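/- Let $T\subset(0,\infty)$ be a nonempty open interval (possibly unbounded). For $s<u$ and values $X_s,X_u$ put $\Delta_{s,u}=\frac{X_u-X_s}{u-s}$ and $\widetilde\Delta_{s,u}=\frac{uX_s-sX_u}{u-s}$, and let $$K(a,b)=1+\eta b+\theta a+\sigma b^2+\tau a^2-(1-\gamma)ab .$$ A square-integrable process $(X_t)_{t\in T}$ is a quadratic harness, $X\in QH(\eta,\theta;\sigma,\tau;\gamma)$ with real parameters and $\gamma\ge-1$, on $T$ with respect to $\sigma$-fields $(\mathcal F_{s,u})_{s<u}$, where $\mathcal F_{r,u}\subset\mathcal F_{s,t}$ for $r\le s<t\le u$ and $X_v$ is $\mathcal F_{s,u}$-measurable for $v\le s$ and for $v\ge u$, if $E X_t=0$, $E X_sX_t=\min\{s,t\}$ and, for all $s<t<u$ in $T$, $$E(X_t\mid\mathcal F_{s,u})=\tfrac{u-t}{u-s}X_s+\tfrac{t-s}{u-s}X_u,\qquad \mathrm{Var}(X_t\mid\mathcal F_{s,u})=\frac{(u-t)(t-s)}{u(1+s\sigma)+\tau-s\gamma}\,K(\Delta_{s,u},\widetilde\Delta_{s,u}).$$ Let $Z=(Z_t)_{t\in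 T}\in QH(\eta,\theta;\sigma,\tau;\gamma)$ be Markov (with respect to its own past), and let $R<V$ be in $T$. For $s<t$ in $(R,V)$ let $$\pi_t(z_R,z_V;U)=\Pr(Z_t\in U\mid Z_R=z_R,Z_V=z_V),\qquad P_{s,t}(x,z_V;U)=\Pr(Z_t\in U\mid Z_s=x,Z_V=z_V)$$ be any regular versions of these conditional laws, and let $S$ be any countable dense subset of $(R,V)$. Then for almost every pair $(z_R,z_V)$ with respect to the law of $(Z_R,Z_V)$ the following holds. Put $\Delta=\frac{z_V-z_R}{V-R}$, $\widetilde\Delta=\frac{Vz_R-Rz_V}{V-R}$, and suppose $K(\Delta,\widetilde\Delta)>0$. Then $$D:=V(1+R\sigma)+\tau-R\gamma>0,\qquad M^2:=K(\Delta,\widetilde\Delta)/D>0 \quad (M>0).$$ There is a bridge $X=(X_t)_{R\le t\le V}$, that is, a process with $X_R=z_R$ and $X_V=z_V$ almost surely, right continuous in probability on $(R,V)$, which at the times of $S$ is Markov with univariate laws $\pi_t(z_R,z_V;\cdot)$ and transition probabilities $P_{s,t}(x,z_V;\cdot)$. For every such $X$ (in particular for every process that is right continuous in probability and has these laws and transition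 probabilities at all times of $(R,V)$) the process $$Y_t=\frac{\sqrt V}{(V-R)M}\left(\Big(\frac tV+1\Big)X_{(t+R)/(t/V+1)}-\Big(t\frac{z_V}{V}+z_R\Big)\right),\qquad t>0,$$ is a quadratic harness on $(0,\infty)$ with respect to its natural $\sigma$-fields $\sigma(Y_r: r\le s\text{ or }r\ge u)$, $Y\in QH(\widetilde\eta,\widetilde\theta;\widetilde\sigma,\widetilde\tau;\widetilde\gamma)$, with $$\widetilde\eta=\frac{-\theta+V\eta-2\tau\Delta+2\sigma V\widetilde\Delta-(1-\gamma)(V\Delta-\widetilde\Delta)}{\sqrt V\,M D},\qquad \widetilde\theta=\frac{\sqrt V\big(\theta-R\eta+2\tau\Delta-2R\sigma\widetilde\Delta-(1-\gamma)(\widetilde\Delta-R\Delta)\big)}{M D},$$ $$\widetilde\sigma=\frac{\sigma V^2+(1-\gamma)V+\tau}{VD},\qquad \widetilde\tau=V\,\frac{\sigma R^2+(1-\gamma)R+\tau}{D},\qquad \widetilde\gamma=\frac{V\gamma-R(V\sigma+1)-\tau}{D}.$$ -/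

import Mathlib

open MeasureTheory ProbabilityTheory Set Filter Topology

namespace QHBridge

/-- `Δ` of a pair of values `x` at time `s` and `y` at time `u`. -/
noncomputable def slope (s u x y : ℝ) : ℝ := (y - x) / (u - s)

/-- `Δ̃` of a pair of values `x` at time `s` and `y` at time `u`. -/
noncomputable def intercept (s u x y : ℝ) : ℝ := (u * x - s * y) / (u - s)

/-- The quadratic polynomial `K(a, b)`; it is used at `a = Δ`, `b = Δ̃`. -/
noncomputable def K (η θ σ τ γ a b : ℝ) : ℝ :=
  1 + η * b + θ * a + σ * b ^ 2 + τ * a ^ 2 - (1 - γ) * a * b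

/-- The quantity `u (1 + s σ) + τ - s γ`. -/
noncomputable def denom (σ τ γ s u : ℝ) : ℝ := u * (1 + s * σ) + τ - s * γ

/-- The non-random factor `F_{t,s,u}`. -/
noncomputable def factor (σ τ γ t s u : ℝ) : ℝ :=
  (u - t) * (t - s) / denom σ τ γ s u

/-- The σ-field generated by `X r`, for `r ∈ T` with `r ≤ s`. -/
def pastField {Ω : Type*} (T : Set ℝ) (X : ℝ → Ω → ℝ) (s : ℝ) : MeasurableSpace Ω :=
  ⨆ r ∈ {r | r ∈ T ∧ r ≤ s}, MeasurableSpace.comap (X r) inferInstance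

/-- The σ-field generated by `X r`, for `r ∈ T` with `r ≤ s` or `u ≤ r`. -/
def outerField {Ω : Type*} (T : Set ℝ) (X : ℝ → Ω → ℝ) (s u : ℝ) : MeasurableSpace Ω :=
  ⨆ r ∈ {r | r ∈ T ∧ (r ≤ s ∨ u ≤ r)}, MeasurableSpace.comap (X r) inferInstance

/-- `X ∈ QH(η, θ; σ, τ; γ)` on the open interval `T ⊆ (0, ∞)` with respect to the family of
σ-fields `F s u`, `s < u` in `T`. Only the values `X t` and `F s u` at times of `T` matter. -/
structure IsQuadraticHarness {Ω : Type*} [mΩ : MeasurableSpace Ω] (μ : Measure Ω) (T : Set ℝ)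
    (F : ℝ → ℝ → MeasurableSpace Ω) (X : ℝ → Ω → ℝ) (η θ σ τ γ : ℝ) : Prop where
  isOpen : IsOpen T
  ordConnected : T.OrdConnected
  nonempty : T.Nonempty
  pos : T ⊆ Ioi 0
  gamma_ge : -1 ≤ γ
  field_le : ∀ s ∈ T, ∀ u ∈ T, s < u → F s u ≤ mΩ
  field_mono : ∀ r ∈ T, ∀ s ∈ T, ∀ t ∈ T, ∀ u ∈ T, r ≤ s → s < t → t ≤ u → F r u ≤ F s t
  measurable : ∀ s ∈ T, ∀ t ∈ T, s < t → ∀ u ∈ T, (u ≤ s ∨ t ≤ u) → Measurable[F s t] (X u)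
  memLp : ∀ t ∈ T, MemLp (X t) 2 μ
  mean : ∀ t ∈ T, ∫ ω, X t ω ∂μ = 0
  cov : ∀ s ∈ T, ∀ t ∈ T, ∫ ω, X s ω * X t ω ∂μ = min s t
  harness : ∀ s ∈ T, ∀ t ∈ T, ∀ u ∈ T, s < t → t < u →
    μ[X t | F s u] =ᵐ[μ] fun ω => (u - t) / (u - s) * X s ω + (t - s) / (u - s) * X u ω
  condVar : ∀ s ∈ T, ∀ t ∈ T, ∀ u ∈ T, s < t → t < u →
    Var[X t; μ | F s u] =ᵐ[μ] fun ω => factor σ τ γ t s u *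
      K η θ σ τ γ (slope s u (X s ω) (X u ω)) (intercept s u (X s ω) (X u ω))

/-- The Markov property of `(X t)`, `t ∈ T`, with respect to its own past. -/
def IsMarkovOn {Ω : Type*} [MeasurableSpace Ω] (μ : Measure Ω) (T : Set ℝ)
    (X : ℝ → Ω → ℝ) : Prop :=
  ∀ s ∈ T, ∀ t ∈ T, s < t → ∀ U : Set ℝ, MeasurableSet U →
    μ⟦X t ⁻¹' U | pastField T X s⟧ =ᵐ[μ]
      μ⟦X t ⁻¹' U | MeasurableSpace.comap (X s) inferInstance⟧

/-- `π t` is a version of the conditional law of `Z t` given `(Z R, Z V)`, and `p s t` is a version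
of the conditional law of `Z t` given `(Z s, Z V)`, for all times in `(R, V)`. -/
structure IsCondLaws {Ω : Type*} [MeasurableSpace Ω] (μ : Measure Ω) (Z : ℝ → Ω → ℝ) (R V : ℝ)
    (π : ℝ → Kernel (ℝ × ℝ) ℝ) (p : ℝ → ℝ → Kernel (ℝ × ℝ) ℝ) : Prop where
  markov_marginal : ∀ t ∈ Ioo R V, IsMarkovKernel (π t)
  marginal : ∀ t ∈ Ioo R V, HasCondDistrib (Z t) (fun ω => (Z R ω, Z V ω)) (π t) μ
  markov_transition : ∀ s ∈ Ioo R V, ∀ t ∈ Ioo R V, s < t → IsMarkovKernel (p s t)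
  transition : ∀ s ∈ Ioo R V, ∀ t ∈ Ioo R V, s < t →
    HasCondDistrib (Z t) (fun ω => (Z s ω, Z V ω)) (p s t) μ

/-- `X t`, `R ≤ t ≤ V`, is the bridge from `zR` at time `R` to `zV` at time `V`: it is the Markov
process with univariate laws `π t (zR, zV)` and transition probabilities `p s t (x, zV)`.

Conditional laws are determined only up to null sets, separately for each time, so the laws are
prescribed at the times of a set `S ⊆ (R, V)` (countable and dense when this is used), and right
continuity in probability determines the law of the process at all other times. A process that is
right continuous in probability (for example has right continuous paths) and is Markov with these
laws and transitions at all times of `(R, V)` satisfies this for every `S ⊆ (R, V)`. -/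
structure IsBridge {Ω : Type*} [MeasurableSpace Ω] (P : Measure Ω) (X : ℝ → Ω → ℝ) (R V zR zV : ℝ)
    (π : ℝ → Kernel (ℝ × ℝ) ℝ) (p : ℝ → ℝ → Kernel (ℝ × ℝ) ℝ) (S : Set ℝ) : Prop where
  measurable : ∀ t ∈ Icc R V, Measurable (X t)
  left_end : ∀ᵐ ω ∂P, X R ω = zR
  right_end : ∀ᵐ ω ∂P, X V ω = zV
  marginal : ∀ t ∈ S, P.map (X t) = π t (zR, zV)
  transition : ∀ s ∈ S, ∀ t ∈ S, s < t → ∀ U : Set ℝ, MeasurableSet U →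
    P⟦X t ⁻¹' U | pastField S X s⟧ =ᵐ[P] fun ω => (p s t (X s ω, zV)).real U
  right_continuous : ∀ t ∈ Ioo R V, TendstoInMeasure P X (𝓝[>] t) (X t)

/-- `K(Δ_{RV}, Δ̃_{RV})` for the endpoint values `zR`, `zV`. -/
noncomputable def KB (η θ σ τ γ R V zR zV : ℝ) : ℝ :=
  K η θ σ τ γ (slope R V zR zV) (intercept R V zR zV)

/-- `M`, the square root of `K(Δ_{RV}, Δ̃_{RV}) / (V (1 + R σ) + τ - R γ)`. -/
noncomputable def MB (η θ σ τ γ R V zR zV : ℝ) : ℝ :=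
  √(KB η θ σ τ γ R V zR zV / denom σ τ γ R V)

/-- The transformed process `Y` with time set `(0, ∞)`. -/
noncomputable def transform {Ω : Type*} (R V zR zV M : ℝ) (X : ℝ → Ω → ℝ) (t : ℝ) (ω : Ω) : ℝ :=
  √V / ((V - R) * M) * ((t / V + 1) * X ((t + R) / (t / V + 1)) ω - (t * (zV / V) + zR))

/-- The parameter `η̃`. -/
noncomputable def etaB (η θ σ τ γ R V zR zV : ℝ) : ℝ :=
  (-θ + V * η - 2 * τ * slope R V zR zV + 2 * σ * V * intercept R V zR zV
      - (1 - γ) * (V * slope R V zR zV - intercept R V zR zV)) /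
    (√V * MB η θ σ τ γ R V zR zV * denom σ τ γ R V)

/-- The parameter `θ̃`. -/
noncomputable def thetaB (η θ σ τ γ R V zR zV : ℝ) : ℝ :=
  √V * (θ - R * η + 2 * τ * slope R V zR zV - 2 * R * σ * intercept R V zR zV
      - (1 - γ) * (intercept R V zR zV - R * slope R V zR zV)) /
    (MB η θ σ τ γ R V zR zV * denom σ τ γ R V)

/-- The parameter `σ̃`. -/
noncomputable def sigmaB (σ τ γ R V : ℝ) : ℝ :=
  (σ * V ^ 2 + (1 - γ) * V + τ) / (V * denom σ τ γ R V)

/-- The parameter `τ̃`. -/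
noncomputable def tauB (σ τ γ R V : ℝ) : ℝ :=
  V * ((σ * R ^ 2 + (1 - γ) * R + τ) / denom σ τ γ R V)

/-- The parameter `γ̃`. -/
noncomputable def gammaB (σ τ γ R V : ℝ) : ℝ :=
  (V * γ - R * (V * σ + 1) - τ) / denom σ τ γ R V

end QHBridge

/-! Write `I = S ∪ {R, V}`, a countable set of times. The path of `Z` on `I` lives in a standard
Borel space, so it has a regular conditional law given `(Z R, Z V)`. Both harness identities say
that some function has zero integral over every event outside `(s, u)`. For `R ≤ s < u ≤ V` these
events include those of the endpoint pair, so conditioning on the endpoints stays inside the same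
σ-field and the identities survive for almost every pair. Countability of `I` and countable
generation of the σ-fields leave a single null set (`ae_condDistrib_setIntegral_eq_zero`,
`IsHarnessOn.ae_condDistrib`). The Markov property makes `p s t` the conditional law of `Z t` given
`Z V` and the whole past up to `s` (`IsMarkovOn.setIntegral_transition`), and this also survives
conditioning. So almost every conditional law is that of a bridge on `I`
(`IsQuadraticHarness.ae_isBridgeLaw`).

Any other bridge with the same endpoint values has the same law on `I`, because marginals and
transitions determine a Markov law (`map_path_eq_of_transitions`); hence it is a harness there.
Reading the identities at the pair `R, V`, where the values are constant, gives mean `interp R t V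
zR zV` and covariance `(V - t) (s - R) M²` for `s ≤ t`. The process is therefore Hölder of order one
half in `L²`. This estimate extends the law from `S` to a bridge on the whole interval
(`exists_extension_of_dense`), and it carries the identities of a given bridge from `S` to all times
(`IsHarnessOn.extend`).

What remains is algebra. The time change is a Möbius map, and multiplication by `t / V + 1` turns
affine functions of the new time into affine functions of `t`. So deviations are merely rescaled,
while slope and intercept undergo a linear change of variables after subtraction of those of the
endpoints. Expanding `K` at the endpoint values produces the new parameters (`K_transform`,
`denom_transform`).

The denominator is nonzero because the unconditional covariances forbid a vanishing conditional
variance, and it cannot be negative where `K` is positive because a conditional variance is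
nonnegative. -/

namespace QHBridge

/-! ### Zero conditional expectations under regular conditional laws -/

/-- The σ-field generated by countably many countably generated σ-fields is countably generated. -/
theorem countablyGenerated_iSup {α ι : Type*} [Countable ι] {m : ι → MeasurableSpace α}
    (h : ∀ i, @MeasurableSpace.CountablyGenerated α (m i)) :
    @MeasurableSpace.CountablyGenerated α (⨆ i, m i) := by
  have h' : ∀ i, ∃ b : Set (Set α), b.Countable ∧ m i = MeasurableSpace.generateFrom b :=
    fun i => (h i).isCountablyGenerated
  choose b hb hm using h'
  refine @MeasurableSpace.CountablyGenerated.mk _ (_) ⟨⋃ i, b i, countable_iUnion hb, ?_⟩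
  rw [← MeasurableSpace.iSup_generateFrom]
  exact iSup_congr hm

/-- Vanishing of the set integrals of `f` extends from a π-system to the σ-field it generates. -/
theorem setIntegral_eq_zero_of_generateFrom {α : Type*} {m : MeasurableSpace α}
    [m0 : MeasurableSpace α] {ν : Measure α}
    {f : α → ℝ} (hf : Integrable f ν) (hm : m ≤ m0) {C : Set (Set α)}
    (hC : m = MeasurableSpace.generateFrom C) (hpi : IsPiSystem C) (huniv : ∫ x, f x ∂ν = 0)
    (h : ∀ A ∈ C, ∫ x in A, f x ∂ν = 0) (A : Set α) (hA : MeasurableSet[m] A) :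
    ∫ x in A, f x ∂ν = 0 := by
  refine MeasurableSpace.induction_on_inter (m := m) (C := fun A _ => ∫ x in A, f x ∂ν = 0)
    hC hpi (by simp) h ?_ ?_ A hA
  · intro t ht h0
    rw [setIntegral_compl (hm t ht) hf, huniv, h0, sub_zero]
  · intro g hd hg h0
    rw [integral_iUnion (fun i => hm _ (hg i)) hd hf.integrableOn]
    simp [h0]

/-- If `f` has zero conditional expectation given `m` under `ρ`, and `ψ` is `m`-measurable, then
the same holds under almost all conditional laws given `ψ`. -/
theorem ae_condDistrib_setIntegral_eq_zero {E β : Type*} {m : MeasurableSpace E}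
    [mE : MeasurableSpace E] [StandardBorelSpace E] [Nonempty E] [mβ : MeasurableSpace β]
    (ρ : Measure E) [IsFiniteMeasure ρ]
    {ψ : E → β} (hm : m ≤ mE)
    (hcg : @MeasurableSpace.CountablyGenerated E m) (hψ : Measurable[m] ψ) {f : E → ℝ}
    (hfm : Measurable f) (hf : Integrable f ρ)
    (h : ∀ A, MeasurableSet[m] A → ∫ x in A, f x ∂ρ = 0) :
    ∀ᵐ z ∂ρ.map ψ, Integrable f (condDistrib id ψ ρ z) ∧
      ∀ A, MeasurableSet[m] A → ∫ x in A, f x ∂(condDistrib id ψ ρ z) = 0 := by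
  have hψ' : Measurable ψ := hψ.mono hm le_rfl
  obtain ⟨b, hb, hmb⟩ := hcg.isCountablyGenerated
  -- The algebra generated by a countable generator is a countable π-system, so one null set serves
  -- all its members.
  set C := generateSetAlgebra b with hCdef
  have hC : m = MeasurableSpace.generateFrom C := by
    rw [hCdef, generateFrom_generateSetAlgebra_eq]; exact hmb
  have hCc : C.Countable := countable_generateSetAlgebra hb
  have hCm : ∀ A ∈ C, MeasurableSet[m] A := fun A hA => by
    rw [hC]; exact MeasurableSpace.measurableSet_generateFrom hA
  have hpi : IsPiSystem C := fun s hs t ht _ => isSetAlgebra_generateSetAlgebra.inter_mem hs ht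
  have key : ∀ A, MeasurableSet[m] A →
      ∀ᵐ z ∂ρ.map ψ, ∫ x in A, f x ∂(condDistrib id ψ ρ z) = 0 := by
    intro A hA
    have hA' : MeasurableSet A := hm A hA
    have hg : StronglyMeasurable (A.indicator f) := (hfm.indicator hA').stronglyMeasurable
    have hmeas : StronglyMeasurable
        fun z => ∫ x, A.indicator f x ∂(condDistrib id ψ ρ z) :=
      (StronglyMeasurable.integral_condDistrib (hg.comp_measurable measurable_snd))
    simp_rw [← integral_indicator hA']
    refine (ae_map_iff (p := fun z => ∫ x, A.indicator f x ∂(condDistrib id ψ ρ z) = 0)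
      hψ'.aemeasurable (hmeas.measurable (measurableSet_singleton 0))).2 ?_
    have h1 := condExp_ae_eq_integral_condDistrib (μ := ρ) hψ' aemeasurable_id hg
      (hf.indicator hA')
    -- Since `ψ` is `m`-measurable, `ψ ⁻¹' B ∩ A` is again an event of `m`, where the integral of
    -- `f` vanishes.
    have h2 : (fun _ => (0 : ℝ)) =ᵐ[ρ] ρ[fun a => A.indicator f (id a) | mβ.comap ψ] := by
      refine ae_eq_condExp_of_forall_setIntegral_eq hψ'.comap_le (hf.indicator hA')
        (fun _ _ _ => (integrable_zero _ _ _).integrableOn) ?_ aestronglyMeasurable_const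
      rintro _ ⟨B, hB, rfl⟩ _
      simp only [id_eq]
      rw [setIntegral_indicator hA', h _ ((hψ hB).inter hA)]
      simp
    filter_upwards [h1, h2] with x hx1 hx2
    rw [← hx1, ← hx2]
  have hint : ∀ᵐ z ∂ρ.map ψ, Integrable f (condDistrib id ψ ρ z) := by
    exact Integrable.condDistrib_ae_map (mβ := mβ) (X := ψ) (Y := id)
      (f := fun q : β × E => f q.2) aemeasurable_id (μ := ρ) (hf.comp_snd_map_prodMk ψ)
  have hall : ∀ᵐ z ∂ρ.map ψ, ∀ A ∈ C, ∫ x in A, f x ∂(condDistrib id ψ ρ z) = 0 :=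
    (ae_ball_iff hCc).2 fun A hA => key A (hCm A hA)
  filter_upwards [hint, hall, key univ MeasurableSet.univ] with z hz1 hz2 hz3
  exact ⟨hz1, fun A hA => setIntegral_eq_zero_of_generateFrom hz1 hm hC hpi
    (by simpa using hz3) hz2 A hA⟩

/-! ### Orthogonality to a σ-field -/

section Orthogonality

variable {Ω : Type*} {m m₁ m₂ : MeasurableSpace Ω}

/-- The intersections of sets of two σ-fields form a π-system generating their supremum. -/
theorem sup_eq_generateFrom_inter :
    m₁ ⊔ m₂ = MeasurableSpace.generateFrom
      {s | ∃ a b, MeasurableSet[m₁] a ∧ MeasurableSet[m₂] b ∧ s = a ∩ b} := by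
  refine le_antisymm (sup_le ?_ ?_) (MeasurableSpace.generateFrom_le ?_)
  · exact fun a ha => MeasurableSpace.measurableSet_generateFrom
      ⟨a, univ, ha, MeasurableSet.univ, by simp⟩
  · exact fun a ha => MeasurableSpace.measurableSet_generateFrom
      ⟨univ, a, MeasurableSet.univ, ha, by simp⟩
  · rintro _ ⟨a, b, ha, hb, rfl⟩
    exact MeasurableSet.inter (m := m₁ ⊔ m₂) ((le_sup_left : m₁ ≤ m₁ ⊔ m₂) a ha)
      ((le_sup_right : m₂ ≤ m₁ ⊔ m₂) b hb)

theorem isPiSystem_inter :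
    IsPiSystem {s : Set Ω | ∃ a b, MeasurableSet[m₁] a ∧ MeasurableSet[m₂] b ∧ s = a ∩ b} := by
  rintro _ ⟨a, b, ha, hb, rfl⟩ _ ⟨a', b', ha', hb', rfl⟩ _
  exact ⟨a ∩ a', b ∩ b', ha.inter ha', hb.inter hb', inter_inter_inter_comm _ _ _ _⟩

theorem norm_indicator_one_le (C : Set Ω) (x : Ω) : ‖C.indicator (fun _ => (1 : ℝ)) x‖ ≤ 1 := by
  by_cases hx : x ∈ C <;> simp [hx]

variable [mΩ : MeasurableSpace Ω] {μ : Measure Ω}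

theorem condExp_ae_eq_zero_of_forall_setIntegral_eq_zero [IsFiniteMeasure μ] (hm : m ≤ mΩ)
    {f : Ω → ℝ} (hf : Integrable f μ) (h0 : ∀ A, MeasurableSet[m] A → ∫ x in A, f x ∂μ = 0) :
    μ[f | m] =ᵐ[μ] 0 := by
  refine (ae_eq_condExp_of_forall_setIntegral_eq hm hf
    (fun _ _ _ => (integrable_zero _ _ _).integrableOn) ?_ aestronglyMeasurable_zero).symm
  intro A hA _
  rw [h0 A hA]
  simp

/-- A function with zero conditional expectation given `m` is orthogonal to all bounded
`m`-measurable functions. -/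
theorem integral_mul_eq_zero [IsFiniteMeasure μ] (hm : m ≤ mΩ) {f h : Ω → ℝ}
    (hf : Integrable f μ) (h0 : ∀ A, MeasurableSet[m] A → ∫ x in A, f x ∂μ = 0)
    (hh : StronglyMeasurable[m] h) {c : ℝ} (hb : ∀ᵐ x ∂μ, ‖h x‖ ≤ c) :
    ∫ x, h x * f x ∂μ = 0 := by
  have h1 := condExp_ae_eq_zero_of_forall_setIntegral_eq_zero hm hf h0
  have h2 := condExp_stronglyMeasurable_mul_of_bound hm hh hf c hb
  change ∫ x, (h * f) x ∂μ = 0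
  rw [← integral_condExp hm, integral_congr_ae h2]
  have : (h * μ[f | m]) =ᵐ[μ] 0 := by
    filter_upwards [h1] with x hx
    simp [hx]
  rw [integral_congr_ae this]
  simp

/-- Rectangles `a ∩ b` form a π-system generating the supremum. This separates past from future in
the Markov arguments. -/
theorem setIntegral_eq_zero_of_sup (h₁ : m₁ ≤ mΩ) (h₂ : m₂ ≤ mΩ) {f : Ω → ℝ}
    (hf : Integrable f μ)
    (h : ∀ a b, MeasurableSet[m₁] a → MeasurableSet[m₂] b → ∫ x in a ∩ b, f x ∂μ = 0)
    (A : Set Ω) (hA : MeasurableSet[m₁ ⊔ m₂] A) : ∫ x in A, f x ∂μ = 0 := by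
  refine setIntegral_eq_zero_of_generateFrom hf (sup_le h₁ h₂) sup_eq_generateFrom_inter
    isPiSystem_inter ?_ ?_ A hA
  · simpa using h univ univ MeasurableSet.univ MeasurableSet.univ
  · rintro _ ⟨a, b, ha, hb, rfl⟩
    exact h a b ha hb

theorem integral_indicator_sub_kernel [IsFiniteMeasure μ] {E : Type*} [MeasurableSpace E]
    {κ : Kernel E ℝ} [IsMarkovKernel κ] {Y : Ω → ℝ} {W : Ω → E} (hY : Measurable Y)
    (hW : Measurable W) {U : Set ℝ} (hU : MeasurableSet U) :
    ∫ ω, ((Y ⁻¹' U).indicator (fun _ => (1 : ℝ)) ω - (κ (W ω)).real U) ∂μ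
      = (μ (Y ⁻¹' U)).toReal - (∫⁻ ω, κ (W ω) U ∂μ).toReal := by
  have hκU : Measurable fun q => (κ q).real U := (κ.measurable_coe hU).ennreal_toReal
  rw [integral_sub ((integrable_const (1 : ℝ)).indicator (hY hU)), integral_indicator (hY hU),
    setIntegral_const, smul_eq_mul, mul_one, measureReal_def]
  · simp only [measureReal_def]
    rw [integral_toReal]
    · exact ((κ.measurable_coe hU).comp hW).aemeasurable
    · exact ae_of_all _ fun ω => measure_lt_top _ _
  · refine Integrable.of_bound (hκU.comp hW).aestronglyMeasurable 1 (ae_of_all _ fun ω => ?_)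
    rw [Real.norm_eq_abs, abs_of_nonneg measureReal_nonneg]
    exact measureReal_le_one

/-- To identify a conditional law it is enough to test it on the sets `Iic q`, `q` rational. -/
theorem integral_indicator_sub_kernel_eq_zero [IsFiniteMeasure μ] {E : Type*} [MeasurableSpace E]
    {κ : Kernel E ℝ} [IsMarkovKernel κ] {Y : Ω → ℝ} {W : Ω → E} (hY : Measurable Y)
    (hW : Measurable W)
    (h : ∀ q : ℚ, ∫ ω, ((Y ⁻¹' Iic (q : ℝ)).indicator (fun _ => (1 : ℝ)) ω
      - (κ (W ω)).real (Iic (q : ℝ))) ∂μ = 0) {U : Set ℝ} (hU : MeasurableSet U) :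
    ∫ ω, ((Y ⁻¹' U).indicator (fun _ => (1 : ℝ)) ω - (κ (W ω)).real U) ∂μ = 0 := by
  have hbind : ∀ U : Set ℝ, MeasurableSet U →
      (μ.map W).bind κ U = ∫⁻ ω, κ (W ω) U ∂μ := fun U hU => by
    rw [Measure.bind_apply hU κ.measurable.aemeasurable, lintegral_map (κ.measurable_coe hU) hW]
  -- The hypothesis compares the law of `Y` with the mixture of `κ` over the law of `W` on rational
  -- half-lines, which already determine a finite measure.
  have key : μ.map Y = (μ.map W).bind κ := by
    refine ext_of_generate_finite (⋃ a : ℚ, {Iic (a : ℝ)})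
      (by rw [← Real.borel_eq_generateFrom_Iic_rat]; exact BorelSpace.measurable_eq)
      Real.isPiSystem_Iic_rat ?_ ?_
    · simp only [mem_iUnion, mem_singleton_iff]
      rintro _ ⟨q, rfl⟩
      have hq := h q
      rw [integral_indicator_sub_kernel hY hW measurableSet_Iic, sub_eq_zero,
        ← hbind _ measurableSet_Iic, ENNReal.toReal_eq_toReal_iff' (measure_ne_top _ _)
        (measure_ne_top _ _)] at hq
      rw [Measure.map_apply hY measurableSet_Iic, hq]
    · rw [hbind _ MeasurableSet.univ, Measure.map_apply hY MeasurableSet.univ]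
      simp
  rw [integral_indicator_sub_kernel hY hW hU, ← hbind U hU, ← key,
    Measure.map_apply hY hU, sub_self]

theorem integrable_of_bound [IsFiniteMeasure μ] {f : Ω → ℝ} (hm : m ≤ mΩ)
    (hf : StronglyMeasurable[m] f) {c : ℝ} (hb : ∀ᵐ x ∂μ, ‖f x‖ ≤ c) : Integrable f μ :=
  Integrable.of_bound (hf.mono hm).aestronglyMeasurable c hb

theorem ae_norm_condExp_indicator_le [IsFiniteMeasure μ] (C : Set Ω) :
    ∀ᵐ x ∂μ, ‖(μ⟦C | m⟧) x‖ ≤ 1 := by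
  exact ae_bdd_abs_condExp_of_ae_bdd_abs (ae_of_all _ fun x => norm_indicator_one_le C x)

theorem setIntegral_indicator_sub_condExp [IsFiniteMeasure μ] (hm : m ≤ mΩ) {C : Set Ω}
    (hC : MeasurableSet C) (A : Set Ω) (hA : MeasurableSet[m] A) :
    ∫ x in A, (C.indicator (fun _ => (1 : ℝ)) x - (μ⟦C | m⟧) x) ∂μ = 0 := by
  have hi : Integrable (C.indicator fun _ => (1 : ℝ)) μ := (integrable_const 1).indicator hC
  rw [integral_sub hi.integrableOn integrable_condExp.integrableOn, setIntegral_condExp hm hi hA,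
    sub_self]

end Orthogonality

/-! ### Past and outer σ-fields -/

section Fields

variable {Ω : Type*} {T : Set ℝ} {X : ℝ → Ω → ℝ} {s u : ℝ}

theorem comap_le_pastField {r : ℝ} (hr : r ∈ T) (hrs : r ≤ s) :
    MeasurableSpace.comap (X r) inferInstance ≤ pastField T X s :=
  le_iSup₂_of_le (f := fun r (_ : r ∈ {r | r ∈ T ∧ r ≤ s}) =>
    MeasurableSpace.comap (X r) inferInstance) r ⟨hr, hrs⟩ le_rfl

theorem comap_le_outerField {r : ℝ} (hr : r ∈ T) (h : r ≤ s ∨ u ≤ r) :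
    MeasurableSpace.comap (X r) inferInstance ≤ outerField T X s u :=
  le_iSup₂_of_le (f := fun r (_ : r ∈ {r | r ∈ T ∧ (r ≤ s ∨ u ≤ r)}) =>
    MeasurableSpace.comap (X r) inferInstance) r ⟨hr, h⟩ le_rfl

theorem measurable_outerField {r : ℝ} (hr : r ∈ T) (h : r ≤ s ∨ u ≤ r) :
    Measurable[outerField T X s u] (X r) :=
  Measurable.of_comap_le (comap_le_outerField hr h)

theorem measurable_pastField {r : ℝ} (hr : r ∈ T) (hrs : r ≤ s) :
    Measurable[pastField T X s] (X r) :=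
  Measurable.of_comap_le (comap_le_pastField hr hrs)

theorem pastField_mono {s' : ℝ} (h : s ≤ s') : pastField T X s ≤ pastField T X s' :=
  iSup₂_le fun _ hr => comap_le_pastField hr.1 (hr.2.trans h)

theorem pastField_le [mΩ : MeasurableSpace Ω] (hX : ∀ t ∈ T, Measurable (X t)) :
    pastField T X s ≤ mΩ :=
  iSup₂_le fun r hr => (hX r hr.1).comap_le

theorem outerField_le [mΩ : MeasurableSpace Ω] (hX : ∀ t ∈ T, Measurable (X t)) :
    outerField T X s u ≤ mΩ :=
  iSup₂_le fun r hr => (hX r hr.1).comap_le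

end Fields

/-! ### Consequences of the Markov property -/

section Markov

variable {Ω : Type*} [mΩ : MeasurableSpace Ω] {μ : Measure Ω} [IsProbabilityMeasure μ]
  {T : Set ℝ} {X : ℝ → Ω → ℝ}

/-- Against a function of the past, the indicator of a future event can be replaced by its
conditional expectation given the past, which by the Markov property is a function of `X s`; and `f`
is orthogonal to bounded functions of `X s`. -/
theorem IsMarkovOn.setIntegral_future_eq_zero (hM : IsMarkovOn μ T X)
    (hX : ∀ t ∈ T, Measurable (X t)) {s t : ℝ} (hs : s ∈ T) (ht : t ∈ T) (hst : s < t)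
    {f : Ω → ℝ} (hf : StronglyMeasurable[pastField T X s] f) {c : ℝ} (hb : ∀ᵐ x ∂μ, ‖f x‖ ≤ c)
    (h0 : ∀ D, MeasurableSet[MeasurableSpace.comap (X s) inferInstance] D → ∫ x in D, f x ∂μ = 0)
    (C : Set Ω) (hC : MeasurableSet[MeasurableSpace.comap (X t) inferInstance] C) :
    ∫ x in C, f x ∂μ = 0 := by
  obtain ⟨U, hU, rfl⟩ := hC
  have hpast : pastField T X s ≤ mΩ := pastField_le hX
  have hfi : Integrable f μ := integrable_of_bound hpast hf hb
  have hCm : MeasurableSet (X t ⁻¹' U) := hX t ht hU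
  have e1 := integral_mul_eq_zero hpast
    (((integrable_const 1).indicator hCm).sub integrable_condExp)
    (setIntegral_indicator_sub_condExp (μ := μ) hpast hCm) hf hb
  have e2 := integral_mul_eq_zero (hX s hs).comap_le hfi h0
    (stronglyMeasurable_condExp (f := (X t ⁻¹' U).indicator fun _ => (1 : ℝ)) (μ := μ))
    (ae_norm_condExp_indicator_le _)
  rw [← integral_indicator hCm]
  have hi1 : Integrable (fun x => f x * (X t ⁻¹' U).indicator (fun _ => (1 : ℝ)) x) μ :=
    hfi.mul_bdd (c := 1) ((measurable_const.indicator hCm).aestronglyMeasurable)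
      (ae_of_all _ (norm_indicator_one_le _))
  have hi2 : Integrable (fun x => f x * (μ⟦X t ⁻¹' U | pastField T X s⟧) x) μ :=
    hfi.mul_bdd (c := 1) ((stronglyMeasurable_condExp.mono hpast).aestronglyMeasurable)
      (ae_norm_condExp_indicator_le _)
  have e3 : ∫ x, f x * (μ⟦X t ⁻¹' U | pastField T X s⟧) x ∂μ = 0 := by
    rw [← e2]
    refine integral_congr_ae ?_
    filter_upwards [hM s hs t ht hst U hU] with x hx
    rw [hx, mul_comm]
  simp only [Pi.sub_apply, mul_sub] at e1
  rw [integral_sub hi1 hi2, e3, sub_zero] at e1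
  rw [← e1]
  refine integral_congr_ae (ae_of_all _ fun x => ?_)
  by_cases hx : x ∈ X t ⁻¹' U <;> simp [hx]

/-- Cutting `f` off to `X t ∈ U` gives a function of the past of `t`. It is centred given `X t` by
the one-time statement, so the same argument can be repeated from `t` to `v`. -/
theorem IsMarkovOn.setIntegral_two_times_eq_zero (hM : IsMarkovOn μ T X)
    (hX : ∀ t ∈ T, Measurable (X t)) {s t v : ℝ} (hs : s ∈ T) (ht : t ∈ T) (hv : v ∈ T)
    (hst : s < t) (htv : t < v)
    {f : Ω → ℝ} (hf : StronglyMeasurable[pastField T X s] f) {c : ℝ} (hb : ∀ᵐ x ∂μ, ‖f x‖ ≤ c)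
    (h0 : ∀ D, MeasurableSet[MeasurableSpace.comap (X s) inferInstance] D → ∫ x in D, f x ∂μ = 0)
    {U B : Set ℝ} (hU : MeasurableSet U) (hB : MeasurableSet B) :
    ∫ x in X t ⁻¹' U ∩ X v ⁻¹' B, f x ∂μ = 0 := by
  have hps : pastField T X s ≤ mΩ := pastField_le hX
  have hpt : pastField T X t ≤ mΩ := pastField_le hX
  have hfi : Integrable f μ := integrable_of_bound hps hf hb
  have hUm : MeasurableSet (X t ⁻¹' U) := hX t ht hU
  have hBm : MeasurableSet (X v ⁻¹' B) := hX v hv hB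
  set h : Ω → ℝ := (X t ⁻¹' U).indicator f with hh
  have hhm : StronglyMeasurable[pastField T X t] h :=
    (hf.mono (pastField_mono hst.le)).indicator (measurable_pastField ht le_rfl hU)
  have hhb : ∀ᵐ x ∂μ, ‖h x‖ ≤ c := by
    filter_upwards [hb] with x hx
    exact (norm_indicator_le_norm_self _ _).trans hx
  have hhi : Integrable h μ := integrable_of_bound hpt hhm hhb
  have e1 := integral_mul_eq_zero hpt
    (((integrable_const 1).indicator hBm).sub integrable_condExp)
    (setIntegral_indicator_sub_condExp (μ := μ) hpt hBm) hhm hhb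
  have hh0 : ∀ D, MeasurableSet[MeasurableSpace.comap (X t) inferInstance] D →
      ∫ x in D, h x ∂μ = 0 := by
    intro D hD
    rw [hh, setIntegral_indicator hUm]
    exact hM.setIntegral_future_eq_zero hX hs ht hst hf hb h0 _ (hD.inter ⟨U, hU, rfl⟩)
  have e2 := integral_mul_eq_zero (hX t ht).comap_le hhi hh0
    (stronglyMeasurable_condExp (f := (X v ⁻¹' B).indicator fun _ => (1 : ℝ)) (μ := μ))
    (ae_norm_condExp_indicator_le _)
  have hi1 : Integrable (fun x => h x * (X v ⁻¹' B).indicator (fun _ => (1 : ℝ)) x) μ :=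
    hhi.mul_bdd (c := 1) ((measurable_const.indicator hBm).aestronglyMeasurable)
      (ae_of_all _ (norm_indicator_one_le _))
  have hi2 : Integrable (fun x => h x * (μ⟦X v ⁻¹' B | pastField T X t⟧) x) μ :=
    hhi.mul_bdd (c := 1) ((stronglyMeasurable_condExp.mono hpt).aestronglyMeasurable)
      (ae_norm_condExp_indicator_le _)
  have e3 : ∫ x, h x * (μ⟦X v ⁻¹' B | pastField T X t⟧) x ∂μ = 0 := by
    rw [← e2]
    refine integral_congr_ae ?_
    filter_upwards [hM t ht v hv htv B hB] with x hx
    rw [hx, mul_comm]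
  simp only [Pi.sub_apply, mul_sub] at e1
  rw [integral_sub hi1 hi2, e3, sub_zero] at e1
  rw [← e1, ← integral_indicator (hUm.inter hBm)]
  refine integral_congr_ae (ae_of_all _ fun x => ?_)
  by_cases hx : x ∈ X t ⁻¹' U <;> by_cases hx' : x ∈ X v ⁻¹' B <;> simp [hh, hx, hx']

/-- The σ-field generated by `X s`, `X t` and `X v`. -/
def threeField {Ω : Type*} (X : ℝ → Ω → ℝ) (s t v : ℝ) : MeasurableSpace Ω :=
  MeasurableSpace.comap (X s) inferInstance ⊔
    (MeasurableSpace.comap (X t) inferInstance ⊔ MeasurableSpace.comap (X v) inferInstance)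

/-- Given the present `X s`, a centred bounded function of the past is orthogonal to the present
and two future times. -/
theorem IsMarkovOn.setIntegral_sup_eq_zero (hM : IsMarkovOn μ T X)
    (hX : ∀ t ∈ T, Measurable (X t)) {s t v : ℝ} (hs : s ∈ T) (ht : t ∈ T) (hv : v ∈ T)
    (hst : s < t) (htv : t < v)
    {f : Ω → ℝ} (hf : StronglyMeasurable[pastField T X s] f) {c : ℝ} (hb : ∀ᵐ x ∂μ, ‖f x‖ ≤ c)
    (h0 : ∀ D, MeasurableSet[MeasurableSpace.comap (X s) inferInstance] D → ∫ x in D, f x ∂μ = 0)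
    (C : Set Ω) (hC : MeasurableSet[threeField X s t v] C) :
    ∫ x in C, f x ∂μ = 0 := by
  have hps : pastField T X s ≤ mΩ := pastField_le hX
  have hfi : Integrable f μ := integrable_of_bound hps hf hb
  have h2 := sup_le (hX t ht).comap_le (hX v hv).comap_le
  refine setIntegral_eq_zero_of_sup (hX s hs).comap_le h2 hfi ?_ C hC
  intro D G hD hG
  have hDm := (hX s hs).comap_le _ hD
  -- The event of the present is absorbed into `f`, which stays measurable for the past and centred
  -- given `X s`.
  rw [inter_comm, ← setIntegral_indicator hDm]
  refine setIntegral_eq_zero_of_sup (hX t ht).comap_le (hX v hv).comap_le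
    (hfi.indicator hDm) ?_ G hG
  rintro _ _ ⟨U, hU, rfl⟩ ⟨B, hB, rfl⟩
  refine hM.setIntegral_two_times_eq_zero hX hs ht hv hst htv
    (hf.indicator (comap_le_pastField hs le_rfl _ hD)) (c := c) ?_ ?_ hU hB
  · filter_upwards [hb] with x hx
    exact (norm_indicator_le_norm_self _ _).trans hx
  · intro D' hD'
    rw [setIntegral_indicator hDm]
    exact h0 _ (hD'.inter hD)

/-- A version of the conditional law of `X t` given `(X s, X v)` is a version of its conditional
law given `X v` and the whole past up to time `s`. -/
theorem IsMarkovOn.setIntegral_transition (hM : IsMarkovOn μ T X)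
    (hX : ∀ t ∈ T, Measurable (X t)) {s t v : ℝ} (hs : s ∈ T) (ht : t ∈ T) (hv : v ∈ T)
    (hst : s < t) (htv : t < v) {κ : Kernel (ℝ × ℝ) ℝ} [IsMarkovKernel κ]
    (hκ : HasCondDistrib (X t) (fun ω => (X s ω, X v ω)) κ μ) {U : Set ℝ} (hU : MeasurableSet U)
    (A : Set Ω)
    (hA : MeasurableSet[pastField T X s ⊔ MeasurableSpace.comap (X v) inferInstance] A) :
    ∫ ω in A, ((X t ⁻¹' U).indicator (fun _ => (1 : ℝ)) ω - (κ (X s ω, X v ω)).real U) ∂μ = 0 := by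
  have hps : pastField T X s ≤ mΩ := pastField_le hX
  have hUm : MeasurableSet (X t ⁻¹' U) := hX t ht hU
  have hpair : Measurable fun ω => (X s ω, X v ω) := (hX s hs).prodMk (hX v hv)
  have hκU : Measurable fun q => (κ q).real U := (κ.measurable_coe hU).ennreal_toReal
  have hm3 : threeField X s t v ≤ mΩ :=
    sup_le (hX s hs).comap_le (sup_le (hX t ht).comap_le (hX v hv).comap_le)
  have hXs : Measurable[threeField X s t v] (X s) := Measurable.of_comap_le le_sup_left
  have hXt : Measurable[threeField X s t v] (X t) :=
    Measurable.of_comap_le (le_sup_of_le_right le_sup_left)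
  have hXv : Measurable[threeField X s t v] (X v) :=
    Measurable.of_comap_le (le_sup_of_le_right le_sup_right)
  set g : Ω → ℝ := fun ω => (X t ⁻¹' U).indicator (fun _ => (1 : ℝ)) ω
    - (κ (X s ω, X v ω)).real U with hg
  have hgm : StronglyMeasurable[threeField X s t v] g := by
    refine Measurable.stronglyMeasurable ?_
    exact (measurable_const.indicator (hXt hU)).sub (hκU.comp (hXs.prodMk hXv))
  have hgb : ∀ ω, ‖g ω‖ ≤ 1 := by
    intro ω
    have h1 : (κ (X s ω, X v ω)).real U ≤ 1 := measureReal_le_one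
    have h2 : 0 ≤ (κ (X s ω, X v ω)).real U := measureReal_nonneg
    rw [hg, Real.norm_eq_abs, abs_le]
    by_cases hx : ω ∈ X t ⁻¹' U <;> simp only [hx, indicator_of_mem, indicator_of_notMem,
      not_false_eq_true] <;> constructor <;> linarith
  have hgi : Integrable g μ := integrable_of_bound hm3 hgm (ae_of_all _ hgb)
  -- the defining property of the conditional law, on sets of `σ(X s, X v)`
  have hg0 : ∀ D, MeasurableSet[MeasurableSpace.comap (fun ω => (X s ω, X v ω)) inferInstance] D →
      ∫ ω in D, g ω ∂μ = 0 := by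
    rintro _ ⟨D, hD, rfl⟩
    have hDm := hpair hD
    have e : μ ((fun ω => (X s ω, X v ω)) ⁻¹' D ∩ X t ⁻¹' U)
        = ∫⁻ ω in (fun ω => (X s ω, X v ω)) ⁻¹' D, κ (X s ω, X v ω) U ∂μ := by
      have := congrArg (fun ν => ν (D ×ˢ U)) hκ.map_eq
      simp only at this
      rw [Measure.map_apply (hpair.prodMk (hX t ht)) (hD.prod hU),
        Measure.compProd_apply_prod hD hU, setLIntegral_map hD (κ.measurable_coe hU) hpair] at this
      exact this
    rw [hg, integral_indicator_sub_kernel (hX t ht) hpair hU, Measure.restrict_apply hUm,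
      inter_comm, e, sub_self]
  refine setIntegral_eq_zero_of_sup hps (hX v hv).comap_le hgi ?_ A hA
  intro A B hA hB
  have hAm := hps _ hA
  have hBm := (hX v hv).comap_le _ hB
  -- Split the indicator of `A` as `f + a`. The part `f` is centred given `X s`, hence orthogonal to
  -- `B.indicator g`, a function of `X s`, `X t`, `X v`. The part `a` is a function of `X s`, so
  -- `B.indicator a` is a function of `(X s, X v)`, to which `g` is orthogonal by the definition of
  -- `κ`.
  set a : Ω → ℝ := μ⟦A | MeasurableSpace.comap (X s) inferInstance⟧ with ha
  have ham : StronglyMeasurable[MeasurableSpace.comap (X s) inferInstance] a :=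
    stronglyMeasurable_condExp
  have hab : ∀ᵐ ω ∂μ, ‖a ω‖ ≤ 1 := ae_norm_condExp_indicator_le _
  set f : Ω → ℝ := fun ω => A.indicator (fun _ => (1 : ℝ)) ω - a ω with hf
  have hfm : StronglyMeasurable[pastField T X s] f :=
    (stronglyMeasurable_const.indicator hA).sub (ham.mono (comap_le_pastField hs le_rfl))
  have hfb : ∀ᵐ ω ∂μ, ‖f ω‖ ≤ 2 := by
    filter_upwards [hab] with ω h
    refine (norm_sub_le _ _).trans ?_
    have := norm_indicator_one_le A ω
    linarith
  have hfi : Integrable f μ := integrable_of_bound hps hfm hfb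
  have hf0 := hM.setIntegral_sup_eq_zero hX hs ht hv hst htv hfm hfb
    (setIntegral_indicator_sub_condExp (hX s hs).comap_le hAm)
  have hgBm : StronglyMeasurable[threeField X s t v] (B.indicator g) :=
    hgm.indicator ((le_sup_of_le_right le_sup_right :
      MeasurableSpace.comap (X v) inferInstance ≤ threeField X s t v) _ hB)
  have hgBb : ∀ᵐ ω ∂μ, ‖B.indicator g ω‖ ≤ 1 :=
    ae_of_all _ fun ω => (norm_indicator_le_norm_self _ _).trans (hgb ω)
  have e1 := integral_mul_eq_zero hm3 hfi hf0 hgBm hgBb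
  have hmp : MeasurableSpace.comap (fun ω => (X s ω, X v ω)) inferInstance
      = MeasurableSpace.comap (X s) inferInstance ⊔ MeasurableSpace.comap (X v) inferInstance :=
    MeasurableSpace.comap_prodMk _ _
  have e2 := integral_mul_eq_zero hpair.comap_le hgi hg0
    (h := B.indicator a) (c := 1) ((ham.mono (by rw [hmp]; exact le_sup_left)).indicator
      (by rw [hmp]; exact (le_sup_right : MeasurableSpace.comap (X v) inferInstance ≤ _) _ hB))
    (by
      filter_upwards [hab] with ω h
      exact (norm_indicator_le_norm_self _ _).trans h)
  have hi1 : Integrable (fun ω => B.indicator g ω * f ω) μ :=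
    hfi.bdd_mul (c := 1) ((hgBm.mono hm3).aestronglyMeasurable) hgBb
  have hi2 : Integrable (fun ω => B.indicator a ω * g ω) μ := by
    refine hgi.bdd_mul (c := 1)
      (((ham.mono (hX s hs).comap_le).indicator hBm).aestronglyMeasurable) ?_
    filter_upwards [hab] with ω h
    exact (norm_indicator_le_norm_self _ _).trans h
  rw [← integral_indicator (hAm.inter hBm)]
  calc ∫ ω, (A ∩ B).indicator g ω ∂μ
      = ∫ ω, (B.indicator g ω * f ω + B.indicator a ω * g ω) ∂μ := by
        refine integral_congr_ae (ae_of_all _ fun ω => ?_)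
        by_cases hx : ω ∈ A <;> by_cases hx' : ω ∈ B <;> simp [hf, hx, hx'] <;> ring
    _ = 0 := by rw [integral_add hi1 hi2, e1, e2, add_zero]

end Markov

/-- Linear interpolation at time `t` between the value `x` at time `s` and `y` at time `u`. -/
noncomputable def interp (s t u x y : ℝ) : ℝ := (u - t) / (u - s) * x + (t - s) / (u - s) * y

/-! ### Path space over a set of times -/

section Paths

variable {Ω : Type*} {I : Set ℝ} {X : ℝ → Ω → ℝ}

/-- The path of `X`, restricted to the times of `I`. -/
def path (I : Set ℝ) (X : ℝ → Ω → ℝ) (ω : Ω) : I → ℝ := fun i => X i ω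

open Classical in
/-- The coordinate process on `I → ℝ`, extended by `0` to times off `I`. -/
noncomputable def coord (I : Set ℝ) (t : ℝ) (x : I → ℝ) : ℝ := if h : t ∈ I then x ⟨t, h⟩ else 0

theorem coord_path {t : ℝ} (ht : t ∈ I) (ω : Ω) : coord I t (path I X ω) = X t ω := by
  simp [coord, path, ht]

theorem coord_comp_path {t : ℝ} (ht : t ∈ I) : coord I t ∘ path I X = X t :=
  funext fun ω => coord_path ht ω

theorem measurable_coord (t : ℝ) : Measurable (coord I t) := by
  by_cases h : t ∈ I
  · have : coord I t = fun x => x ⟨t, h⟩ := by ext x; simp [coord, h]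
    rw [this]
    exact measurable_pi_apply _
  · have : coord I t = fun _ => 0 := by ext x; simp [coord, h]
    rw [this]
    exact measurable_const

theorem measurable_path [MeasurableSpace Ω] (hX : ∀ t ∈ I, Measurable (X t)) :
    Measurable (path I X) :=
  measurable_pi_lambda _ fun i => hX i i.2

/-- Every outer event is the preimage of an outer event of path space; this allows harness
identities to pass between a process and its law. -/
theorem outerField_eq_comap_path (s u : ℝ) :
    outerField I X s u = (outerField I (coord I) s u).comap (path I X) := by
  simp only [outerField, MeasurableSpace.comap_iSup, MeasurableSpace.comap_comp]
  refine iSup_congr fun r => iSup_congr fun hr => ?_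
  rw [coord_comp_path hr.1]

theorem countablyGenerated_outerField (hI : I.Countable) (s u : ℝ) :
    @MeasurableSpace.CountablyGenerated _ (outerField I X s u) := by
  have hc : Countable {r | r ∈ I ∧ (r ≤ s ∨ u ≤ r)} :=
    (hI.mono fun r hr => hr.1).to_subtype
  rw [outerField, iSup_subtype']
  exact countablyGenerated_iSup fun i => MeasurableSpace.CountablyGenerated.comap _

theorem outerField_mono_set {I' : Set ℝ} (hI : I' ⊆ I) {s u s' u' : ℝ} (hs : s' ≤ s)
    (hu : u ≤ u') : outerField I' X s' u' ≤ outerField I X s u :=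
  iSup₂_le fun _ hr => comap_le_outerField (hI hr.1) (hr.2.imp (fun h => h.trans hs) hu.trans)

end Paths

/-! ### The harness identities as vanishing set integrals -/

/-- The deviation of `X t` from the interpolation between its values at times `s` and `u`. -/
noncomputable def deviation {Ω : Type*} (X : ℝ → Ω → ℝ) (s t u : ℝ) (ω : Ω) : ℝ :=
  X t ω - interp s t u (X s ω) (X u ω)

/-- The prescribed conditional variance of a quadratic harness. -/
noncomputable def varForm {Ω : Type*} (η θ σ τ γ : ℝ) (X : ℝ → Ω → ℝ) (s t u : ℝ) (ω : Ω) : ℝ :=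
  factor σ τ γ t s u *
    K η θ σ τ γ (slope s u (X s ω) (X u ω)) (intercept s u (X s ω) (X u ω))

/-- The two conditional moment identities of a quadratic harness on an arbitrary set of times `I`,
with respect to the natural σ-fields and in terms of set integrals. -/
structure IsHarnessOn {Ω : Type*} [MeasurableSpace Ω] (P : Measure Ω) (I : Set ℝ)
    (X : ℝ → Ω → ℝ) (η θ σ τ γ : ℝ) : Prop where
  measurable : ∀ t ∈ I, Measurable (X t)
  memLp : ∀ t ∈ I, MemLp (X t) 2 P
  harness : ∀ s ∈ I, ∀ t ∈ I, ∀ u ∈ I, s < t → t < u →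
    ∀ A, MeasurableSet[outerField I X s u] A → ∫ ω in A, deviation X s t u ω ∂P = 0
  condVar : ∀ s ∈ I, ∀ t ∈ I, ∀ u ∈ I, s < t → t < u →
    ∀ A, MeasurableSet[outerField I X s u] A →
      ∫ ω in A, (deviation X s t u ω ^ 2 - varForm η θ σ τ γ X s t u ω) ∂P = 0

section Integrability

variable {Ω : Type*} [mΩ : MeasurableSpace Ω] {P : Measure Ω} {X : ℝ → Ω → ℝ} {s t u : ℝ}

theorem memLp_interp {p : ENNReal} (hs : MemLp (X s) p P) (hu : MemLp (X u) p P) :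
    MemLp (fun ω => interp s t u (X s ω) (X u ω)) p P :=
  (hs.const_mul _).add (hu.const_mul _)

theorem memLp_deviation {p : ENNReal} (hs : MemLp (X s) p P) (ht : MemLp (X t) p P)
    (hu : MemLp (X u) p P) : MemLp (deviation X s t u) p P :=
  ht.sub (memLp_interp hs hu)

theorem memLp_slope {p : ENNReal} (hs : MemLp (X s) p P) (hu : MemLp (X u) p P) :
    MemLp (fun ω => slope s u (X s ω) (X u ω)) p P := by
  simp only [slope, div_eq_inv_mul]
  exact (hu.sub hs).const_mul (u - s)⁻¹

theorem memLp_intercept {p : ENNReal} (hs : MemLp (X s) p P) (hu : MemLp (X u) p P) :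
    MemLp (fun ω => intercept s u (X s ω) (X u ω)) p P := by
  simp only [intercept, div_eq_inv_mul]
  exact ((hs.const_mul u).sub (hu.const_mul s)).const_mul (u - s)⁻¹

theorem integrable_K [IsFiniteMeasure P] (η θ σ τ γ : ℝ) {a b : Ω → ℝ} (ha : MemLp a 2 P)
    (hb : MemLp b 2 P) : Integrable (fun ω => K η θ σ τ γ (a ω) (b ω)) P := by
  have ha1 := ha.integrable one_le_two
  have hb1 := hb.integrable one_le_two
  have hab : Integrable (fun ω => a ω * b ω) P := ha.integrable_mul hb
  simp only [K, mul_assoc]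
  exact (((((integrable_const 1).add (hb1.const_mul η)).add (ha1.const_mul θ)).add
    (hb.integrable_sq.const_mul σ)).add (ha.integrable_sq.const_mul τ)).sub
    (hab.const_mul (1 - γ))

theorem integrable_varForm [IsFiniteMeasure P] (η θ σ τ γ : ℝ) (hs : MemLp (X s) 2 P)
    (hu : MemLp (X u) 2 P) : Integrable (varForm η θ σ τ γ X s t u) P :=
  (integrable_K η θ σ τ γ (memLp_slope hs hu) (memLp_intercept hs hu)).const_mul _

end Integrability

theorem measurable_deviation {Ω : Type*} {m : MeasurableSpace Ω} {X : ℝ → Ω → ℝ} {s t u : ℝ}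
    (hs : Measurable (X s)) (ht : Measurable (X t))
    (hu : Measurable (X u)) : Measurable (deviation X s t u) :=
  ht.sub ((hs.const_mul _).add (hu.const_mul _))

theorem measurable_varForm {Ω : Type*} {m : MeasurableSpace Ω} {X : ℝ → Ω → ℝ} {s t u : ℝ}
    (η θ σ τ γ : ℝ) (hs : Measurable (X s))
    (hu : Measurable (X u)) : Measurable (varForm η θ σ τ γ X s t u) := by
  unfold varForm K slope intercept
  fun_prop

theorem deviation_coord_path {Ω : Type*} {I : Set ℝ} {X : ℝ → Ω → ℝ} {s t u : ℝ}
    (hs : s ∈ I) (ht : t ∈ I) (hu : u ∈ I) (ω : Ω) :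
    deviation (coord I) s t u (path I X ω) = deviation X s t u ω := by
  simp only [deviation, coord_path hs, coord_path ht, coord_path hu]

theorem varForm_coord_path {Ω : Type*} {I : Set ℝ} {X : ℝ → Ω → ℝ} {η θ σ τ γ s t u : ℝ}
    (hs : s ∈ I) (hu : u ∈ I) (ω : Ω) :
    varForm η θ σ τ γ (coord I) s t u (path I X ω) = varForm η θ σ τ γ X s t u ω := by
  simp only [varForm, coord_path hs, coord_path hu]

theorem setIntegral_sub_eq_zero_of_condExp {Ω : Type*} {m m' : MeasurableSpace Ω}
    [mΩ : MeasurableSpace Ω] {μ : Measure Ω} [IsFiniteMeasure μ] (hm : m ≤ mΩ) (hm' : m' ≤ m)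
    {f g : Ω → ℝ} (hf : Integrable f μ) (hg : Integrable g μ) (h : μ[f | m] =ᵐ[μ] g) (A : Set Ω)
    (hA : MeasurableSet[m'] A) : ∫ ω in A, (f ω - g ω) ∂μ = 0 := by
  rw [integral_sub hf.integrableOn hg.integrableOn, ← setIntegral_condExp hm hf (hm' _ hA),
    sub_eq_zero]
  exact integral_congr_ae (ae_restrict_of_ae h)

theorem IsQuadraticHarness.measurable_process {Ω : Type*} [mΩ : MeasurableSpace Ω] {μ : Measure Ω}
    {T : Set ℝ} {F : ℝ → ℝ → MeasurableSpace Ω} {X : ℝ → Ω → ℝ} {η θ σ τ γ : ℝ}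
    (h : IsQuadraticHarness μ T F X η θ σ τ γ) (t : ℝ) (ht : t ∈ T) : Measurable (X t) := by
  -- Measurability is given only relative to `F s u` for a pair of times, so a later time is taken
  -- from the open set `T`.
  obtain ⟨u, htu, hu⟩ : ∃ u, t < u ∧ u ∈ T := by
    have : T ∈ 𝓝[>] t := mem_nhdsWithin_of_mem_nhds (h.isOpen.mem_nhds ht)
    obtain ⟨u, hu1, hu2⟩ := ((eventually_mem_nhdsWithin (s := Ioi t)).and this).exists
    exact ⟨u, hu1, hu2⟩
  exact (h.measurable t ht u hu htu t ht (Or.inl le_rfl)).mono (h.field_le t ht u hu htu) le_rfl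

/-- The natural outer fields on `I` lie below `F`, and set-integral identities restrict to smaller
σ-fields. The interpolation is the conditional mean, so the conditional variance is the conditional
expectation of the squared deviation. -/
theorem IsQuadraticHarness.isHarnessOn {Ω : Type*} [mΩ : MeasurableSpace Ω] {μ : Measure Ω}
    [IsFiniteMeasure μ] {T I : Set ℝ} {F : ℝ → ℝ → MeasurableSpace Ω} {X : ℝ → Ω → ℝ}
    {η θ σ τ γ : ℝ} (h : IsQuadraticHarness μ T F X η θ σ τ γ) (hI : I ⊆ T) :
    IsHarnessOn μ I X η θ σ τ γ := by
  have hle : ∀ s ∈ I, ∀ u ∈ I, s < u → outerField I X s u ≤ F s u := fun s hs u hu hsu =>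
    iSup₂_le fun r hr => (h.measurable s (hI hs) u (hI hu) hsu r (hI hr.1) hr.2).comap_le
  refine ⟨fun t ht => h.measurable_process t (hI ht), fun t ht => h.memLp t (hI ht), ?_, ?_⟩
  · intro s hs t ht u hu hst htu
    have hsu := hst.trans htu
    exact setIntegral_sub_eq_zero_of_condExp (h.field_le s (hI hs) u (hI hu) hsu)
      (hle s hs u hu hsu) ((h.memLp t (hI ht)).integrable one_le_two)
      ((memLp_interp (h.memLp s (hI hs)) (h.memLp u (hI hu))).integrable one_le_two)
      (h.harness s (hI hs) t (hI ht) u (hI hu) hst htu)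
  · intro s hs t ht u hu hst htu
    have hsu := hst.trans htu
    have h2 := memLp_deviation (h.memLp s (hI hs)) (h.memLp t (hI ht)) (h.memLp u (hI hu))
    refine setIntegral_sub_eq_zero_of_condExp (h.field_le s (hI hs) u (hI hu) hsu)
      (hle s hs u hu hsu) h2.integrable_sq
      (integrable_varForm η θ σ τ γ (h.memLp s (hI hs)) (h.memLp u (hI hu))) ?_
    refine EventuallyEq.trans ?_ (h.condVar s (hI hs) t (hI ht) u (hI hu) hst htu)
    refine condExp_congr_ae ?_
    filter_upwards [h.harness s (hI hs) t (hI ht) u (hI hu) hst htu] with ω hω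
    simp [deviation, interp, hω]

/-! ### Transfer between a process and its law -/

section Transfer

variable {Ω : Type*} [mΩ : MeasurableSpace Ω] {P : Measure Ω} {I : Set ℝ} {X : ℝ → Ω → ℝ}
  {η θ σ τ γ : ℝ}

/-- Being a harness on `I` is a property of the law of the path on `I`. -/
theorem isHarnessOn_coord_iff (hX : ∀ t ∈ I, Measurable (X t)) :
    IsHarnessOn (P.map (path I X)) I (coord I) η θ σ τ γ ↔ IsHarnessOn P I X η θ σ τ γ := by
  have hp := measurable_path hX
  have hL : ∀ t ∈ I, (MemLp (coord I t) 2 (P.map (path I X)) ↔ MemLp (X t) 2 P) := fun t ht => by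
    rw [memLp_map_measure_iff (measurable_coord t).aestronglyMeasurable hp.aemeasurable,
      coord_comp_path ht]
  have hle : ∀ s u, outerField I (coord I) s u ≤ MeasurableSpace.pi := fun s u =>
    outerField_le fun t _ => measurable_coord t
  have h1 : ∀ s ∈ I, ∀ t ∈ I, ∀ u ∈ I, ∀ A, MeasurableSet[outerField I (coord I) s u] A →
      ∫ x in A, deviation (coord I) s t u x ∂(P.map (path I X))
        = ∫ ω in path I X ⁻¹' A, deviation X s t u ω ∂P := fun s hs t ht u hu A hA => by
    rw [setIntegral_map (hle _ _ _ hA) (measurable_deviation (measurable_coord s)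
      (measurable_coord t) (measurable_coord u)).aestronglyMeasurable hp.aemeasurable]
    simp only [deviation_coord_path hs ht hu]
  have h2 : ∀ s ∈ I, ∀ t ∈ I, ∀ u ∈ I, ∀ A, MeasurableSet[outerField I (coord I) s u] A →
      ∫ x in A, (deviation (coord I) s t u x ^ 2 - varForm η θ σ τ γ (coord I) s t u x)
          ∂(P.map (path I X))
        = ∫ ω in path I X ⁻¹' A, (deviation X s t u ω ^ 2 - varForm η θ σ τ γ X s t u ω) ∂P :=
      fun s hs t ht u hu A hA => by
    have hm : Measurable fun x =>
        deviation (coord I) s t u x ^ 2 - varForm η θ σ τ γ (coord I) s t u x :=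
      ((measurable_deviation (measurable_coord s) (measurable_coord t)
        (measurable_coord u)).pow_const 2).sub
        (measurable_varForm η θ σ τ γ (measurable_coord s) (measurable_coord u))
    rw [setIntegral_map (hle _ _ _ hA) hm.aestronglyMeasurable hp.aemeasurable]
    simp only [deviation_coord_path hs ht hu, varForm_coord_path hs hu]
  constructor
  · intro h
    refine ⟨hX, fun t ht => (hL t ht).1 (h.memLp t ht), ?_, ?_⟩
    · intro s hs t ht u hu hst htu A hA
      rw [outerField_eq_comap_path] at hA
      obtain ⟨B, hB, rfl⟩ := hA
      rw [← h1 s hs t ht u hu B hB]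
      exact h.harness s hs t ht u hu hst htu B hB
    · intro s hs t ht u hu hst htu A hA
      rw [outerField_eq_comap_path] at hA
      obtain ⟨B, hB, rfl⟩ := hA
      rw [← h2 s hs t ht u hu B hB]
      exact h.condVar s hs t ht u hu hst htu B hB
  · intro h
    refine ⟨fun t _ => measurable_coord t, fun t ht => (hL t ht).2 (h.memLp t ht), ?_, ?_⟩
    · intro s hs t ht u hu hst htu B hB
      rw [h1 s hs t ht u hu B hB]
      refine h.harness s hs t ht u hu hst htu _ ?_
      rw [outerField_eq_comap_path]
      exact ⟨B, hB, rfl⟩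
    · intro s hs t ht u hu hst htu B hB
      rw [h2 s hs t ht u hu B hB]
      refine h.condVar s hs t ht u hu hst htu _ ?_
      rw [outerField_eq_comap_path]
      exact ⟨B, hB, rfl⟩

end Transfer

/-! ### Conditioning a path law on its endpoints -/

section Conditioning

variable {I : Set ℝ} {η θ σ τ γ R V : ℝ}

/-- The pair of endpoint values of a path. -/
noncomputable def endpoints (I : Set ℝ) (R V : ℝ) (x : I → ℝ) : ℝ × ℝ := (coord I R x, coord I V x)

theorem measurable_endpoints : Measurable (endpoints I R V) :=
  (measurable_coord R).prodMk (measurable_coord V)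

theorem measurable_outerField_endpoints (hR : R ∈ I) (hV : V ∈ I) {s u : ℝ} (hs : R ≤ s)
    (hu : u ≤ V) : Measurable[outerField I (coord I) s u] (endpoints I R V) :=
  (measurable_outerField hR (Or.inl hs)).prodMk (measurable_outerField hV (Or.inr hu))

variable [Countable I]

/-- Conditioning on the endpoints preserves the harness property. -/
theorem IsHarnessOn.ae_condDistrib (ρ : Measure (I → ℝ)) [IsFiniteMeasure ρ]
    (h : IsHarnessOn ρ I (coord I) η θ σ τ γ) (hR : R ∈ I) (hV : V ∈ I) (hIRV : I ⊆ Icc R V) :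
    ∀ᵐ z ∂ρ.map (endpoints I R V),
      IsHarnessOn (condDistrib id (endpoints I R V) ρ z) I (coord I) η θ σ τ γ := by
  have hI : I.Countable := I.to_countable
  have hle : ∀ s u, outerField I (coord I) s u ≤ MeasurableSpace.pi := fun s u =>
    outerField_le fun t _ => measurable_coord t
  have hsq : ∀ᵐ z ∂ρ.map (endpoints I R V), ∀ t ∈ I,
      MemLp (coord I t) 2 (condDistrib id (endpoints I R V) ρ z) := by
    refine (ae_ball_iff hI).2 fun t ht => ?_
    have := Integrable.condDistrib_ae_map (mβ := inferInstance) (X := endpoints I R V) (Y := id)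
      (f := fun q : (ℝ × ℝ) × (I → ℝ) => coord I t q.2 ^ 2) aemeasurable_id (μ := ρ)
      ((h.memLp t ht).integrable_sq.comp_snd_map_prodMk _)
    filter_upwards [this] with z hz
    exact (memLp_two_iff_integrable_sq (measurable_coord t).aestronglyMeasurable).2 hz
  have h1 : ∀ᵐ z ∂ρ.map (endpoints I R V), ∀ s ∈ I, ∀ t ∈ I, ∀ u ∈ I, s < t → t < u →
      ∀ A, MeasurableSet[outerField I (coord I) s u] A →
        ∫ x in A, deviation (coord I) s t u x ∂(condDistrib id (endpoints I R V) ρ z) = 0 := by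
    refine (ae_ball_iff hI).2 fun s hs => (ae_ball_iff hI).2 fun t ht => (ae_ball_iff hI).2
      fun u hu => ?_
    by_cases hst : s < t
    swap; · exact ae_of_all _ fun z h => absurd h hst
    by_cases htu : t < u
    swap; · exact ae_of_all _ fun z _ h => absurd h htu
    filter_upwards [ae_condDistrib_setIntegral_eq_zero ρ (hle s u)
      (countablyGenerated_outerField hI s u)
      (measurable_outerField_endpoints hR hV (hIRV hs).1 (hIRV hu).2)
      (measurable_deviation (measurable_coord s) (measurable_coord t) (measurable_coord u))
      ((memLp_deviation (h.memLp s hs) (h.memLp t ht) (h.memLp u hu)).integrable one_le_two)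
      (h.harness s hs t ht u hu hst htu)] with z hz _ _
    exact hz.2
  have h2 : ∀ᵐ z ∂ρ.map (endpoints I R V), ∀ s ∈ I, ∀ t ∈ I, ∀ u ∈ I, s < t → t < u →
      ∀ A, MeasurableSet[outerField I (coord I) s u] A →
        ∫ x in A, (deviation (coord I) s t u x ^ 2 - varForm η θ σ τ γ (coord I) s t u x)
          ∂(condDistrib id (endpoints I R V) ρ z) = 0 := by
    refine (ae_ball_iff hI).2 fun s hs => (ae_ball_iff hI).2 fun t ht => (ae_ball_iff hI).2
      fun u hu => ?_
    by_cases hst : s < t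
    swap; · exact ae_of_all _ fun z h => absurd h hst
    by_cases htu : t < u
    swap; · exact ae_of_all _ fun z _ h => absurd h htu
    filter_upwards [ae_condDistrib_setIntegral_eq_zero ρ (hle s u)
      (countablyGenerated_outerField hI s u)
      (measurable_outerField_endpoints hR hV (hIRV hs).1 (hIRV hu).2)
      (((measurable_deviation (measurable_coord s) (measurable_coord t)
        (measurable_coord u)).pow_const 2).sub (measurable_varForm η θ σ τ γ (t := t)
        (measurable_coord s) (measurable_coord u)))
      ((memLp_deviation (h.memLp s hs) (h.memLp t ht) (h.memLp u hu)).integrable_sq.sub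
        (integrable_varForm η θ σ τ γ (h.memLp s hs) (h.memLp u hu)))
      (h.condVar s hs t ht u hu hst htu)] with z hz _ _
    exact hz.2
  filter_upwards [hsq, h1, h2] with z hz hz1 hz2
  exact ⟨fun t _ => measurable_coord t, hz, hz1, hz2⟩

/-- Under the conditional law given the endpoints, the endpoints are constant. -/
theorem ae_condDistrib_endpoints (ρ : Measure (I → ℝ)) [IsFiniteMeasure ρ] :
    ∀ᵐ z ∂ρ.map (endpoints I R V),
      ∀ᵐ x ∂(condDistrib id (endpoints I R V) ρ z), endpoints I R V x = z := by
  refine Measure.ae_ae_of_ae_compProd (p := fun q : (ℝ × ℝ) × (I → ℝ) => endpoints I R V q.2 = q.1)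
    ?_
  rw [compProd_map_condDistrib aemeasurable_id]
  refine (ae_map_iff (p := fun q : (ℝ × ℝ) × (I → ℝ) => endpoints I R V q.2 = q.1)
    (measurable_endpoints.prodMk measurable_id).aemeasurable
    (measurableSet_eq_fun (measurable_endpoints.comp measurable_snd) measurable_fst)).2 ?_
  exact ae_of_all _ fun x => rfl

/-- Disintegrations are almost everywhere unique: `π` and the image of the conditional path law both
disintegrate the joint law of the endpoints and the value at `t`. -/
theorem ae_condDistrib_map_coord (ρ : Measure (I → ℝ)) [IsFiniteMeasure ρ]
    {t : ℝ} {π : Kernel (ℝ × ℝ) ℝ} [IsFiniteKernel π]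
    (hπ : ρ.map (fun x => (endpoints I R V x, coord I t x)) = ρ.map (endpoints I R V) ⊗ₘ π) :
    ∀ᵐ z ∂ρ.map (endpoints I R V),
      (condDistrib id (endpoints I R V) ρ z).map (coord I t) = π z := by
  have h1 := condDistrib_ae_eq_of_measure_eq_compProd (endpoints I R V)
    (measurable_coord t).aemeasurable hπ
  have h2 := condDistrib_comp (mβ := inferInstance) (endpoints I R V)
    (aemeasurable_id (μ := ρ)) (measurable_coord (I := I) t)
  filter_upwards [h1, h2] with z hz1 hz2
  rw [← hz1, ← Kernel.map_apply _ (measurable_coord t), ← hz2]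
  rfl

/-- Testing only rational half-lines leaves countably many null sets; off their union
`integral_indicator_sub_kernel_eq_zero` recovers every Borel set `U`. -/
theorem ae_condDistrib_transition (ρ : Measure (I → ℝ)) [IsFiniteMeasure ρ] {s t : ℝ}
    {κ : Kernel (ℝ × ℝ) ℝ} [IsMarkovKernel κ] (hR : R ∈ I) (hV : V ∈ I) (hs : R ≤ s)
    (h : ∀ U, MeasurableSet U → ∀ A, MeasurableSet[outerField I (coord I) s V] A →
      ∫ x in A, ((coord I t ⁻¹' U).indicator (fun _ => (1 : ℝ)) x
        - (κ (coord I s x, coord I V x)).real U) ∂ρ = 0) :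
    ∀ᵐ z ∂ρ.map (endpoints I R V), ∀ U, MeasurableSet U →
      ∀ A, MeasurableSet[outerField I (coord I) s V] A →
      ∫ x in A, ((coord I t ⁻¹' U).indicator (fun _ => (1 : ℝ)) x
        - (κ (coord I s x, coord I V x)).real U) ∂(condDistrib id (endpoints I R V) ρ z) = 0 := by
  have hpair : Measurable fun x : I → ℝ => (coord I s x, coord I V x) :=
    (measurable_coord s).prodMk (measurable_coord V)
  have hle : outerField I (coord I) s V ≤ MeasurableSpace.pi :=
    outerField_le fun t _ => measurable_coord t
  have hq : ∀ᵐ z ∂ρ.map (endpoints I R V), ∀ q : ℚ,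
      ∀ A, MeasurableSet[outerField I (coord I) s V] A →
      ∫ x in A, ((coord I t ⁻¹' Iic (q : ℝ)).indicator (fun _ => (1 : ℝ)) x
        - (κ (coord I s x, coord I V x)).real (Iic (q : ℝ)))
          ∂(condDistrib id (endpoints I R V) ρ z) = 0 := by
    refine ae_all_iff.2 fun q => ?_
    have hκ : Measurable fun y => (κ y).real (Iic (q : ℝ)) :=
      (κ.measurable_coe measurableSet_Iic).ennreal_toReal
    have hm : Measurable fun x : I → ℝ => (coord I t ⁻¹' Iic (q : ℝ)).indicator
        (fun _ => (1 : ℝ)) x - (κ (coord I s x, coord I V x)).real (Iic (q : ℝ)) :=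
      (measurable_const.indicator (measurable_coord t measurableSet_Iic)).sub (hκ.comp hpair)
    have hi : Integrable (fun x : I → ℝ => (coord I t ⁻¹' Iic (q : ℝ)).indicator
        (fun _ => (1 : ℝ)) x - (κ (coord I s x, coord I V x)).real (Iic (q : ℝ))) ρ := by
      refine Integrable.of_bound hm.aestronglyMeasurable (1 + 1) (ae_of_all _ fun x => ?_)
      refine (norm_sub_le _ _).trans (add_le_add (norm_indicator_one_le _ _) ?_)
      rw [Real.norm_eq_abs, abs_of_nonneg measureReal_nonneg]
      exact measureReal_le_one
    filter_upwards [ae_condDistrib_setIntegral_eq_zero ρ hle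
      (countablyGenerated_outerField I.to_countable s V)
      (measurable_outerField_endpoints hR hV hs le_rfl) hm hi (h _ measurableSet_Iic)] with z hz
    exact hz.2
  filter_upwards [hq] with z hz U hU A hA
  exact integral_indicator_sub_kernel_eq_zero (measurable_coord t) hpair
    (fun q => hz q A hA) hU

end Conditioning

/-! ### Uniqueness of the law of a Markov process -/

/-- The Markov property at the times of `S`, with transition kernels `q s t`, in terms of set
integrals. -/
def HasTransitions {Ω : Type*} [MeasurableSpace Ω] (P : Measure Ω) (S : Set ℝ) (X : ℝ → Ω → ℝ)
    (q : ℝ → ℝ → Kernel ℝ ℝ) : Prop :=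
  ∀ s ∈ S, ∀ t ∈ S, s < t → ∀ U : Set ℝ, MeasurableSet U →
    ∀ A, MeasurableSet[pastField S X s] A →
      ∫ ω in A, ((X t ⁻¹' U).indicator (fun _ => (1 : ℝ)) ω - (q s t (X s ω)).real U) ∂P = 0

section Uniqueness

variable {S : Set ℝ}

/-- The values of `X` at the times of a finite set. -/
def finPath {Ω : Type*} (X : ℝ → Ω → ℝ) (J : Finset S) (ω : Ω) : J → ℝ := fun j => X j ω

theorem measurable_finPath {Ω : Type*} [MeasurableSpace Ω] {X : ℝ → Ω → ℝ}
    (hX : ∀ t ∈ S, Measurable (X t)) (J : Finset S) : Measurable (finPath X J) :=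
  measurable_pi_lambda _ fun j => hX j j.1.2

/-- Extends a finite sequence of values, indexed by `J`, by one more value at time `t`. -/
noncomputable def insertValue (J : Finset S) (t : S) (y : (J → ℝ) × ℝ) : ↥(insert t J) → ℝ :=
  fun i =>
  if h : i.1 ∈ J then y.1 ⟨i.1, h⟩ else y.2

theorem measurable_insertValue (J : Finset S) (t : S) : Measurable (insertValue J t) := by
  refine measurable_pi_lambda _ fun i => ?_
  by_cases h : i.1 ∈ J
  · simp only [insertValue, h, dite_true]
    exact (measurable_pi_apply _).comp measurable_fst
  · simp only [insertValue, h, dite_false]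
    exact measurable_snd

theorem finPath_insert {Ω : Type*} (X : ℝ → Ω → ℝ) (J : Finset S) (t : S) :
    finPath X (insert t J) = insertValue J t ∘ fun ω => (finPath X J ω, X t ω) := by
  ext ω i
  by_cases h : i.1 ∈ J
  · simp [insertValue, h, finPath]
  · have : i.1 = t := (Finset.mem_insert.1 i.2).resolve_right h
    simp [insertValue, finPath, this, show t ∉ J from this ▸ h]

theorem eq_empty_or_univ_of_subsingleton {α : Type*} [Subsingleton α] (A : Set α) :
    A = ∅ ∨ A = univ :=
  A.eq_empty_or_nonempty.imp_right fun ⟨a, ha⟩ =>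
    eq_univ_of_forall fun x => Subsingleton.elim a x ▸ ha

/-- The induction step for finite-dimensional laws: `s` is the last time of `J`, so `finPath X J`
belongs to the past of `s` and the next value is governed by `q s t`. -/
theorem HasTransitions.measure_inter_eq {Ω : Type*} [MeasurableSpace Ω] {P : Measure Ω}
    [IsFiniteMeasure P] {X : ℝ → Ω → ℝ} {q : ℝ → ℝ → Kernel ℝ ℝ} (hX : ∀ t ∈ S, Measurable (X t))
    (hT : HasTransitions P S X q) {s t : S} [IsMarkovKernel (q s t)] {J : Finset S} (hs : s ∈ J)
    (hJ : ∀ r ∈ J, r ≤ s) (hst : s < t) {B : Set (J → ℝ)} (hB : MeasurableSet B) {U : Set ℝ}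
    (hU : MeasurableSet U) :
    P (finPath X J ⁻¹' B ∩ X t ⁻¹' U)
      = ∫⁻ y in B, q s t (y ⟨s, hs⟩) U ∂(P.map (finPath X J)) := by
  have hm := measurable_finPath hX J
  have hA : MeasurableSet[pastField S X s] (finPath X J ⁻¹' B) := by
    have : Measurable[pastField S X s] (finPath X J) :=
      @measurable_pi_lambda _ _ _ (pastField S X s) _ _
        fun j => measurable_pastField j.1.2 (hJ j j.2)
    exact measurableSet_preimage this hB
  have h := hT s s.2 t t.2 hst U hU _ hA
  rw [integral_indicator_sub_kernel (hX t t.2) (hX s s.2) hU, sub_eq_zero] at h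
  have hqm : Measurable fun y : J → ℝ => q s t (y ⟨s, hs⟩) U :=
    ((q s t).measurable_coe hU).comp (measurable_pi_apply _)
  rw [setLIntegral_map hB hqm hm, inter_comm, ← Measure.restrict_apply (hX t t.2 hU)]
  refine (ENNReal.toReal_eq_toReal_iff' (measure_ne_top _ _) ?_).1 h
  refine ne_of_lt (lt_of_le_of_lt (lintegral_mono (g := fun _ => 1) fun ω => prob_le_one) ?_)
  simp

/-- Univariate laws and transition probabilities determine the law of a Markov process. -/
theorem map_path_eq_of_transitions {Ω₁ Ω₂ : Type*} [MeasurableSpace Ω₁] [MeasurableSpace Ω₂]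
    {P₁ : Measure Ω₁} {P₂ : Measure Ω₂} [IsProbabilityMeasure P₁] [IsProbabilityMeasure P₂]
    {X₁ : ℝ → Ω₁ → ℝ} {X₂ : ℝ → Ω₂ → ℝ} {q : ℝ → ℝ → Kernel ℝ ℝ}
    (hq : ∀ s ∈ S, ∀ t ∈ S, s < t → IsMarkovKernel (q s t))
    (h₁ : ∀ t ∈ S, Measurable (X₁ t)) (h₂ : ∀ t ∈ S, Measurable (X₂ t))
    (hT₁ : HasTransitions P₁ S X₁ q) (hT₂ : HasTransitions P₂ S X₂ q)
    (hmarg : ∀ t ∈ S, P₁.map (X₁ t) = P₂.map (X₂ t)) :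
    P₁.map (path S X₁) = P₂.map (path S X₂) := by
  have hfin : ∀ J : Finset S, P₁.map (finPath X₁ J) = P₂.map (finPath X₂ J) := by
    intro J
    -- Times are added in increasing order. The first one uses the marginals, every later one the
    -- kernel from the preceding maximum.
    induction J using Finset.induction_on_max with
    | empty =>
      have i₁ : IsProbabilityMeasure (P₁.map (finPath X₁ (∅ : Finset S))) :=
        Measure.isProbabilityMeasure_map (measurable_finPath h₁ _).aemeasurable
      have i₂ : IsProbabilityMeasure (P₂.map (finPath X₂ (∅ : Finset S))) :=
        Measure.isProbabilityMeasure_map (measurable_finPath h₂ _).aemeasurable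
      ext A _
      rcases eq_empty_or_univ_of_subsingleton A with h | h <;> simp [h]
    | insert t J hJ ih =>
      have hpair : P₁.map (fun ω => (finPath X₁ J ω, X₁ t ω))
          = P₂.map (fun ω => (finPath X₂ J ω, X₂ t ω)) := by
        rcases J.eq_empty_or_nonempty with rfl | hne
        · refine Measure.ext_prod fun {B U} hB hU => ?_
          rw [Measure.map_apply ((measurable_finPath h₁ _).prodMk (h₁ t t.2)) (hB.prod hU),
            Measure.map_apply ((measurable_finPath h₂ _).prodMk (h₂ t t.2)) (hB.prod hU)]
          rcases eq_empty_or_univ_of_subsingleton B with h | h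
          · simp [h]
          · have := congrArg (fun ν => ν U) (hmarg t t.2)
            simp only [Measure.map_apply (h₁ t t.2) hU, Measure.map_apply (h₂ t t.2) hU] at this
            rw [h]
            convert this using 2
            · ext ω; simp
            · ext ω; simp
        · set s := J.max' hne with hs
          have hsJ : s ∈ J := J.max'_mem hne
          have hst : s < t := hJ s hsJ
          have := hq s s.2 t t.2 hst
          refine Measure.ext_prod fun {B U} hB hU => ?_
          rw [Measure.map_apply ((measurable_finPath h₁ _).prodMk (h₁ t t.2)) (hB.prod hU),
            Measure.map_apply ((measurable_finPath h₂ _).prodMk (h₂ t t.2)) (hB.prod hU)]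
          have e₁ := hT₁.measure_inter_eq h₁ hsJ (fun r hr => J.le_max' r hr) hst hB hU
          have e₂ := hT₂.measure_inter_eq h₂ hsJ (fun r hr => J.le_max' r hr) hst hB hU
          rw [ih] at e₁
          exact e₁.trans e₂.symm
      have hg := measurable_insertValue J t
      rw [finPath_insert, finPath_insert,
        ← Measure.map_map hg ((measurable_finPath h₁ _).prodMk (h₁ t t.2)),
        ← Measure.map_map hg ((measurable_finPath h₂ _).prodMk (h₂ t t.2)), hpair]
  refine IsProjectiveLimit.unique (P := fun J : Finset S => P₁.map (finPath X₁ J))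
    (fun J => ?_) (fun J => ?_)
  · rw [Measure.map_map (by fun_prop) (measurable_path h₁)]
    rfl
  · rw [Measure.map_map (by fun_prop) (measurable_path h₂)]
    refine Eq.trans ?_ (hfin J).symm
    rfl

end Uniqueness

/-- A function with zero conditional expectation given `m` is orthogonal to all `m`-measurable
functions for which the product is integrable. -/
theorem integral_mul_eq_zero_of_integrable {Ω : Type*} {m : MeasurableSpace Ω}
    [mΩ : MeasurableSpace Ω] {μ : Measure Ω} [IsFiniteMeasure μ] (hm : m ≤ mΩ) {f h : Ω → ℝ}
    (hf : Integrable f μ) (h0 : ∀ A, MeasurableSet[m] A → ∫ x in A, f x ∂μ = 0)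
    (hh : StronglyMeasurable[m] h) (hhf : Integrable (h * f) μ) :
    ∫ x, h x * f x ∂μ = 0 := by
  have h1 := condExp_ae_eq_zero_of_forall_setIntegral_eq_zero hm hf h0
  have h2 := condExp_mul_of_stronglyMeasurable_left hh hhf hf
  change ∫ x, (h * f) x ∂μ = 0
  rw [← integral_condExp hm, integral_congr_ae h2]
  have : (h * μ[f | m]) =ᵐ[μ] 0 := by
    filter_upwards [h1] with x hx
    simp [hx]
  rw [integral_congr_ae this]
  simp

theorem IsHarnessOn.mono {Ω : Type*} [MeasurableSpace Ω] {P : Measure Ω} {I I' : Set ℝ}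
    {X : ℝ → Ω → ℝ} {η θ σ τ γ : ℝ} (h : IsHarnessOn P I X η θ σ τ γ) (hI : I' ⊆ I) :
    IsHarnessOn P I' X η θ σ τ γ :=
  ⟨fun t ht => h.measurable t (hI ht), fun t ht => h.memLp t (hI ht),
    fun s hs t ht u hu hst htu A hA => h.harness s (hI hs) t (hI ht) u (hI hu) hst htu A
      (outerField_mono_set hI le_rfl le_rfl A hA),
    fun s hs t ht u hu hst htu A hA => h.condVar s (hI hs) t (hI ht) u (hI hu) hst htu A
      (outerField_mono_set hI le_rfl le_rfl A hA)⟩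

/-! ### Sign of the denominator -/

section Denominator

/-- The denominator in the conditional variance of a quadratic harness does not vanish. -/
theorem IsQuadraticHarness.denom_ne_zero {Ω : Type*} [MeasurableSpace Ω] {μ : Measure Ω}
    [IsProbabilityMeasure μ] {T : Set ℝ} {F : ℝ → ℝ → MeasurableSpace Ω} {X : ℝ → Ω → ℝ}
    {η θ σ τ γ : ℝ} (h : IsQuadraticHarness μ T F X η θ σ τ γ) {s u : ℝ} (hs : s ∈ T) (hu : u ∈ T)
    (hsu : s < u) : denom σ τ γ s u ≠ 0 := by
  intro h0
  set t := (s + u) / 2 with ht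
  have hst : s < t := by rw [ht]; linarith
  have htu : t < u := by rw [ht]; linarith
  have htT : t ∈ T := h.ordConnected.out hs hu ⟨hst.le, htu.le⟩
  have hH := h.isHarnessOn (subset_refl T)
  have key := hH.condVar s hs t htT u hu hst htu univ MeasurableSet.univ
  -- Division by zero yields zero, so a zero denominator makes the prescribed variance vanish. The
  -- covariances instead give the deviation second moment `(u - t) (t - s) / (u - s) > 0`.
  have hv : ∀ ω, varForm η θ σ τ γ X s t u ω = 0 := fun ω => by simp [varForm, factor, h0]
  simp only [hv, sub_zero, Measure.restrict_univ] at key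
  set a := (u - t) / (u - s) with ha
  set b := (t - s) / (u - s) with hb
  have m : ∀ r ∈ T, ∀ q ∈ T, Integrable (fun ω => X r ω * X q ω) μ := fun r hr q hq =>
    (h.memLp r hr).integrable_mul (h.memLp q hq)
  have e : ∀ ω, deviation X s t u ω ^ 2 = X t ω * X t ω + (a ^ 2 * (X s ω * X s ω) +
      (b ^ 2 * (X u ω * X u ω) + (-2 * a * (X s ω * X t ω) + (-2 * b * (X t ω * X u ω)
        + 2 * a * b * (X s ω * X u ω))))) := fun ω => by
    simp only [deviation, interp, ← ha, ← hb]; ring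
  simp only [e] at key
  have i1 := m t htT t htT
  have i2 := (m s hs s hs).const_mul (a ^ 2)
  have i3 := (m u hu u hu).const_mul (b ^ 2)
  have i4 := (m s hs t htT).const_mul (-2 * a)
  have i5 := (m t htT u hu).const_mul (-2 * b)
  have i6 := (m s hs u hu).const_mul (2 * a * b)
  rw [integral_add i1 (i2.fun_add (i3.fun_add (i4.fun_add (i5.fun_add i6)))),
    integral_add i2 (i3.fun_add (i4.fun_add (i5.fun_add i6))),
    integral_add i3 (i4.fun_add (i5.fun_add i6)),
    integral_add i4 (i5.fun_add i6), integral_add i5 i6] at key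
  simp only [integral_const_mul] at key
  rw [h.cov t htT t htT, h.cov s hs s hs, h.cov u hu u hu, h.cov s hs t htT, h.cov t htT u hu,
    h.cov s hs u hu, min_self, min_self, min_self, min_eq_left hst.le, min_eq_left htu.le,
    min_eq_left hsu.le] at key
  have hd : u - s ≠ 0 := (sub_pos.2 hsu).ne'
  have hab : (u - t) * (t - s) / (u - s) = 0 := by
    rw [← key, ha, hb]
    field_simp
    ring
  have : 0 < (u - t) * (t - s) / (u - s) :=
    div_pos (mul_pos (sub_pos.2 htu) (sub_pos.2 hst)) (sub_pos.2 hsu)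
  exact this.ne' hab

/-- Almost surely, the quadratic form and the denominator have the same sign. -/
theorem IsQuadraticHarness.ae_denom_pos {Ω : Type*} [MeasurableSpace Ω] {μ : Measure Ω}
    [IsProbabilityMeasure μ] {T : Set ℝ} {F : ℝ → ℝ → MeasurableSpace Ω} {X : ℝ → Ω → ℝ}
    {η θ σ τ γ : ℝ} (h : IsQuadraticHarness μ T F X η θ σ τ γ) {s u : ℝ} (hs : s ∈ T) (hu : u ∈ T)
    (hsu : s < u) :
    ∀ᵐ ω ∂μ, 0 < KB η θ σ τ γ s u (X s ω) (X u ω) → 0 < denom σ τ γ s u := by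
  set t := (s + u) / 2 with ht
  have hst : s < t := by rw [ht]; linarith
  have htu : t < u := by rw [ht]; linarith
  have htT : t ∈ T := h.ordConnected.out hs hu ⟨hst.le, htu.le⟩
  have hnn : 0 ≤ᵐ[μ] Var[X t; μ | F s u] :=
    condExp_nonneg (ae_of_all _ fun ω => by simp only [Pi.zero_apply, Pi.pow_apply]; positivity)
  filter_upwards [hnn, h.condVar s hs t htT u hu hst htu] with ω h1 h2 h3
  rw [h2] at h1
  -- A negative denominator with a positive quadratic form would make the conditional variance
  -- negative.
  rcases (h.denom_ne_zero hs hu hsu).lt_or_gt with hlt | hgt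
  · have hf : factor σ τ γ t s u < 0 :=
      div_neg_of_pos_of_neg (mul_pos (sub_pos.2 htu) (sub_pos.2 hst)) hlt
    have : factor σ τ γ t s u * KB η θ σ τ γ s u (X s ω) (X u ω) < 0 := mul_neg_of_neg_of_pos hf h3
    exact absurd h1 (not_le.2 this)
  · exact hgt

end Denominator

/-! ### Moments of a harness with constant endpoints -/

section Moments

variable {Ω : Type*} [mΩ : MeasurableSpace Ω] {P : Measure Ω} [IsProbabilityMeasure P]
  {I : Set ℝ} {X : ℝ → Ω → ℝ} {η θ σ τ γ R V zR zV : ℝ}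

theorem IsHarnessOn.integral_eq_interp (h : IsHarnessOn P I X η θ σ τ γ) (hR : R ∈ I) (hV : V ∈ I)
    (hzR : ∀ᵐ ω ∂P, X R ω = zR) (hzV : ∀ᵐ ω ∂P, X V ω = zV) {t : ℝ} (ht : t ∈ I) (hRt : R < t)
    (htV : t < V) : ∫ ω, X t ω ∂P = interp R t V zR zV := by
  have h1 := h.harness R hR t ht V hV hRt htV univ MeasurableSet.univ
  have h2 : (deviation X R t V) =ᵐ[P] fun ω => X t ω - interp R t V zR zV := by
    filter_upwards [hzR, hzV] with ω e1 e2
    simp [deviation, e1, e2]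
  rw [Measure.restrict_univ, integral_congr_ae h2,
    integral_sub ((h.memLp t ht).integrable one_le_two) (integrable_const _)] at h1
  simpa [sub_eq_zero] using h1

theorem IsHarnessOn.integral_sub_interp_sq (h : IsHarnessOn P I X η θ σ τ γ) (hR : R ∈ I)
    (hV : V ∈ I) (hzR : ∀ᵐ ω ∂P, X R ω = zR) (hzV : ∀ᵐ ω ∂P, X V ω = zV) {t : ℝ} (ht : t ∈ I)
    (hRt : R < t) (htV : t < V) :
    ∫ ω, (X t ω - interp R t V zR zV) ^ 2 ∂P
      = (V - t) * (t - R) * (KB η θ σ τ γ R V zR zV / denom σ τ γ R V) := by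
  have h1 := h.condVar R hR t ht V hV hRt htV univ MeasurableSet.univ
  have h2 : (fun ω => deviation X R t V ω ^ 2 - varForm η θ σ τ γ X R t V ω) =ᵐ[P]
      fun ω => (X t ω - interp R t V zR zV) ^ 2
        - factor σ τ γ t R V * KB η θ σ τ γ R V zR zV := by
    filter_upwards [hzR, hzV] with ω e1 e2
    simp [deviation, varForm, KB, e1, e2]
  have hi : Integrable (fun ω => (X t ω - interp R t V zR zV) ^ 2) P :=
    ((h.memLp t ht).sub (memLp_const _)).integrable_sq
  rw [Measure.restrict_univ, integral_congr_ae h2, integral_sub hi (integrable_const _),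
    sub_eq_zero] at h1
  rw [h1]
  simp [factor]
  ring

/-- The deviation of `X t` from the interpolation between `s` and `V` is orthogonal to functions of
`X s`. With `X V` constant, the covariance is therefore `(V - t) / (V - s)` times the variance at
`s`. -/
theorem IsHarnessOn.integral_sub_interp_mul (h : IsHarnessOn P I X η θ σ τ γ) (hR : R ∈ I)
    (hV : V ∈ I) (hzR : ∀ᵐ ω ∂P, X R ω = zR) (hzV : ∀ᵐ ω ∂P, X V ω = zV) {s t : ℝ} (hs : s ∈ I)
    (ht : t ∈ I) (hRs : R < s) (hst : s < t) (htV : t < V) :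
    ∫ ω, (X s ω - interp R s V zR zV) * (X t ω - interp R t V zR zV) ∂P
      = (V - t) * (s - R) * (KB η θ σ τ γ R V zR zV / denom σ τ γ R V) := by
  have hsV := hst.trans htV
  have L : ∀ r ∈ I, MemLp (fun ω => X r ω - interp R r V zR zV) 2 P := fun r hr =>
    (h.memLp r hr).sub (memLp_const _)
  have hD := memLp_deviation (t := t) (h.memLp s hs) (h.memLp t ht) (h.memLp V hV)
  have h1 := integral_mul_eq_zero_of_integrable
    (outerField_le (s := s) (u := V) h.measurable) (hD.integrable one_le_two)
    (h.harness s hs t ht V hV hst htV)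
    (h := fun ω => X s ω - interp R s V zR zV)
    (((measurable_outerField hs (Or.inl le_rfl)).sub_const _).stronglyMeasurable)
    ((L s hs).integrable_mul hD)
  have h2 : (fun ω => (X s ω - interp R s V zR zV) * deviation X s t V ω) =ᵐ[P] fun ω =>
      (X s ω - interp R s V zR zV) * (X t ω - interp R t V zR zV)
        - (V - t) / (V - s) * (X s ω - interp R s V zR zV) ^ 2 := by
    filter_upwards [hzV] with ω e
    have d1 : V - s ≠ 0 := (sub_pos.2 hsV).ne'
    have d2 : V - R ≠ 0 := (sub_pos.2 (hRs.trans hsV)).ne'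
    simp only [deviation, e, interp]
    field_simp
    ring
  have hi : Integrable (fun ω => (X s ω - interp R s V zR zV) * (X t ω - interp R t V zR zV)) P :=
    (L s hs).integrable_mul (L t ht)
  rw [integral_congr_ae h2, integral_sub hi
    ((L s hs).integrable_sq.const_mul _), integral_const_mul,
    h.integral_sub_interp_sq hR hV hzR hzV hs hRs hsV, sub_eq_zero] at h1
  rw [h1]
  have d1 : V - s ≠ 0 := (sub_pos.2 hsV).ne'
  field_simp

theorem IsHarnessOn.integral_mul (h : IsHarnessOn P I X η θ σ τ γ) (hR : R ∈ I)
    (hV : V ∈ I) (hzR : ∀ᵐ ω ∂P, X R ω = zR) (hzV : ∀ᵐ ω ∂P, X V ω = zV) {s t : ℝ} (hs : s ∈ I)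
    (ht : t ∈ I) (hs' : s ∈ Ioo R V) (ht' : t ∈ Ioo R V) :
    ∫ ω, X s ω * X t ω ∂P = interp R s V zR zV * interp R t V zR zV
      + (V - max s t) * (min s t - R) * (KB η θ σ τ γ R V zR zV / denom σ τ γ R V) := by
  have hc : ∫ ω, (X s ω - interp R s V zR zV) * (X t ω - interp R t V zR zV) ∂P
      = (V - max s t) * (min s t - R) * (KB η θ σ τ γ R V zR zV / denom σ τ γ R V) := by
    rcases lt_trichotomy s t with hst | rfl | hst
    · rw [max_eq_right hst.le, min_eq_left hst.le]
      exact h.integral_sub_interp_mul hR hV hzR hzV hs ht hs'.1 hst ht'.2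
    · simp only [max_self, min_self, ← pow_two]
      exact h.integral_sub_interp_sq hR hV hzR hzV hs hs'.1 hs'.2
    · rw [max_eq_left hst.le, min_eq_right hst.le,
        ← h.integral_sub_interp_mul hR hV hzR hzV ht hs ht'.1 hst hs'.2]
      simp only [mul_comm]
  have e : ∀ ω, X s ω * X t ω = (X s ω - interp R s V zR zV) * (X t ω - interp R t V zR zV)
      + (interp R t V zR zV * X s ω + (interp R s V zR zV * X t ω
        + -(interp R s V zR zV * interp R t V zR zV))) := fun ω => by ring
  have Ls := (h.memLp s hs).integrable one_le_two
  have Lt := (h.memLp t ht).integrable one_le_two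
  have i1 : Integrable (fun ω => (X s ω - interp R s V zR zV) * (X t ω - interp R t V zR zV)) P :=
    ((h.memLp s hs).sub (memLp_const _)).integrable_mul ((h.memLp t ht).sub (memLp_const _))
  have i2 := Ls.const_mul (interp R t V zR zV)
  have i3 := Lt.const_mul (interp R s V zR zV)
  have i4 : Integrable (fun _ : Ω => -(interp R s V zR zV * interp R t V zR zV)) P :=
    integrable_const _
  simp only [e]
  rw [integral_add i1 (i2.fun_add (i3.fun_add i4)), integral_add i2 (i3.fun_add i4),
    integral_add i3 i4, hc,
    integral_const_mul, integral_const_mul, h.integral_eq_interp hR hV hzR hzV hs hs'.1 hs'.2,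
    h.integral_eq_interp hR hV hzR hzV ht ht'.1 ht'.2]
  simp
  ring

/-- The process is Hölder continuous of order one half in `L²`. -/
theorem IsHarnessOn.integral_sub_sq_le (h : IsHarnessOn P I X η θ σ τ γ) (hR : R ∈ I)
    (hV : V ∈ I) (hzR : ∀ᵐ ω ∂P, X R ω = zR) (hzV : ∀ᵐ ω ∂P, X V ω = zV)
    (hk : 0 ≤ KB η θ σ τ γ R V zR zV / denom σ τ γ R V) {s t : ℝ} (hs : s ∈ I)
    (ht : t ∈ I) (hs' : s ∈ Ioo R V) (ht' : t ∈ Ioo R V) :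
    ∫ ω, (X s ω - X t ω) ^ 2 ∂P ≤ ((V - R) * (KB η θ σ τ γ R V zR zV / denom σ τ γ R V)
      + (V - R) * slope R V zR zV ^ 2) * |s - t| := by
  set k := KB η θ σ τ γ R V zR zV / denom σ τ γ R V with hkdef
  have e : ∀ ω, (X s ω - X t ω) ^ 2 = X s ω * X s ω + (-2 * (X s ω * X t ω) + X t ω * X t ω) :=
    fun ω => by ring
  have m : ∀ r ∈ I, ∀ q ∈ I, Integrable (fun ω => X r ω * X q ω) P := fun r hr q hq =>
    (h.memLp r hr).integrable_mul (h.memLp q hq)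
  simp only [e]
  rw [integral_add (m s hs s hs) (((m s hs t ht).const_mul _).fun_add (m t ht t ht)),
    integral_add ((m s hs t ht).const_mul _) (m t ht t ht), integral_const_mul,
    h.integral_mul hR hV hzR hzV hs hs hs' hs', h.integral_mul hR hV hzR hzV hs ht hs' ht',
    h.integral_mul hR hV hzR hzV ht ht ht' ht', ← hkdef, max_self, min_self, max_self, min_self]
  have hd : V - R ≠ 0 := (sub_pos.2 (hs'.1.trans hs'.2)).ne'
  have hm : interp R s V zR zV - interp R t V zR zV = slope R V zR zV * (s - t) := by
    simp only [interp, slope]; field_simp; ring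
  have hm2 : interp R s V zR zV ^ 2 - 2 * (interp R s V zR zV * interp R t V zR zV)
      + interp R t V zR zV ^ 2 = slope R V zR zV ^ 2 * (|s - t| * |s - t|) := by
    rw [abs_mul_abs_self, ← sq, ← mul_pow, ← hm]; ring
  -- With maximum and minimum written through `|s - t|`, the variance terms collapse to `k |s - t|
  -- (V - R) - k |s - t|²`, and the means contribute the squared slope times `|s - t|²`.
  have hmax : max s t = (s + t + |s - t|) / 2 := by
    rcases le_total s t with hst | hst
    · rw [max_eq_right hst, abs_of_nonpos (sub_nonpos.2 hst)]; ring
    · rw [max_eq_left hst, abs_of_nonneg (sub_nonneg.2 hst)]; ring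
  have hmin : min s t = (s + t - |s - t|) / 2 := by
    rcases le_total s t with hst | hst
    · rw [min_eq_left hst, abs_of_nonpos (sub_nonpos.2 hst)]; ring
    · rw [min_eq_right hst, abs_of_nonneg (sub_nonneg.2 hst)]; ring
  have habs : |s - t| ≤ V - R := abs_le.2 ⟨by linarith [hs'.1, ht'.2], by linarith [hs'.2, ht'.1]⟩
  have h0 := abs_nonneg (s - t)
  have hsq : |s - t| ^ 2 = (s - t) ^ 2 := sq_abs _
  rw [hmax, hmin]
  have hL : interp R s V zR zV * interp R s V zR zV + (V - s) * (s - R) * k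
      + (-2 * (interp R s V zR zV * interp R t V zR zV + (V - (s + t + |s - t|) / 2)
        * ((s + t - |s - t|) / 2 - R) * k)
      + (interp R t V zR zV * interp R t V zR zV + (V - t) * (t - R) * k))
      = slope R V zR zV ^ 2 * (|s - t| * |s - t|) + k * (|s - t| * (V - R))
        - k * (|s - t| ^ 2) := by
    rw [← hm2]
    linear_combination (k / 2) * hsq
  rw [hL]
  have p1 : slope R V zR zV ^ 2 * (|s - t| * |s - t|) ≤
      slope R V zR zV ^ 2 * (|s - t| * (V - R)) := by
    gcongr
  have p2 : 0 ≤ k * |s - t| ^ 2 := by positivity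
  nlinarith [p1, p2]

end Moments

/-! ### Convergence in `L²` -/

section SquareIntegrable

variable {Ω : Type*} [mΩ : MeasurableSpace Ω] {P : Measure Ω}

theorem eLpNorm_two_le_of_integral_sq_le {f : Ω → ℝ} (hf : MemLp f 2 P) {c : ℝ}
    (h : ∫ ω, f ω ^ 2 ∂P ≤ c) : eLpNorm f 2 P ≤ ENNReal.ofReal √c := by
  rw [hf.eLpNorm_eq_integral_rpow_norm two_ne_zero ENNReal.ofNat_ne_top]
  refine ENNReal.ofReal_le_ofReal ?_
  simp only [ENNReal.toReal_ofNat, Real.rpow_two, Real.norm_eq_abs, sq_abs]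
  rw [← one_div, ← Real.sqrt_eq_rpow]
  exact Real.sqrt_le_sqrt h

theorem inner_toLp_toLp {f g : Ω → ℝ} (hf : MemLp f 2 P) (hg : MemLp g 2 P) :
    inner ℝ (hf.toLp f) (hg.toLp g) = ∫ ω, f ω * g ω ∂P := by
  rw [L2.inner_def]
  refine integral_congr_ae ?_
  filter_upwards [hf.coeFn_toLp, hg.coeFn_toLp] with ω h1 h2
  rw [h1, h2]
  simp [mul_comm]

/-- Integrals of products depend continuously on the factors in `L²`. -/
theorem tendsto_integral_mul {ι : Type*} {l : Filter ι} {f g : ι → Ω → ℝ} {f' g' : Ω → ℝ}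
    (hf : ∀ i, MemLp (f i) 2 P) (hg : ∀ i, MemLp (g i) 2 P) (hf' : MemLp f' 2 P)
    (hg' : MemLp g' 2 P) (hfl : Tendsto (fun i => eLpNorm (f i - f') 2 P) l (𝓝 0))
    (hgl : Tendsto (fun i => eLpNorm (g i - g') 2 P) l (𝓝 0)) :
    Tendsto (fun i => ∫ ω, f i ω * g i ω ∂P) l (𝓝 (∫ ω, f' ω * g' ω ∂P)) := by
  have h1 := (Lp.tendsto_Lp_iff_tendsto_eLpNorm'' f hf f' hf').2 hfl
  have h2 := (Lp.tendsto_Lp_iff_tendsto_eLpNorm'' g hg g' hg').2 hgl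
  have := h1.inner (𝕜 := ℝ) h2
  simpa only [inner_toLp_toLp] using this

/-- Convergence in `L²` is compatible with linear combinations with convergent coefficients. -/
theorem tendsto_eLpNorm_linear_comb {ι : Type*} {l : Filter ι} {f g : ι → Ω → ℝ} {f' g' : Ω → ℝ}
    (hf : ∀ i, MemLp (f i) 2 P) (hg : ∀ i, MemLp (g i) 2 P) (hf' : MemLp f' 2 P)
    (hg' : MemLp g' 2 P) (hfl : Tendsto (fun i => eLpNorm (f i - f') 2 P) l (𝓝 0))
    (hgl : Tendsto (fun i => eLpNorm (g i - g') 2 P) l (𝓝 0)) {a b : ι → ℝ} {a' b' : ℝ}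
    (ha : Tendsto a l (𝓝 a')) (hb : Tendsto b l (𝓝 b')) :
    Tendsto (fun i => eLpNorm ((fun ω => a i * f i ω + b i * g i ω)
      - fun ω => a' * f' ω + b' * g' ω) 2 P) l (𝓝 0) := by
  have h1 := (Lp.tendsto_Lp_iff_tendsto_eLpNorm'' f hf f' hf').2 hfl
  have h2 := (Lp.tendsto_Lp_iff_tendsto_eLpNorm'' g hg g' hg').2 hgl
  refine (Lp.tendsto_Lp_iff_tendsto_eLpNorm'' (fun i ω => a i * f i ω + b i * g i ω)
    (fun i => ((hf i).const_mul (a i)).add ((hg i).const_mul (b i))) _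
    ((hf'.const_mul a').add (hg'.const_mul b'))).1 ?_
  exact (ha.smul h1).add (hb.smul h2)

end SquareIntegrable

/-! ### Continuity of the harness identities in the times -/

section Limits

variable {Ω : Type*} [mΩ : MeasurableSpace Ω] {P : Measure Ω}
  {X : ℝ → Ω → ℝ} {ι : Type*} {l : Filter ι} {s t u : ι → ℝ} {s' t' u' : ℝ}

theorem tendsto_eLpNorm_deviation (hs : ∀ i, MemLp (X (s i)) 2 P) (ht : ∀ i, MemLp (X (t i)) 2 P)
    (hu : ∀ i, MemLp (X (u i)) 2 P) (hs' : MemLp (X s') 2 P) (ht' : MemLp (X t') 2 P)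
    (hu' : MemLp (X u') 2 P) (hsl : Tendsto (fun i => eLpNorm (X (s i) - X s') 2 P) l (𝓝 0))
    (htl : Tendsto (fun i => eLpNorm (X (t i) - X t') 2 P) l (𝓝 0))
    (hul : Tendsto (fun i => eLpNorm (X (u i) - X u') 2 P) l (𝓝 0))
    (hs0 : Tendsto s l (𝓝 s')) (ht0 : Tendsto t l (𝓝 t')) (hu0 : Tendsto u l (𝓝 u'))
    (hne : u' - s' ≠ 0) :
    Tendsto (fun i => eLpNorm (deviation X (s i) (t i) (u i) - deviation X s' t' u') 2 P)
      l (𝓝 0) := by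
  have h1 := tendsto_eLpNorm_linear_comb hs hu hs' hu' hsl hul
    ((hu0.sub ht0).div (hu0.sub hs0) hne) ((ht0.sub hs0).div (hu0.sub hs0) hne)
  have h2 := tendsto_eLpNorm_linear_comb ht
    (fun i => memLp_interp (s := s i) (t := t i) (u := u i) (hs i) (hu i)) ht'
    (memLp_interp (t := t') hs' hu') htl h1 (tendsto_const_nhds (x := (1 : ℝ)))
    (tendsto_const_nhds (x := (-1 : ℝ)))
  refine h2.congr fun i => ?_
  congr 1
  ext ω
  simp only [Pi.sub_apply, deviation]
  ring

variable [IsFiniteMeasure P]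

theorem tendsto_integral_deviation (hs : ∀ i, MemLp (X (s i)) 2 P) (ht : ∀ i, MemLp (X (t i)) 2 P)
    (hu : ∀ i, MemLp (X (u i)) 2 P) (hs' : MemLp (X s') 2 P) (ht' : MemLp (X t') 2 P)
    (hu' : MemLp (X u') 2 P) (hsl : Tendsto (fun i => eLpNorm (X (s i) - X s') 2 P) l (𝓝 0))
    (htl : Tendsto (fun i => eLpNorm (X (t i) - X t') 2 P) l (𝓝 0))
    (hul : Tendsto (fun i => eLpNorm (X (u i) - X u') 2 P) l (𝓝 0))
    (hs0 : Tendsto s l (𝓝 s')) (ht0 : Tendsto t l (𝓝 t')) (hu0 : Tendsto u l (𝓝 u'))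
    (hne : u' - s' ≠ 0) :
    Tendsto (fun i => ∫ ω, deviation X (s i) (t i) (u i) ω ∂P) l
      (𝓝 (∫ ω, deviation X s' t' u' ω ∂P)) := by
  have h1 : Tendsto (fun _ : ι => eLpNorm ((fun _ : Ω => (1 : ℝ)) - fun _ => 1) 2 P) l (𝓝 0) := by
    simpa using tendsto_const_nhds
  have := tendsto_integral_mul (fun _ => memLp_const 1)
    (fun i => memLp_deviation (hs i) (ht i) (hu i)) (memLp_const 1) (memLp_deviation hs' ht' hu') h1
    (tendsto_eLpNorm_deviation hs ht hu hs' ht' hu' hsl htl hul hs0 ht0 hu0 hne)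
  simpa only [one_mul] using this

theorem integral_K (η θ σ τ γ : ℝ) {a b : Ω → ℝ} (ha : MemLp a 2 P) (hb : MemLp b 2 P) :
    ∫ ω, K η θ σ τ γ (a ω) (b ω) ∂P = ∫ _, (1 : ℝ) * 1 ∂P + η * ∫ ω, 1 * b ω ∂P
      + θ * ∫ ω, 1 * a ω ∂P + σ * ∫ ω, b ω * b ω ∂P + τ * ∫ ω, a ω * a ω ∂P
      - (1 - γ) * ∫ ω, a ω * b ω ∂P := by
  have i1 : Integrable (fun _ : Ω => (1 : ℝ)) P := integrable_const 1
  have i2 := (hb.integrable one_le_two).const_mul η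
  have i3 := (ha.integrable one_le_two).const_mul θ
  have i4 : Integrable (fun ω => σ * (b ω * b ω)) P := (hb.integrable_mul hb).const_mul σ
  have i5 : Integrable (fun ω => τ * (a ω * a ω)) P := (ha.integrable_mul ha).const_mul τ
  have i6 : Integrable (fun ω => (1 - γ) * (a ω * b ω)) P := (ha.integrable_mul hb).const_mul _
  simp only [K, one_mul, mul_assoc, pow_two]
  rw [integral_sub ((((i1.fun_add i2).fun_add i3).fun_add i4).fun_add i5) i6,
    integral_add (((i1.fun_add i2).fun_add i3).fun_add i4) i5,
    integral_add ((i1.fun_add i2).fun_add i3) i4, integral_add (i1.fun_add i2) i3,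
    integral_add i1 i2]
  simp only [integral_const_mul]

/-- Everything is a combination, with convergent coefficients, of integrals of products of two
factors converging in `L²`. Nonvanishing of the limiting denominator is needed for `factor` to
converge. -/
theorem tendsto_integral_sq_sub_varForm (η θ σ τ γ : ℝ)
    (hs : ∀ i, MemLp (X (s i)) 2 P) (ht : ∀ i, MemLp (X (t i)) 2 P)
    (hu : ∀ i, MemLp (X (u i)) 2 P) (hs' : MemLp (X s') 2 P) (ht' : MemLp (X t') 2 P)
    (hu' : MemLp (X u') 2 P) (hsl : Tendsto (fun i => eLpNorm (X (s i) - X s') 2 P) l (𝓝 0))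
    (htl : Tendsto (fun i => eLpNorm (X (t i) - X t') 2 P) l (𝓝 0))
    (hul : Tendsto (fun i => eLpNorm (X (u i) - X u') 2 P) l (𝓝 0))
    (hs0 : Tendsto s l (𝓝 s')) (ht0 : Tendsto t l (𝓝 t')) (hu0 : Tendsto u l (𝓝 u'))
    (hne : u' - s' ≠ 0) (hden : denom σ τ γ s' u' ≠ 0) :
    Tendsto (fun i => ∫ ω, (deviation X (s i) (t i) (u i) ω ^ 2
        - varForm η θ σ τ γ X (s i) (t i) (u i) ω) ∂P) l
      (𝓝 (∫ ω, (deviation X s' t' u' ω ^ 2 - varForm η θ σ τ γ X s' t' u' ω) ∂P)) := by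
  have hD := tendsto_eLpNorm_deviation hs ht hu hs' ht' hu' hsl htl hul hs0 ht0 hu0 hne
  have hDi := fun i => memLp_deviation (hs i) (ht i) (hu i)
  have hD' := memLp_deviation hs' ht' hu'
  have h1 : Tendsto (fun _ : ι => eLpNorm ((fun _ : Ω => (1 : ℝ)) - fun _ => 1) 2 P) l (𝓝 0) := by
    simpa using tendsto_const_nhds
  have hone : MemLp (fun _ : Ω => (1 : ℝ)) 2 P := memLp_const 1
  have hinv : Tendsto (fun i => (u i - s i)⁻¹) l (𝓝 (u' - s')⁻¹) := (hu0.sub hs0).inv₀ hne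
  have ha : Tendsto (fun i => eLpNorm ((fun ω => slope (s i) (u i) (X (s i) ω) (X (u i) ω))
      - fun ω => slope s' u' (X s' ω) (X u' ω)) 2 P) l (𝓝 0) := by
    refine (tendsto_eLpNorm_linear_comb hs hu hs' hu' hsl hul hinv.neg hinv).congr fun i => ?_
    congr 1
    ext ω
    simp only [Pi.sub_apply, slope]
    ring
  have hb : Tendsto (fun i => eLpNorm ((fun ω => intercept (s i) (u i) (X (s i) ω) (X (u i) ω))
      - fun ω => intercept s' u' (X s' ω) (X u' ω)) 2 P) l (𝓝 0) := by
    refine (tendsto_eLpNorm_linear_comb hs hu hs' hu' hsl hul (hu0.mul hinv)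
      (hs0.mul hinv).neg).congr fun i => ?_
    congr 1
    ext ω
    simp only [Pi.sub_apply, intercept]
    ring
  have hai := fun i => memLp_slope (hs i) (hu i)
  have hbi := fun i => memLp_intercept (hs i) (hu i)
  have ha' := memLp_slope hs' hu'
  have hb' := memLp_intercept hs' hu'
  have hK := (((((tendsto_integral_mul (fun _ => hone) (fun _ => hone) hone hone h1 h1).add
    ((tendsto_integral_mul (fun _ => hone) hbi hone hb' h1 hb).const_mul η)).add
    ((tendsto_integral_mul (fun _ => hone) hai hone ha' h1 ha).const_mul θ)).add
    ((tendsto_integral_mul hbi hbi hb' hb' hb hb).const_mul σ)).add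
    ((tendsto_integral_mul hai hai ha' ha' ha ha).const_mul τ)).sub
    ((tendsto_integral_mul hai hbi ha' hb' ha hb).const_mul (1 - γ))
  have hF : Tendsto (fun i => factor σ τ γ (t i) (s i) (u i)) l (𝓝 (factor σ τ γ t' s' u')) := by
    refine ((hu0.sub ht0).mul (ht0.sub hs0)).div ?_ hden
    exact ((hu0.mul ((hs0.mul_const σ).const_add 1)).add_const τ).sub (hs0.mul_const γ)
  have hDD := tendsto_integral_mul hDi hDi hD' hD' hD hD
  have e : ∀ {a b c : ℝ}, MemLp (X a) 2 P → MemLp (X b) 2 P → MemLp (X c) 2 P →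
      ∫ ω, (deviation X a b c ω ^ 2 - varForm η θ σ τ γ X a b c ω) ∂P
        = ∫ ω, deviation X a b c ω * deviation X a b c ω ∂P - factor σ τ γ b a c *
          (∫ ω, K η θ σ τ γ (slope a c (X a ω) (X c ω)) (intercept a c (X a ω) (X c ω)) ∂P) := by
    intro a b c h1 h2 h3
    rw [integral_sub (memLp_deviation h1 h2 h3).integrable_sq (integrable_varForm η θ σ τ γ h1 h3)]
    simp only [varForm, integral_const_mul, pow_two]
  rw [e hs' ht' hu', integral_K η θ σ τ γ ha' hb']
  refine (hDD.sub (hF.mul hK)).congr fun i => ?_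
  rw [e (hs i) (ht i) (hu i), integral_K η θ σ τ γ (hai i) (hbi i)]

end Limits

/-! ### Approximation by a dense set of times -/

section Dense

variable {S : Set ℝ} {R V : ℝ}

theorem exists_mem_Ioo_of_dense (hd : Ioo R V ⊆ closure S) {a b : ℝ} (hab : a < b) (ha : R ≤ a)
    (hb : b ≤ V) : ∃ s ∈ S, a < s ∧ s < b := by
  obtain ⟨c, hc1, hc2⟩ := exists_between hab
  have hc : c ∈ closure S := hd ⟨ha.trans_lt hc1, hc2.trans_le hb⟩
  obtain ⟨s, hs1, hs2⟩ := mem_closure_iff.1 hc (Ioo a b) isOpen_Ioo ⟨hc1, hc2⟩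
  exact ⟨s, hs2, hs1.1, hs1.2⟩

theorem neBot_nhdsWithin_right (hd : Ioo R V ⊆ closure S) {t : ℝ} (ht : t ∈ Ioo R V) :
    (𝓝[S ∩ Ioi t] t).NeBot := by
  rw [← mem_closure_iff_nhdsWithin_neBot, Metric.mem_closure_iff]
  intro ε hε
  obtain ⟨s, hs, h1, h2⟩ := exists_mem_Ioo_of_dense hd (a := t) (b := min (t + ε) V)
    (lt_min (by linarith) ht.2) ht.1.le (min_le_right _ _)
  refine ⟨s, ⟨hs, h1⟩, ?_⟩
  rw [Real.dist_eq, abs_of_neg (by linarith)]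
  linarith [h2.trans_le (min_le_left _ _)]

theorem neBot_nhdsWithin_left (hd : Ioo R V ⊆ closure S) {t : ℝ} (ht : t ∈ Ioo R V) :
    (𝓝[S ∩ Iio t] t).NeBot := by
  rw [← mem_closure_iff_nhdsWithin_neBot, Metric.mem_closure_iff]
  intro ε hε
  obtain ⟨s, hs, h1, h2⟩ := exists_mem_Ioo_of_dense hd (a := max (t - ε) R) (b := t)
    (max_lt (by linarith) ht.1) (le_max_right _ _) ht.2.le
  refine ⟨s, ⟨hs, h2⟩, ?_⟩
  rw [Real.dist_eq, abs_of_pos (by linarith)]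
  linarith [(le_max_left (t - ε) R).trans_lt h1]

theorem exists_seq_of_neBot {A : Set ℝ} {t : ℝ} (h : (𝓝[A] t).NeBot) :
    ∃ ns : ℕ → ℝ, (∀ n, ns n ∈ A) ∧ Tendsto ns atTop (𝓝 t) := by
  obtain ⟨ns, hns, h⟩ := mem_closure_iff_seq_limit.1 (mem_closure_iff_nhdsWithin_neBot.2 h)
  exact ⟨ns, hns, h⟩

end Dense

/-! ### From a dense set of times to all times -/

section Extension

variable {Ω : Type*} [mΩ : MeasurableSpace Ω] {P : Measure Ω}
  {S : Set ℝ} {X : ℝ → Ω → ℝ} {η θ σ τ γ R V C : ℝ}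

/-- At every time, the process is an almost sure limit of its values at times of `S` to the
right. -/
theorem exists_seq_tendsto_ae_of_right_continuous (hd : Ioo R V ⊆ closure S) {t : ℝ}
    (ht : t ∈ Ioo R V) (hrc : TendstoInMeasure P X (𝓝[>] t) (X t)) :
    ∃ ns : ℕ → ℝ, (∀ n, ns n ∈ S ∧ t < ns n) ∧ Tendsto ns atTop (𝓝 t) ∧
      ∀ᵐ ω ∂P, Tendsto (fun n => X (ns n) ω) atTop (𝓝 (X t ω)) := by
  have := neBot_nhdsWithin_right hd ht
  have h : TendstoInMeasure P X (𝓝[S ∩ Ioi t] t) (X t) := fun ε hε =>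
    (hrc ε hε).mono_left (nhdsWithin_mono t inter_subset_right)
  obtain ⟨ns, h1, h2⟩ := h.exists_seq_tendsto_ae'
  rw [tendsto_nhdsWithin_iff] at h1
  obtain ⟨N, hN⟩ := eventually_atTop.1 h1.2
  refine ⟨fun n => ns (n + N), fun n => hN _ (Nat.le_add_left _ _),
    h1.1.comp (tendsto_add_atTop_nat N), ?_⟩
  filter_upwards [h2] with ω hω
  exact hω.comp (tendsto_add_atTop_nat N)

/-- Fatou's lemma along times of `S` decreasing to `t` from the right with almost surely convergent
values; no integrability of `X t` is assumed beforehand. -/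
theorem eLpNorm_sub_le_of_right_continuous (hd : Ioo R V ⊆ closure S)
    (hX : ∀ t ∈ S, MemLp (X t) 2 P)
    (hC : ∀ s ∈ S, ∀ t ∈ S, ∫ ω, (X s ω - X t ω) ^ 2 ∂P ≤ C * |s - t|) {s t : ℝ} (hs : s ∈ S)
    (ht : t ∈ Ioo R V) (hrc : TendstoInMeasure P X (𝓝[>] t) (X t)) :
    eLpNorm (X s - X t) 2 P ≤ ENNReal.ofReal √(C * |s - t|) := by
  obtain ⟨ns, h1, h2, h3⟩ := exists_seq_tendsto_ae_of_right_continuous hd ht hrc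
  have hlim : Tendsto (fun n => ENNReal.ofReal √(C * |s - ns n|)) atTop
      (𝓝 (ENNReal.ofReal √(C * |s - t|))) := by
    have hcont : Continuous fun r => ENNReal.ofReal √(C * |s - r|) :=
      ENNReal.continuous_ofReal.comp (by fun_prop)
    exact (hcont.tendsto t).comp h2
  refine le_of_forall_gt fun c hc => ?_
  -- The Fatou bound needs one constant valid for all late `n`, whereas the available bounds vary
  -- with `n`; hence an intermediate `c'`.
  obtain ⟨c', hc1, hc2⟩ := exists_between hc
  refine lt_of_le_of_lt (Lp.eLpNorm_le_of_ae_tendsto (f := fun n => X s - X (ns n)) (u := atTop)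
    ?_ (fun n => ((hX s hs).sub (hX _ (h1 n).1)).aestronglyMeasurable) ?_) hc2
  · filter_upwards [hlim.eventually_lt_const hc1] with n hn
    exact (eLpNorm_two_le_of_integral_sq_le ((hX s hs).sub (hX _ (h1 n).1))
      (hC s hs _ (h1 n).1)).trans hn.le
  · filter_upwards [h3] with ω hω
    exact tendsto_const_nhds.sub hω

/-- Up to null sets, the events outside `(s, u)` are determined by the times of `S` outside a
smaller interval. -/
theorem outerField_le_eventuallyMeasurableSpace (hd : Ioo R V ⊆ closure S)
    (hrc : ∀ t ∈ Ioo R V, TendstoInMeasure P X (𝓝[>] t) (X t)) {s u s' u' : ℝ} (hs : s < s')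
    (hu : u' < u) :
    outerField (Ioo R V) X s u ≤ eventuallyMeasurableSpace (outerField S X s' u') (ae P) := by
  refine iSup₂_le fun r hr => ?_
  obtain ⟨hr, hr'⟩ := hr
  obtain ⟨ns, h1, h2, h3⟩ := exists_seq_tendsto_ae_of_right_continuous hd hr (hrc r hr)
  -- The approximating times lie to the right of `r`. The gap `s < s'` leaves room for them when `r
  -- ≤ s`; when `u ≤ r` they remain beyond `u'`.
  have h4 : ∀ᶠ n in atTop, ns n ≤ s' ∨ u' ≤ ns n := by
    rcases hr' with h | h
    · filter_upwards [h2.eventually_lt_const (h.trans_lt hs)] with n hn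
      exact Or.inl hn.le
    · exact Eventually.of_forall fun n => Or.inr ((hu.trans_le h).trans (h1 n).2).le
  obtain ⟨N, hN⟩ := eventually_atTop.1 h4
  -- The limsup is measurable without completing the σ-field and agrees with `X r` almost surely.
  have hm : Measurable[outerField S X s' u'] fun ω => limsup (fun n => X (ns (n + N)) ω) atTop :=
    Measurable.limsup fun n =>
      measurable_outerField (h1 _).1 (hN _ (Nat.le_add_left _ _))
  have he : X r =ᵐ[P] fun ω => limsup (fun n => X (ns (n + N)) ω) atTop := by
    filter_upwards [h3] with ω hω
    exact (hω.comp (tendsto_add_atTop_nat N)).limsup_eq.symm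
  have := @Measurable.eventuallyMeasurable_of_eventuallyEq _ (outerField S X s' u') (ae P) _ _ _ _ _
    hm he
  exact Measurable.comap_le this

theorem memLp_of_right_continuous (hd : Ioo R V ⊆ closure S) (hX : ∀ t ∈ S, MemLp (X t) 2 P)
    (hC : ∀ s ∈ S, ∀ t ∈ S, ∫ ω, (X s ω - X t ω) ^ 2 ∂P ≤ C * |s - t|) {t : ℝ}
    (ht : t ∈ Ioo R V) (htm : Measurable (X t)) (hrc : TendstoInMeasure P X (𝓝[>] t) (X t)) :
    MemLp (X t) 2 P := by
  obtain ⟨s, hs, -⟩ := exists_mem_Ioo_of_dense hd ht.1 le_rfl ht.2.le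
  have h : MemLp (X s - X t) 2 P :=
    ⟨(hX s hs).aestronglyMeasurable.sub htm.aestronglyMeasurable,
      (eLpNorm_sub_le_of_right_continuous hd hX hC hs ht hrc).trans_lt ENNReal.ofReal_lt_top⟩
  simpa using (hX s hs).sub h

theorem tendsto_eLpNorm_of_right_continuous (hd : Ioo R V ⊆ closure S)
    (hX : ∀ t ∈ S, MemLp (X t) 2 P)
    (hC : ∀ s ∈ S, ∀ t ∈ S, ∫ ω, (X s ω - X t ω) ^ 2 ∂P ≤ C * |s - t|) {t : ℝ}
    (ht : t ∈ Ioo R V) (hrc : TendstoInMeasure P X (𝓝[>] t) (X t)) {ns : ℕ → ℝ}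
    (hns : ∀ n, ns n ∈ S) (hlim : Tendsto ns atTop (𝓝 t)) :
    Tendsto (fun n => eLpNorm (X (ns n) - X t) 2 P) atTop (𝓝 0) := by
  have h0 : Tendsto (fun n => ENNReal.ofReal √(C * |ns n - t|)) atTop (𝓝 0) := by
    have hcont : Continuous fun r => ENNReal.ofReal √(C * |r - t|) :=
      ENNReal.continuous_ofReal.comp (by fun_prop)
    have := (hcont.tendsto t).comp hlim
    simpa [Function.comp_def] using this
  exact tendsto_of_tendsto_of_tendsto_of_le_of_le tendsto_const_nhds h0 (fun _ => zero_le)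
    fun n => eLpNorm_sub_le_of_right_continuous hd hX hC (hns n) ht hrc

variable [IsProbabilityMeasure P]

/-- A right continuous process which is a harness at a dense set of times is a harness at all
times. -/
theorem IsHarnessOn.extend (h : IsHarnessOn P S X η θ σ τ γ)
    (hd : Ioo R V ⊆ closure S) (hX : ∀ t ∈ Ioo R V, Measurable (X t))
    (hrc : ∀ t ∈ Ioo R V, TendstoInMeasure P X (𝓝[>] t) (X t))
    (hC : ∀ s ∈ S, ∀ t ∈ S, ∫ ω, (X s ω - X t ω) ^ 2 ∂P ≤ C * |s - t|)
    (hden : ∀ s ∈ Ioo R V, ∀ u ∈ Ioo R V, s < u → denom σ τ γ s u ≠ 0) :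
    IsHarnessOn P (Ioo R V) X η θ σ τ γ := by
  have hL : ∀ t ∈ Ioo R V, MemLp (X t) 2 P := fun t ht =>
    memLp_of_right_continuous hd h.memLp hC ht (hX t ht) (hrc t ht)
  have key : ∀ s ∈ Ioo R V, ∀ t ∈ Ioo R V, ∀ u ∈ Ioo R V, s < t → t < u →
      ∀ A, MeasurableSet[outerField (Ioo R V) X s u] A →
        ∫ ω in A, deviation X s t u ω ∂P = 0 ∧
        ∫ ω in A, (deviation X s t u ω ^ 2 - varForm η θ σ τ γ X s t u ω) ∂P = 0 := by
    intro s hs t ht u hu hst htu A hA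
    -- With `a n` above `s` and `c n` below `u`, the event `A` is, up to a null set, an outer event
    -- of `(a n, c n)` at the times of `S`. The identities at these times then pass to the limit
    -- over the fixed set `A`. The side from which `b n` approaches `t` is immaterial.
    obtain ⟨a, ha, hal⟩ := exists_seq_of_neBot (neBot_nhdsWithin_right hd hs)
    obtain ⟨b, hb, hbl⟩ := exists_seq_of_neBot (neBot_nhdsWithin_right hd ht)
    obtain ⟨c, hc, hcl⟩ := exists_seq_of_neBot (neBot_nhdsWithin_left hd hu)
    have hev : ∀ᶠ n in atTop, a n < b n ∧ b n < c n :=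
      (hal.eventually_lt hbl hst).and (hbl.eventually_lt hcl htu)
    have hA' : ∀ n, ∃ B, MeasurableSet[outerField S X (a n) (c n)] B ∧ A =ᵐ[P] B := fun n =>
      outerField_le_eventuallyMeasurableSpace hd hrc (ha n).2 (hc n).2 A hA
    have hmono : ∀ {ns : ℕ → ℝ} {r : ℝ}, r ∈ Ioo R V → (∀ n, ns n ∈ S) → Tendsto ns atTop (𝓝 r) →
        Tendsto (fun n => eLpNorm (X (ns n) - X r) 2 (P.restrict A)) atTop (𝓝 0) :=
      fun {ns r} hr hns hl => tendsto_of_tendsto_of_tendsto_of_le_of_le tendsto_const_nhds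
        (tendsto_eLpNorm_of_right_continuous hd h.memLp hC hr (hrc r hr) hns hl)
        (fun _ => zero_le) fun n => eLpNorm_mono_measure _ Measure.restrict_le_self
    have hne : u - s ≠ 0 := (sub_pos.2 (hst.trans htu)).ne'
    have hLS : ∀ r ∈ S, MemLp (X r) 2 (P.restrict A) := fun r hr => (h.memLp r hr).restrict A
    have l1 := tendsto_integral_deviation (P := P.restrict A) (fun n => hLS _ (ha n).1)
      (fun n => hLS _ (hb n).1) (fun n => hLS _ (hc n).1) ((hL s hs).restrict A)
      ((hL t ht).restrict A) ((hL u hu).restrict A) (hmono hs (fun n => (ha n).1) hal)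
      (hmono ht (fun n => (hb n).1) hbl) (hmono hu (fun n => (hc n).1) hcl) hal hbl hcl hne
    have l2 := tendsto_integral_sq_sub_varForm (P := P.restrict A) η θ σ τ γ
      (fun n => hLS _ (ha n).1)
      (fun n => hLS _ (hb n).1) (fun n => hLS _ (hc n).1) ((hL s hs).restrict A)
      ((hL t ht).restrict A) ((hL u hu).restrict A) (hmono hs (fun n => (ha n).1) hal)
      (hmono ht (fun n => (hb n).1) hbl) (hmono hu (fun n => (hc n).1) hcl) hal hbl hcl hne
      (hden s hs u hu (hst.trans htu))
    constructor
    · refine tendsto_nhds_unique l1 (tendsto_const_nhds.congr' ?_)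
      filter_upwards [hev] with n hn
      obtain ⟨B, hB, hAB⟩ := hA' n
      rw [setIntegral_congr_set hAB]
      exact (h.harness _ (ha n).1 _ (hb n).1 _ (hc n).1 hn.1 hn.2 B hB).symm
    · refine tendsto_nhds_unique l2 (tendsto_const_nhds.congr' ?_)
      filter_upwards [hev] with n hn
      obtain ⟨B, hB, hAB⟩ := hA' n
      rw [setIntegral_congr_set hAB]
      exact (h.condVar _ (ha n).1 _ (hb n).1 _ (hc n).1 hn.1 hn.2 B hB).symm
  exact ⟨hX, hL, fun s hs t ht u hu hst htu A hA => (key s hs t ht u hu hst htu A hA).1,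
    fun s hs t ht u hu hst htu A hA => (key s hs t ht u hu hst htu A hA).2⟩

/-- Continuity in `L²` carries first and second moments over from a dense set of times. -/
theorem moments_of_dense (hd : Ioo R V ⊆ closure S) (hXm : ∀ t ∈ Ioo R V, Measurable (X t))
    (hX : ∀ t ∈ S, MemLp (X t) 2 P)
    (hrc : ∀ t ∈ Ioo R V, TendstoInMeasure P X (𝓝[>] t) (X t))
    (hC : ∀ s ∈ S, ∀ t ∈ S, ∫ ω, (X s ω - X t ω) ^ 2 ∂P ≤ C * |s - t|) {m : ℝ → ℝ}
    (hm : Continuous m) (h1 : ∀ t ∈ S, ∫ ω, X t ω ∂P = m t) {c : ℝ → ℝ → ℝ}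
    (hc : Continuous fun q : ℝ × ℝ => c q.1 q.2)
    (h2 : ∀ s ∈ S, ∀ t ∈ S, ∫ ω, X s ω * X t ω ∂P = c s t) :
    (∀ t ∈ Ioo R V, ∫ ω, X t ω ∂P = m t) ∧
      ∀ s ∈ Ioo R V, ∀ t ∈ Ioo R V, ∫ ω, X s ω * X t ω ∂P = c s t := by
  have hL : ∀ t ∈ Ioo R V, MemLp (X t) 2 P := fun t ht =>
    memLp_of_right_continuous hd hX hC ht (hXm t ht) (hrc t ht)
  constructor
  · intro t ht
    obtain ⟨a, ha, hal⟩ := exists_seq_of_neBot (neBot_nhdsWithin_right hd ht)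
    have h0 : Tendsto (fun _ : ℕ => eLpNorm ((fun _ : Ω => (1 : ℝ)) - fun _ => 1) 2 P) atTop
        (𝓝 0) := by
      simp
    have := tendsto_integral_mul (fun _ => memLp_const 1) (fun n => hX _ (ha n).1) (memLp_const 1)
      (hL t ht) h0 (tendsto_eLpNorm_of_right_continuous hd hX hC ht (hrc t ht)
        (fun n => (ha n).1) hal)
    simp only [one_mul] at this
    refine tendsto_nhds_unique this (((hm.tendsto t).comp hal).congr fun n => ?_)
    exact (h1 _ (ha n).1).symm
  · intro s hs t ht
    obtain ⟨a, ha, hal⟩ := exists_seq_of_neBot (neBot_nhdsWithin_right hd hs)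
    obtain ⟨b, hb, hbl⟩ := exists_seq_of_neBot (neBot_nhdsWithin_right hd ht)
    have := tendsto_integral_mul (fun n => hX _ (ha n).1) (fun n => hX _ (hb n).1) (hL s hs)
      (hL t ht) (tendsto_eLpNorm_of_right_continuous hd hX hC hs (hrc s hs)
        (fun n => (ha n).1) hal) (tendsto_eLpNorm_of_right_continuous hd hX hC ht (hrc t ht)
        (fun n => (hb n).1) hbl)
    refine tendsto_nhds_unique this
      (((hc.tendsto (s, t)).comp (hal.prodMk_nhds hbl)).congr fun n => ?_)
    exact (h2 _ (ha n).1 _ (hb n).1).symm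

end Extension

/-! ### The Möbius time change -/

section TimeChange

variable {R V : ℝ}

/-- The time change of the bridge. -/
noncomputable def timeChange (R V t : ℝ) : ℝ := (t + R) / (t / V + 1)

theorem timeChange_eq (hV : 0 < V) {t : ℝ} (ht : 0 < t) :
    timeChange R V t = V * (t + R) / (t + V) := by
  have h1 : t + V ≠ 0 := by positivity
  have h2 : t / V + 1 ≠ 0 := by positivity
  rw [timeChange]
  field_simp

theorem timeChange_mem (hV : 0 < V) (hRV : R < V) {t : ℝ} (ht : 0 < t) :
    timeChange R V t ∈ Ioo R V := by
  have h1 : 0 < t + V := by positivity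
  rw [timeChange_eq hV ht]
  constructor
  · rw [lt_div_iff₀ h1]; nlinarith
  · rw [div_lt_iff₀ h1]; nlinarith

theorem timeChange_sub (hV : 0 < V) {s t : ℝ} (hs : 0 < s) (ht : 0 < t) :
    timeChange R V t - timeChange R V s = V * (V - R) * (t - s) / ((t + V) * (s + V)) := by
  have h1 : t + V ≠ 0 := by positivity
  have h2 : s + V ≠ 0 := by positivity
  rw [timeChange_eq hV ht, timeChange_eq hV hs]
  field_simp
  ring

theorem timeChange_lt (hV : 0 < V) (hRV : R < V) {s t : ℝ} (hs : 0 < s) (hst : s < t) :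
    timeChange R V s < timeChange R V t := by
  have ht := hs.trans hst
  have : 0 < timeChange R V t - timeChange R V s := by
    rw [timeChange_sub hV hs ht]
    have h3 := sub_pos.2 hRV
    have h4 := sub_pos.2 hst
    positivity
  linarith

end TimeChange

/-! ### The transformed parameters -/

section Algebra

variable {R V : ℝ}

/-- `denom` is bilinear in the vectors `(s, 1)` and `(u, 1)`, on which the Möbius map acts linearly
up to the scalars `s + V` and `u + V`. Dividing by `V` times the endpoint denominator normalises the
coefficient of `u` to one. -/
theorem denom_transform (σ τ γ : ℝ) (hV : 0 < V) (hD : denom σ τ γ R V ≠ 0) {s u : ℝ}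
    (hs : 0 < s) (hu : 0 < u) :
    denom (sigmaB σ τ γ R V) (tauB σ τ γ R V) (gammaB σ τ γ R V) s u
      = (u + V) * (s + V) * denom σ τ γ (timeChange R V s) (timeChange R V u)
        / (V * denom σ τ γ R V) := by
  have h1 : u + V ≠ 0 := by positivity
  have h2 : s + V ≠ 0 := by positivity
  rw [timeChange_eq hV hs, timeChange_eq hV hu]
  unfold sigmaB tauB gammaB
  obtain ⟨D, hDdef⟩ : ∃ D, D = denom σ τ γ R V := ⟨_, rfl⟩
  rw [← hDdef] at hD ⊢
  unfold denom at hDdef ⊢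
  field_simp
  rw [hDdef]
  ring

/-- Taylor expansion of the quadratic `K` at `(a, b)`, in the coordinates `V p + q` and `R p + q`.
The constant term is `M ^ 2 * D`, the gradient gives the first two new parameters, and the quadratic
part gives the other three. -/
theorem K_transform (η θ σ τ γ : ℝ) {a b p q M D : ℝ} (hV : 0 < V) (hRV : R < V) (hM : 0 < M)
    (hD : D = V * (1 + R * σ) + τ - R * γ) (hD0 : D ≠ 0) (hMD : M ^ 2 * D = K η θ σ τ γ a b) :
    K ((-θ + V * η - 2 * τ * a + 2 * σ * V * b - (1 - γ) * (V * a - b)) / (√V * M * D))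
      (√V * (θ - R * η + 2 * τ * a - 2 * R * σ * b - (1 - γ) * (b - R * a)) / (M * D))
      ((σ * V ^ 2 + (1 - γ) * V + τ) / (V * D)) (V * ((σ * R ^ 2 + (1 - γ) * R + τ) / D))
      ((V * γ - R * (V * σ + 1) - τ) / D)
      (√V / ((V - R) * M) * (p + q / V)) (√V / ((V - R) * M) * (R * p + q)) * (M ^ 2 * D)
      = K η θ σ τ γ (a + p) (b + q) := by
  -- Replacing the square root by a variable `w` with `w ^ 2 = V` makes the identity a rational one.
  obtain ⟨w, hw, hw2⟩ : ∃ w, 0 < w ∧ w ^ 2 = V := ⟨√V, Real.sqrt_pos.2 hV, Real.sq_sqrt hV.le⟩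
  have hsw : √V = w := by rw [← hw2]; exact Real.sqrt_sq hw.le
  have hd : V - R ≠ 0 := (sub_pos.2 hRV).ne'
  have hM' := hM.ne'
  have hw' := hw.ne'
  rw [hsw]
  have e1 : K ((-θ + V * η - 2 * τ * a + 2 * σ * V * b - (1 - γ) * (V * a - b)) / (w * M * D))
      (w * (θ - R * η + 2 * τ * a - 2 * R * σ * b - (1 - γ) * (b - R * a)) / (M * D))
      ((σ * V ^ 2 + (1 - γ) * V + τ) / (V * D)) (V * ((σ * R ^ 2 + (1 - γ) * R + τ) / D))
      ((V * γ - R * (V * σ + 1) - τ) / D)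
      (w / ((V - R) * M) * (p + q / V)) (w / ((V - R) * M) * (R * p + q)) * (M ^ 2 * D)
      = M ^ 2 * D
        + (-θ + V * η - 2 * τ * a + 2 * σ * V * b - (1 - γ) * (V * a - b)) * (R * p + q) / (V - R)
        + (θ - R * η + 2 * τ * a - 2 * R * σ * b - (1 - γ) * (b - R * a)) * (V * p + q) / (V - R)
        + (σ * V ^ 2 + (1 - γ) * V + τ) * (R * p + q) ^ 2 / (V - R) ^ 2
        + (σ * R ^ 2 + (1 - γ) * R + τ) * (V * p + q) ^ 2 / (V - R) ^ 2
        - (D - (V * γ - R * (V * σ + 1) - τ)) * (V * p + q) * (R * p + q) / (V - R) ^ 2 := by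
    rw [← hw2] at hd ⊢
    unfold K
    field_simp
  rw [e1, hMD, hD]
  unfold K
  field_simp
  ring

end Algebra

/-! ### Deviations and conditional variances under the transformation -/

section Transform

variable {Ω : Type*} {X : ℝ → Ω → ℝ} {η θ σ τ γ R V zR zV M : ℝ}

theorem transform_eq (R V zR zV M : ℝ) (X : ℝ → Ω → ℝ) (t : ℝ) (ω : Ω) :
    transform R V zR zV M X t ω = √V / ((V - R) * M) *
      ((t / V + 1) * X (timeChange R V t) ω - (t * (zV / V) + zR)) := rfl

/-- Since `(t / V + 1) * timeChange R V t = t + R`, affine functions of the new time become affine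
in `t` after multiplication by `t / V + 1`. Interpolation is thus preserved, and the affine centring
drops out. -/
theorem deviation_transform (hV : 0 < V) (hRV : R < V) {s t u : ℝ} (hs : 0 < s)
    (hst : s < t) (htu : t < u) (ω : Ω) :
    deviation (transform R V zR zV M X) s t u ω = √V / ((V - R) * M) * (t / V + 1) *
      deviation X (timeChange R V s) (timeChange R V t) (timeChange R V u) ω := by
  have ht := hs.trans hst
  have hu := ht.trans htu
  have hsu := hst.trans htu
  simp only [deviation, interp, transform_eq]
  rw [timeChange_sub hV ht hu, timeChange_sub hV hs hu, timeChange_sub hV hs ht]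
  have h1 : u + V ≠ 0 := by positivity
  have h2 : s + V ≠ 0 := by positivity
  have h3 : t + V ≠ 0 := by positivity
  have h4 : V - R ≠ 0 := (sub_pos.2 hRV).ne'
  have h5 : u - s ≠ 0 := (sub_pos.2 hsu).ne'
  generalize √V / ((V - R) * M) = c
  field_simp
  ring

/-- The line `a x + b` evaluated at the changed time and multiplied by `t / V + 1` is `(a + b / V) t
+ (R a + b)`. The line through the endpoint values becomes exactly the centring `t * (zV / V) + zR`.
The constant term gives `intercept_transform`. -/
theorem slope_transform (hV : 0 < V) (hRV : R < V) {s u : ℝ} (hs : 0 < s) (hsu : s < u) (ω : Ω) :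
    slope s u (transform R V zR zV M X s ω) (transform R V zR zV M X u ω)
      = √V / ((V - R) * M) *
        ((slope (timeChange R V s) (timeChange R V u) (X (timeChange R V s) ω)
          (X (timeChange R V u) ω) - slope R V zR zV)
        + (intercept (timeChange R V s) (timeChange R V u) (X (timeChange R V s) ω)
          (X (timeChange R V u) ω) - intercept R V zR zV) / V) := by
  have hu := hs.trans hsu
  simp only [slope, intercept, transform_eq]
  rw [timeChange_sub hV hs hu]
  generalize X (timeChange R V s) ω = x
  generalize X (timeChange R V u) ω = y
  rw [timeChange_eq hV hs, timeChange_eq hV hu]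
  have h1 : u + V ≠ 0 := by positivity
  have h2 : s + V ≠ 0 := by positivity
  have h4 : V - R ≠ 0 := (sub_pos.2 hRV).ne'
  have h5 : u - s ≠ 0 := (sub_pos.2 hsu).ne'
  generalize √V / ((V - R) * M) = c
  field_simp
  ring

theorem intercept_transform (hV : 0 < V) (hRV : R < V) {s u : ℝ} (hs : 0 < s) (hsu : s < u)
    (ω : Ω) :
    intercept s u (transform R V zR zV M X s ω) (transform R V zR zV M X u ω)
      = √V / ((V - R) * M) *
        (R * (slope (timeChange R V s) (timeChange R V u) (X (timeChange R V s) ω)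
          (X (timeChange R V u) ω) - slope R V zR zV)
        + (intercept (timeChange R V s) (timeChange R V u) (X (timeChange R V s) ω)
          (X (timeChange R V u) ω) - intercept R V zR zV)) := by
  have hu := hs.trans hsu
  simp only [slope, intercept, transform_eq]
  rw [timeChange_sub hV hs hu]
  generalize X (timeChange R V s) ω = x
  generalize X (timeChange R V u) ω = y
  rw [timeChange_eq hV hs, timeChange_eq hV hu]
  have h1 : u + V ≠ 0 := by positivity
  have h2 : s + V ≠ 0 := by positivity
  have h4 : V - R ≠ 0 := (sub_pos.2 hRV).ne'
  have h5 : u - s ≠ 0 := (sub_pos.2 hsu).ne'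
  generalize √V / ((V - R) * M) = c
  field_simp
  ring

theorem varForm_transform (hV : 0 < V) (hRV : R < V) (hD : 0 < denom σ τ γ R V)
    (hK : 0 < KB η θ σ τ γ R V zR zV) {s t u : ℝ} (hs : 0 < s) (hst : s < t) (htu : t < u)
    (hden : denom σ τ γ (timeChange R V s) (timeChange R V u) ≠ 0) (ω : Ω) :
    varForm (etaB η θ σ τ γ R V zR zV) (thetaB η θ σ τ γ R V zR zV) (sigmaB σ τ γ R V)
        (tauB σ τ γ R V) (gammaB σ τ γ R V)
        (transform R V zR zV (MB η θ σ τ γ R V zR zV) X) s t u ω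
      = (√V / ((V - R) * MB η θ σ τ γ R V zR zV) * (t / V + 1)) ^ 2 *
        varForm η θ σ τ γ X (timeChange R V s) (timeChange R V t) (timeChange R V u) ω := by
  have ht := hs.trans hst
  have hu := ht.trans htu
  have hsu := hst.trans htu
  have hM : 0 < MB η θ σ τ γ R V zR zV := Real.sqrt_pos.2 (div_pos hK hD)
  have hM2 : MB η θ σ τ γ R V zR zV ^ 2 * denom σ τ γ R V = KB η θ σ τ γ R V zR zV := by
    rw [MB, Real.sq_sqrt (div_pos hK hD).le, div_mul_cancel₀ _ hD.ne']
  have key := K_transform η θ σ τ γ (a := slope R V zR zV) (b := intercept R V zR zV)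
    (p := slope (timeChange R V s) (timeChange R V u) (X (timeChange R V s) ω)
          (X (timeChange R V u) ω) - slope R V zR zV)
    (q := intercept (timeChange R V s) (timeChange R V u) (X (timeChange R V s) ω)
          (X (timeChange R V u) ω) - intercept R V zR zV) hV hRV hM rfl hD.ne' hM2
  rw [add_sub_cancel, add_sub_cancel] at key
  unfold varForm
  rw [slope_transform hV hRV hs hsu, intercept_transform hV hRV hs hsu, ← key]
  change _ * K (etaB η θ σ τ γ R V zR zV) (thetaB η θ σ τ γ R V zR zV) (sigmaB σ τ γ R V)
        (tauB σ τ γ R V) (gammaB σ τ γ R V) _ _ = _ * (_ * (K (etaB η θ σ τ γ R V zR zV)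
        (thetaB η θ σ τ γ R V zR zV) (sigmaB σ τ γ R V)
        (tauB σ τ γ R V) (gammaB σ τ γ R V) _ _ * (MB η θ σ τ γ R V zR zV ^ 2 * denom σ τ γ R V)))
  generalize K (etaB η θ σ τ γ R V zR zV) (thetaB η θ σ τ γ R V zR zV) (sigmaB σ τ γ R V)
        (tauB σ τ γ R V) (gammaB σ τ γ R V) _ _ = k
  generalize MB η θ σ τ γ R V zR zV = M at *
  unfold factor
  rw [denom_transform σ τ γ hV hD.ne' hs hu, timeChange_sub hV ht hu, timeChange_sub hV hs ht]
  have hD' := hD.ne'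
  generalize denom σ τ γ (timeChange R V s) (timeChange R V u) = d at *
  generalize denom σ τ γ R V = D at *
  have h1 : u + V ≠ 0 := by positivity
  have h2 : s + V ≠ 0 := by positivity
  have h3 : t + V ≠ 0 := by positivity
  have h4 : V - R ≠ 0 := (sub_pos.2 hRV).ne'
  rw [mul_pow, div_pow, Real.sq_sqrt hV.le]
  field_simp

end Transform

/-! ### Return to conditional expectations and the transformed harness -/

theorem condExp_ae_eq_of_forall_setIntegral_sub_eq_zero {Ω : Type*} {m : MeasurableSpace Ω}
    [mΩ : MeasurableSpace Ω] {μ : Measure Ω} [IsFiniteMeasure μ] (hm : m ≤ mΩ) {f g : Ω → ℝ}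
    (hf : Integrable f μ) (hg : Integrable g μ) (hgm : StronglyMeasurable[m] g)
    (h : ∀ A, MeasurableSet[m] A → ∫ ω in A, (f ω - g ω) ∂μ = 0) : μ[f | m] =ᵐ[μ] g := by
  refine (ae_eq_condExp_of_forall_setIntegral_eq hm hf (fun _ _ _ => hg.integrableOn) ?_
    hgm.aestronglyMeasurable).symm
  intro A hA _
  have := h A hA
  rw [integral_sub hf.integrableOn hg.integrableOn, sub_eq_zero] at this
  exact this.symm

/-- A harness in terms of set integrals, with the covariances of a quadratic harness, is a
quadratic harness. -/
theorem IsHarnessOn.isQuadraticHarness {Ω : Type*} [mΩ : MeasurableSpace Ω] {P : Measure Ω}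
    [IsProbabilityMeasure P] {T : Set ℝ} {X : ℝ → Ω → ℝ} {η θ σ τ γ : ℝ}
    (h : IsHarnessOn P T X η θ σ τ γ) (hTo : IsOpen T) (hTc : T.OrdConnected) (hTn : T.Nonempty)
    (hT : T ⊆ Ioi 0) (hγ : -1 ≤ γ) (hmean : ∀ t ∈ T, ∫ ω, X t ω ∂P = 0)
    (hcov : ∀ s ∈ T, ∀ t ∈ T, ∫ ω, X s ω * X t ω ∂P = min s t) :
    IsQuadraticHarness P T (outerField T X) X η θ σ τ γ := by
  have hle : ∀ s u, outerField T X s u ≤ mΩ := fun s u => outerField_le h.measurable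
  have hH : ∀ s ∈ T, ∀ t ∈ T, ∀ u ∈ T, s < t → t < u →
      P[X t | outerField T X s u] =ᵐ[P] fun ω => interp s t u (X s ω) (X u ω) := by
    intro s hs t ht u hu hst htu
    refine condExp_ae_eq_of_forall_setIntegral_sub_eq_zero (hle s u)
      ((h.memLp t ht).integrable one_le_two)
      ((memLp_interp (h.memLp s hs) (h.memLp u hu)).integrable one_le_two) ?_
      (h.harness s hs t ht u hu hst htu)
    exact (((measurable_outerField hs (Or.inl le_rfl)).const_mul _).add
      ((measurable_outerField hu (Or.inr le_rfl)).const_mul _)).stronglyMeasurable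
  refine ⟨hTo, hTc, hTn, hT, hγ, fun s _ u _ _ => hle s u, ?_, ?_, h.memLp, hmean, hcov, hH, ?_⟩
  · intro r _ s _ t _ u _ hrs _ htu
    exact outerField_mono_set subset_rfl hrs htu
  · intro s _ t _ _ u hu hut
    exact measurable_outerField hu hut
  · intro s hs t ht u hu hst htu
    have hcong : (X t - P[X t | outerField T X s u]) ^ 2 =ᵐ[P]
        fun ω => deviation X s t u ω ^ 2 := by
      filter_upwards [hH s hs t ht u hu hst htu] with ω hω
      simp [deviation, hω]
    refine (condExp_congr_ae hcong).trans ?_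
    refine condExp_ae_eq_of_forall_setIntegral_sub_eq_zero (hle s u)
      (memLp_deviation (h.memLp s hs) (h.memLp t ht) (h.memLp u hu)).integrable_sq
      (integrable_varForm η θ σ τ γ (h.memLp s hs) (h.memLp u hu)) ?_
      (h.condVar s hs t ht u hu hst htu)
    exact (measurable_varForm η θ σ τ γ (t := t) (measurable_outerField hs (Or.inl le_rfl))
      (measurable_outerField hu (Or.inr le_rfl))).stronglyMeasurable

section Transform

variable {Ω : Type*} [mΩ : MeasurableSpace Ω] {P : Measure Ω} [IsProbabilityMeasure P]
  {X : ℝ → Ω → ℝ} {η θ σ τ γ R V zR zV : ℝ}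

/-- The time change is increasing, so it sends times outside `(s, u)` to times outside the image
interval. -/
theorem outerField_transform_le {Ω : Type*} {X : ℝ → Ω → ℝ} {R V zR zV M : ℝ} (hV : 0 < V)
    (hRV : R < V) {s u : ℝ} (hs : 0 < s) (hu : 0 < u) :
    outerField (Ioi 0) (transform R V zR zV M X) s u
      ≤ outerField (Ioo R V) X (timeChange R V s) (timeChange R V u) := by
  refine iSup₂_le fun r hr => ?_
  obtain ⟨hr0, hr⟩ := hr
  have hmono : StrictMonoOn (timeChange R V) (Ioi 0) := fun a ha b _ hab =>
    timeChange_lt hV hRV ha hab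
  have hX : Measurable[outerField (Ioo R V) X (timeChange R V s) (timeChange R V u)]
      (X (timeChange R V r)) :=
    measurable_outerField (timeChange_mem hV hRV hr0)
      (hr.imp (fun h => (hmono.le_iff_le hr0 hs).2 h) fun h => (hmono.le_iff_le hu hr0).2 h)
  have hY : Measurable[outerField (Ioo R V) X (timeChange R V s) (timeChange R V u)]
      (QHBridge.transform R V zR zV M X r) :=
    ((hX.const_mul (r / V + 1)).sub_const _).const_mul _
  exact hY.comap_le

theorem memLp_transform {M t : ℝ} (h : MemLp (X (timeChange R V t)) 2 P) :
    MemLp (transform R V zR zV M X t) 2 P :=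
  (((h.const_mul (t / V + 1)).sub (memLp_const (t * (zV / V) + zR))).const_mul _)

/-- The transformed harness. -/
theorem IsHarnessOn.transform (h : IsHarnessOn P (Ioo R V) X η θ σ τ γ) (hV : 0 < V)
    (hRV : R < V) (hD : 0 < denom σ τ γ R V) (hK : 0 < KB η θ σ τ γ R V zR zV)
    (hden : ∀ s ∈ Ioo R V, ∀ u ∈ Ioo R V, s < u → denom σ τ γ s u ≠ 0) :
    IsHarnessOn P (Ioi 0) (transform R V zR zV (MB η θ σ τ γ R V zR zV) X)
      (etaB η θ σ τ γ R V zR zV) (thetaB η θ σ τ γ R V zR zV) (sigmaB σ τ γ R V)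
      (tauB σ τ γ R V) (gammaB σ τ γ R V) := by
  refine ⟨fun t ht => ?_, fun t ht => ?_, ?_, ?_⟩
  · exact (((h.measurable _ (timeChange_mem hV hRV ht)).const_mul _).sub_const _).const_mul _
  · exact memLp_transform (h.memLp _ (timeChange_mem hV hRV ht))
  · intro s hs t ht u hu hst htu A hA
    simp only [deviation_transform hV hRV hs hst htu, integral_const_mul]
    rw [h.harness _ (timeChange_mem hV hRV hs) _ (timeChange_mem hV hRV ht) _
      (timeChange_mem hV hRV hu) (timeChange_lt hV hRV hs hst) (timeChange_lt hV hRV ht htu) A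
      (outerField_transform_le hV hRV hs hu A hA), mul_zero]
  · intro s hs t ht u hu hst htu A hA
    have hlt := timeChange_lt hV hRV hs (hst.trans htu)
    simp only [deviation_transform hV hRV hs hst htu, varForm_transform hV hRV hD hK hs hst htu
      (hden _ (timeChange_mem hV hRV hs) _ (timeChange_mem hV hRV hu) hlt),
      mul_pow _ (deviation _ _ _ _ _),
      ← mul_sub, integral_const_mul]
    rw [h.condVar _ (timeChange_mem hV hRV hs) _ (timeChange_mem hV hRV ht) _
      (timeChange_mem hV hRV hu) (timeChange_lt hV hRV hs hst) (timeChange_lt hV hRV ht htu) A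
      (outerField_transform_le hV hRV hs hu A hA), mul_zero]

/-- The centring is the scaled mean of the bridge, and the time change turns the covariance `(V - y)
(x - R) M²` into the smaller of the two original times. -/
theorem isQuadraticHarness_transform (h : IsHarnessOn P (Ioo R V) X η θ σ τ γ) (hR : 0 < R)
    (hRV : R < V) (hγ : -1 ≤ γ) (hD : 0 < denom σ τ γ R V) (hK : 0 < KB η θ σ τ γ R V zR zV)
    (hden : ∀ s ∈ Ioo R V, ∀ u ∈ Ioo R V, s < u → denom σ τ γ s u ≠ 0)
    (hmean : ∀ t ∈ Ioo R V, ∫ ω, X t ω ∂P = interp R t V zR zV)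
    (hcov : ∀ s ∈ Ioo R V, ∀ t ∈ Ioo R V, ∫ ω, X s ω * X t ω ∂P
      = interp R s V zR zV * interp R t V zR zV
      + (V - max s t) * (min s t - R) * (KB η θ σ τ γ R V zR zV / denom σ τ γ R V)) :
    IsQuadraticHarness P (Ioi 0)
      (outerField (Ioi 0) (transform R V zR zV (MB η θ σ τ γ R V zR zV) X))
      (transform R V zR zV (MB η θ σ τ γ R V zR zV) X)
      (etaB η θ σ τ γ R V zR zV) (thetaB η θ σ τ γ R V zR zV) (sigmaB σ τ γ R V)
      (tauB σ τ γ R V) (gammaB σ τ γ R V) := by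
  have hV : 0 < V := hR.trans hRV
  have hd : V - R ≠ 0 := (sub_pos.2 hRV).ne'
  have hY := h.transform hV hRV hD hK hden
  set M := MB η θ σ τ γ R V zR zV with hMdef
  have hM : 0 < M := Real.sqrt_pos.2 (div_pos hK hD)
  have hM2 : KB η θ σ τ γ R V zR zV / denom σ τ γ R V = M ^ 2 := by
    rw [hMdef, MB, Real.sq_sqrt (div_pos hK hD).le]
  -- the centring of the transformed process
  have hline : ∀ {t : ℝ}, 0 < t →
      t * (zV / V) + zR = (t / V + 1) * interp R (timeChange R V t) V zR zV := by
    intro t ht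
    have h1 : t + V ≠ 0 := by positivity
    rw [timeChange_eq hV ht, interp]
    field_simp
    ring
  refine hY.isQuadraticHarness isOpen_Ioi ordConnected_Ioi nonempty_Ioi subset_rfl ?_ ?_ ?_
  -- One plus the new last parameter equals `(V - R) (1 + γ)` divided by the denominator.
  · rw [gammaB, le_div_iff₀ hD, denom]
    nlinarith [mul_nonneg (sub_pos.2 hRV).le (by linarith : 0 ≤ 1 + γ)]
  · intro t ht
    have htm := timeChange_mem hV hRV ht
    have hi := (h.memLp _ htm).integrable one_le_two
    simp only [transform_eq, integral_const_mul]
    rw [integral_sub (hi.const_mul _) (integrable_const _), integral_const_mul, hmean _ htm,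
      hline ht]
    simp
  · have main : ∀ s ∈ Ioi (0 : ℝ), ∀ t ∈ Ioi (0 : ℝ), s ≤ t →
        ∫ ω, transform R V zR zV M X s ω * transform R V zR zV M X t ω ∂P = s := by
      intro s hs t ht hst
      have hsm := timeChange_mem hV hRV hs
      have htm := timeChange_mem hV hRV ht
      have hle : timeChange R V s ≤ timeChange R V t := by
        rcases hst.eq_or_lt with rfl | hlt
        · rfl
        · exact (timeChange_lt hV hRV hs hlt).le
      set x := timeChange R V s with hx
      set y := timeChange R V t with hy
      set a := interp R x V zR zV with ha
      set b := interp R y V zR zV with hb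
      have e : ∀ ω, transform R V zR zV M X s ω * transform R V zR zV M X t ω
          = (√V / ((V - R) * M)) ^ 2 * (s / V + 1) * (t / V + 1) *
            (X x ω * X y ω + (-b * X x ω + (-a * X y ω + a * b))) := by
        intro ω
        rw [transform_eq, transform_eq, hline hs, hline ht]
        ring
      have i1 : Integrable (fun ω => X x ω * X y ω) P :=
        (h.memLp _ hsm).integrable_mul (h.memLp _ htm)
      have i2 := ((h.memLp _ hsm).integrable one_le_two).const_mul (-b)
      have i3 := ((h.memLp _ htm).integrable one_le_two).const_mul (-a)
      have i4 : Integrable (fun _ : Ω => a * b) P := integrable_const _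
      simp only [e, integral_const_mul]
      rw [integral_add i1 (i2.fun_add (i3.fun_add i4)), integral_add i2 (i3.fun_add i4),
        integral_add i3 i4, integral_const_mul, integral_const_mul, hmean _ hsm, hmean _ htm,
        hcov _ hsm _ htm, max_eq_right hle, min_eq_left hle, hM2, ← ha, ← hb, div_pow,
        Real.sq_sqrt hV.le]
      simp only [integral_const, probReal_univ, one_smul]
      have h1 : t + V ≠ 0 := by have : 0 < t := ht; positivity
      have h2 : s + V ≠ 0 := by have : 0 < s := hs; positivity
      have hyV : V - y = V * (V - R) / (t + V) := by
        rw [hy, timeChange_eq hV ht]; field_simp; ring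
      have hxR : x - R = s * (V - R) / (s + V) := by
        rw [hx, timeChange_eq hV hs]; field_simp; ring
      rw [hyV, hxR]
      have hM' := hM.ne'
      field_simp
      ring
    intro s hs t ht
    rcases le_total s t with hst | hst
    · rw [min_eq_left hst, main s hs t ht hst]
    · rw [min_eq_right hst]
      refine Eq.trans ?_ (main t ht s hs hst)
      simp only [mul_comm]

end Transform

/-! ### Bridge laws on the closed countable time set -/

/-- The time set `S` together with the two endpoints. -/
abbrev closeTimes (R V : ℝ) (S : Set ℝ) : Set ℝ := insert R (insert V S)

/-- The transition kernels of the bridge, with the terminal value fixed. -/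
noncomputable def fixEnd (p : ℝ → ℝ → Kernel (ℝ × ℝ) ℝ) (zV : ℝ) (s t : ℝ) : Kernel ℝ ℝ :=
  (p s t).comap (fun x => (x, zV)) (measurable_id.prodMk measurable_const)

theorem fixEnd_apply (p : ℝ → ℝ → Kernel (ℝ × ℝ) ℝ) (zV s t x : ℝ) :
    fixEnd p zV s t x = p s t (x, zV) := rfl

/-- A law on paths with times `S ∪ {R, V}` with the properties that the conditional law of a
quadratic harness given its values at `R` and `V` has almost surely. -/
structure IsBridgeLaw (R V : ℝ) (S : Set ℝ) (Q : Measure (closeTimes R V S → ℝ))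
    (π : ℝ → Kernel (ℝ × ℝ) ℝ) (p : ℝ → ℝ → Kernel (ℝ × ℝ) ℝ) (η θ σ τ γ zR zV : ℝ) : Prop where
  harness : IsHarnessOn Q (closeTimes R V S) (coord (closeTimes R V S)) η θ σ τ γ
  left_end : ∀ᵐ x ∂Q, coord (closeTimes R V S) R x = zR
  right_end : ∀ᵐ x ∂Q, coord (closeTimes R V S) V x = zV
  marginal : ∀ t ∈ S, Q.map (coord (closeTimes R V S) t) = π t (zR, zV)
  transition : HasTransitions Q S (coord (closeTimes R V S)) (fixEnd p zV)

/-! ### Extending a process from a dense set of times -/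

section Existence

variable {Ω : Type*} [mΩ : MeasurableSpace Ω] {P : Measure Ω} {S : Set ℝ} {R V C : ℝ}

/-- A process indexed by a dense set of times which is Hölder continuous in `L²` extends to all
times, continuously in probability. -/
theorem exists_extension_of_dense (hS : S ⊆ Ioo R V) (hd : Ioo R V ⊆ closure S)
    {X : ℝ → Ω → ℝ} (hX : ∀ t ∈ S, MemLp (X t) 2 P)
    (hC : ∀ s ∈ S, ∀ t ∈ S, ∫ ω, (X s ω - X t ω) ^ 2 ∂P ≤ C * |s - t|)
    (hXm : ∀ t ∈ S, Measurable (X t)) :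
    ∃ Y : ℝ → Ω → ℝ, (∀ t, t ∉ Ioo R V ∨ t ∈ S → Y t = X t) ∧ (∀ t ∈ Ioo R V, Measurable (Y t)) ∧
      ∀ t ∈ Ioo R V, TendstoInMeasure P Y (𝓝[>] t) (Y t) := by
  classical
  let f : S → Lp ℝ 2 P := fun s => (hX s s.2).toLp (X s)
  have hf : UniformContinuous f := by
    rw [Metric.uniformContinuous_iff]
    intro ε hε
    -- The sign of `C` is not known; `|C| + 1` is positive in any case and dominates it.
    refine ⟨ε ^ 2 / (|C| + 1), by positivity, fun {a b} hab => ?_⟩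
    have h1 := eLpNorm_two_le_of_integral_sq_le ((hX a a.2).sub (hX b b.2)) (hC a a.2 b b.2)
    have h2 : dist (f a) (f b) ≤ √(C * |(a : ℝ) - b|) := by
      rw [Lp.dist_edist, Lp.edist_toLp_toLp]
      exact ENNReal.toReal_le_of_le_ofReal (Real.sqrt_nonneg _) h1
    refine h2.trans_lt ?_
    rw [Real.sqrt_lt' hε]
    have h3 : |(a : ℝ) - b| < ε ^ 2 / (|C| + 1) := hab
    rw [lt_div_iff₀ (by positivity)] at h3
    have h4 := abs_nonneg ((a : ℝ) - b)
    have h5 := mul_le_mul_of_nonneg_right (le_abs_self C) h4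
    linarith
  have he : IsUniformInducing (inclusion hS) :=
    (isUniformEmbedding_set_inclusion hS).isUniformInducing
  have hde : DenseRange (inclusion hS) := (denseRange_inclusion_iff hS).2 hd
  let G : Ioo R V → Lp ℝ 2 P := (he.isDenseInducing hde).extend f
  have hG : Continuous G := (uniformContinuous_uniformly_extend he hde hf).continuous
  have hGS : ∀ s : S, G (inclusion hS s) = f s := fun s => uniformly_extend_of_ind he hde hf s
  let H : ℝ → Lp ℝ 2 P := fun t => if h : t ∈ Ioo R V then G ⟨t, h⟩ else 0
  have hH : ∀ t ∈ Ioo R V, ContinuousAt H t := by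
    intro t ht
    have : ContinuousOn H (Ioo R V) := by
      rw [continuousOn_iff_continuous_domRestrict]
      convert hG using 1
      ext1 s
      have hs : (s : ℝ) ∈ Ioo R V := s.2
      simp only [domRestrict_apply, H, dif_pos hs]
    exact this.continuousAt (isOpen_Ioo.mem_nhds ht)
  -- The values on `S` and off the interval are kept exactly, not merely up to null sets, so
  -- marginals, past fields and endpoint values carry over unchanged. Elsewhere a representative of
  -- the `L²` extension is used.
  let Y : ℝ → Ω → ℝ := fun t => if t ∉ Ioo R V ∨ t ∈ S then X t else H t
  have hYH : ∀ t ∈ Ioo R V, H t =ᵐ[P] Y t := by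
    intro t ht
    by_cases hts : t ∈ S
    · have h1 : Y t = X t := if_pos (Or.inr hts)
      have h2 : H t = f ⟨t, hts⟩ := by
        simp only [H, dif_pos ht]
        exact hGS ⟨t, hts⟩
      rw [h1, h2]
      exact (hX t hts).coeFn_toLp
    · have h1 : Y t = H t := if_neg (by simp [ht.1, ht.2, hts])
      rw [h1]
  refine ⟨Y, fun t ht => if_pos ht, ?_, ?_⟩
  · intro t ht
    by_cases hts : t ∈ S
    · have h1 : Y t = X t := if_pos (Or.inr hts)
      rw [h1]
      exact hXm t hts
    · have h1 : Y t = H t := if_neg (by simp [ht.1, ht.2, hts])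
      rw [h1]
      exact (Lp.stronglyMeasurable _).measurable
  · intro t ht
    refine TendstoInMeasure.congr' ?_ (hYH t ht)
      (tendstoInMeasure_of_tendsto_Lp ((hH t ht).tendsto.mono_left nhdsWithin_le_nhds))
    filter_upwards [mem_nhdsWithin_of_mem_nhds (isOpen_Ioo.mem_nhds ht)] with r hr
    exact hYH r hr

end Existence

/-! ### Existence, uniqueness in law and transformation of bridges -/

section Bridge

variable {R V : ℝ} {S : Set ℝ} {Q : Measure (closeTimes R V S → ℝ)} [IsProbabilityMeasure Q]
  {π : ℝ → Kernel (ℝ × ℝ) ℝ} {p : ℝ → ℝ → Kernel (ℝ × ℝ) ℝ} {η θ σ τ γ zR zV : ℝ}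

theorem left_mem_closeTimes : R ∈ closeTimes R V S := mem_insert _ _

theorem right_mem_closeTimes : V ∈ closeTimes R V S := mem_insert_of_mem _ (mem_insert _ _)

theorem subset_closeTimes : S ⊆ closeTimes R V S :=
  (subset_insert _ _).trans (subset_insert _ _)

/-- The bridge lives on path space itself: the coordinate process on `S`, extended by `L²`
continuity. -/
theorem IsBridgeLaw.exists_bridge (h : IsBridgeLaw R V S Q π p η θ σ τ γ zR zV)
    (hS : S ⊆ Ioo R V) (hd : Ioo R V ⊆ closure S)
    (hp : ∀ s ∈ S, ∀ t ∈ S, s < t → IsMarkovKernel (p s t))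
    (hk : 0 ≤ KB η θ σ τ γ R V zR zV / denom σ τ γ R V) :
    ∃ X : ℝ → (closeTimes R V S → ℝ) → ℝ, IsBridge Q X R V zR zV π p S := by
  have hC : ∀ s ∈ S, ∀ t ∈ S, _ := fun s hs t ht => h.harness.integral_sub_sq_le
    left_mem_closeTimes right_mem_closeTimes h.left_end h.right_end hk (subset_closeTimes hs)
    (subset_closeTimes ht) (hS hs) (hS ht)
  obtain ⟨X, h1, h2, h3⟩ := exists_extension_of_dense hS hd
    (fun t ht => h.harness.memLp t (subset_closeTimes ht)) hC (fun t _ => measurable_coord t)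
  have hXS : ∀ t ∈ S, X t = coord (closeTimes R V S) t := fun t ht => h1 t (Or.inr ht)
  have hXR : X R = coord (closeTimes R V S) R := h1 R (Or.inl (by simp))
  have hXV : X V = coord (closeTimes R V S) V := h1 V (Or.inl (by simp))
  have hXm : ∀ t ∈ S, Measurable (X t) := fun t ht => h2 t (hS ht)
  have hpast : ∀ s, pastField S X s = pastField S (coord (closeTimes R V S)) s := fun s =>
    iSup_congr fun r => iSup_congr fun hr => by rw [hXS r hr.1]
  refine ⟨X, ?_, ?_, ?_, ?_, ?_, h3⟩
  · intro t ht
    rcases ht.1.eq_or_lt with rfl | hRt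
    · rw [hXR]; exact measurable_coord _
    · rcases ht.2.eq_or_lt with rfl | htV
      · rw [hXV]; exact measurable_coord _
      · exact h2 t ⟨hRt, htV⟩
  · rw [hXR]; exact h.left_end
  · rw [hXV]; exact h.right_end
  · intro t ht
    rw [hXS t ht, h.marginal t ht]
  · intro s hs t ht hst U hU
    have := hp s hs t ht hst
    have hκ : Measurable fun x : ℝ => (p s t (x, zV)).real U :=
      (((p s t).measurable_coe hU).ennreal_toReal).comp (measurable_id.prodMk measurable_const)
    refine condExp_ae_eq_of_forall_setIntegral_sub_eq_zero (pastField_le hXm)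
      ((integrable_const (1 : ℝ)).indicator (hXm t ht hU)) ?_
      (hκ.comp (measurable_pastField hs le_rfl)).stronglyMeasurable ?_
    · refine Integrable.of_bound (hκ.comp (hXm s hs)).aestronglyMeasurable 1
        (ae_of_all _ fun ω => ?_)
      rw [Real.norm_eq_abs, abs_of_nonneg measureReal_nonneg]
      exact measureReal_le_one
    · intro A hA
      rw [hpast] at hA
      have := h.transition s hs t ht hst U hU A hA
      simpa only [fixEnd_apply, hXS s hs, hXS t ht] using this

variable {Ω : Type*} [mΩ : MeasurableSpace Ω] {P : Measure Ω} [IsProbabilityMeasure P]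
  {X : ℝ → Ω → ℝ}

theorem IsBridge.hasTransitions (hX : IsBridge P X R V zR zV π p S) (hS : S ⊆ Ioo R V)
    (hp : ∀ s ∈ S, ∀ t ∈ S, s < t → IsMarkovKernel (p s t)) :
    HasTransitions P S X (fixEnd p zV) := by
  intro s hs t ht hst U hU
  have := hp s hs t ht hst
  have hXm : ∀ t ∈ S, Measurable (X t) := fun t ht => hX.measurable t (Ioo_subset_Icc_self (hS ht))
  have hκ : Measurable fun x : ℝ => (p s t (x, zV)).real U :=
    (((p s t).measurable_coe hU).ennreal_toReal).comp (measurable_id.prodMk measurable_const)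
  refine setIntegral_sub_eq_zero_of_condExp (pastField_le hXm) le_rfl
    ((integrable_const (1 : ℝ)).indicator (hXm t ht hU)) ?_ (hX.transition s hs t ht hst U hU)
  refine Integrable.of_bound (hκ.comp (hXm s hs)).aestronglyMeasurable 1 (ae_of_all _ fun ω => ?_)
  rw [Real.norm_eq_abs, fixEnd_apply, abs_of_nonneg measureReal_nonneg]
  exact measureReal_le_one

open Classical in
/-- Adds the endpoint values to a path on `S`. -/
noncomputable def addEnds (R V : ℝ) (S : Set ℝ) (zR zV : ℝ) (y : S → ℝ) : closeTimes R V S → ℝ :=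
  fun i => if h : i.1 ∈ S then y ⟨i.1, h⟩ else if i.1 = R then zR else zV

theorem measurable_addEnds : Measurable (addEnds R V S zR zV) := by
  refine measurable_pi_lambda _ fun i => ?_
  by_cases h : i.1 ∈ S
  · simp only [addEnds, h, dite_true]
    exact measurable_pi_apply _
  · simp only [addEnds, h, dite_false]
    exact measurable_const

/-- The transitions concern only times of `S`. Because the endpoint values are almost surely
constant, the law on `S` already determines the law with endpoints included. -/
theorem path_ae_eq_addEnds {Ω : Type*} [MeasurableSpace Ω] {P : Measure Ω} {X : ℝ → Ω → ℝ}
    (hR : ∀ᵐ ω ∂P, X R ω = zR) (hV : ∀ᵐ ω ∂P, X V ω = zV) :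
    path (closeTimes R V S) X =ᵐ[P] addEnds R V S zR zV ∘ path S X := by
  filter_upwards [hR, hV] with ω h1 h2
  ext i
  by_cases h : i.1 ∈ S
  · simp [addEnds, path, h]
  · by_cases hi : i.1 = R
    · simp [addEnds, path, hi, h1, show R ∉ S from hi ▸ h]
    · have hiV : i.1 = V := (i.2.resolve_left hi).resolve_right h
      simp only [Function.comp_apply, addEnds, h, dite_false, hi, if_false, path]
      rw [hiV, h2]

/-- Every bridge has the given law at the times `S ∪ {R, V}`. -/
theorem IsBridgeLaw.map_path_eq (h : IsBridgeLaw R V S Q π p η θ σ τ γ zR zV)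
    (hX : IsBridge P X R V zR zV π p S) (hS : S ⊆ Ioo R V)
    (hp : ∀ s ∈ S, ∀ t ∈ S, s < t → IsMarkovKernel (p s t)) :
    P.map (path (closeTimes R V S) X) = Q := by
  have hXm : ∀ t ∈ S, Measurable (X t) := fun t ht => hX.measurable t (Ioo_subset_Icc_self (hS ht))
  have hq : ∀ s ∈ S, ∀ t ∈ S, s < t → IsMarkovKernel (fixEnd p zV s t) := fun s hs t ht hst => by
    have := hp s hs t ht hst
    exact Kernel.IsMarkovKernel.comap _ _
  have key := map_path_eq_of_transitions hq hXm (fun t _ => measurable_coord t)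
    (hX.hasTransitions hS hp) h.transition
    (fun t ht => (hX.marginal t ht).trans (h.marginal t ht).symm)
  have hid : path (closeTimes R V S) (coord (closeTimes R V S)) = id := by
    ext x i
    simp only [path, coord, id_eq]
    rw [dif_pos i.2]
  rw [Measure.map_congr (path_ae_eq_addEnds hX.left_end hX.right_end),
    ← Measure.map_map measurable_addEnds (measurable_path hXm), key,
    Measure.map_map measurable_addEnds (measurable_path fun t _ => measurable_coord t),
    ← Measure.map_congr (path_ae_eq_addEnds h.left_end h.right_end), hid, Measure.map_id]

theorem continuous_interp (R V zR zV : ℝ) : Continuous fun t => interp R t V zR zV := by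
  unfold interp
  fun_prop

/-- The transformation of a bridge is a quadratic harness. -/
theorem IsBridgeLaw.isQuadraticHarness_transform
    (h : IsBridgeLaw R V S Q π p η θ σ τ γ zR zV)
    (hX : IsBridge P X R V zR zV π p S) (hS : S ⊆ Ioo R V) (hd : Ioo R V ⊆ closure S)
    (hp : ∀ s ∈ S, ∀ t ∈ S, s < t → IsMarkovKernel (p s t)) (hR : 0 < R) (hRV : R < V)
    (hγ : -1 ≤ γ) (hD : 0 < denom σ τ γ R V) (hK : 0 < KB η θ σ τ γ R V zR zV)
    (hden : ∀ s ∈ Ioo R V, ∀ u ∈ Ioo R V, s < u → denom σ τ γ s u ≠ 0) :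
    IsQuadraticHarness P (Ioi 0)
      (outerField (Ioi 0) (transform R V zR zV (MB η θ σ τ γ R V zR zV) X))
      (transform R V zR zV (MB η θ σ τ γ R V zR zV) X)
      (etaB η θ σ τ γ R V zR zV) (thetaB η θ σ τ γ R V zR zV) (sigmaB σ τ γ R V)
      (tauB σ τ γ R V) (gammaB σ τ γ R V) := by
  have hsub : closeTimes R V S ⊆ Icc R V := by
    rintro t (rfl | rfl | ht)
    · exact ⟨le_rfl, hRV.le⟩
    · exact ⟨hRV.le, le_rfl⟩
    · exact Ioo_subset_Icc_self (hS ht)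
  -- Equality in law with `Q` makes the given bridge a harness on the countable time set.
  have hH : IsHarnessOn P (closeTimes R V S) X η θ σ τ γ := by
    rw [← isHarnessOn_coord_iff fun t ht => hX.measurable t (hsub ht), h.map_path_eq hX hS hp]
    exact h.harness
  have hC : ∀ s ∈ S, ∀ t ∈ S, _ := fun s hs t ht => hH.integral_sub_sq_le
    left_mem_closeTimes right_mem_closeTimes hX.left_end hX.right_end (div_pos hK hD).le
    (subset_closeTimes hs) (subset_closeTimes ht) (hS hs) (hS ht)
  have hHS := hH.mono subset_closeTimes
  have hXm : ∀ t ∈ Ioo R V, Measurable (X t) := fun t ht =>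
    hX.measurable t (Ioo_subset_Icc_self ht)
  have hmom := moments_of_dense hd hXm hHS.memLp hX.right_continuous hC
    (continuous_interp R V zR zV)
    (fun t ht => hH.integral_eq_interp left_mem_closeTimes right_mem_closeTimes hX.left_end
      hX.right_end (subset_closeTimes ht) (hS ht).1 (hS ht).2)
    (c := fun s t => interp R s V zR zV * interp R t V zR zV
      + (V - max s t) * (min s t - R) * (KB η θ σ τ γ R V zR zV / denom σ τ γ R V))
    (by
      have := continuous_interp R V zR zV
      fun_prop)
    (fun s hs t ht => hH.integral_mul left_mem_closeTimes right_mem_closeTimes hX.left_end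
      hX.right_end (subset_closeTimes hs) (subset_closeTimes ht) (hS hs) (hS ht))
  exact QHBridge.isQuadraticHarness_transform
    (hHS.extend hd hXm hX.right_continuous hC hden) hR hRV hγ hD hK hden hmom.1 hmom.2

end Bridge

/-! ### Conditional laws of the given harness as bridge laws -/

/-- The field generated by the values outside `(s, V)` on a set of times in `[R, V]` is generated
by the past up to `s` and the value at `V`. -/
theorem outerField_le_pastField_sup {Ω : Type*} {T I : Set ℝ} {Z : ℝ → Ω → ℝ} {R V s : ℝ}
    (hI : I ⊆ Icc R V) (hIT : I ⊆ T) :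
    outerField I Z s V ≤ pastField T Z s ⊔ MeasurableSpace.comap (Z V) inferInstance := by
  refine iSup₂_le fun r hr => ?_
  rcases hr.2 with h | h
  · exact (comap_le_pastField (hIT hr.1) h).trans le_sup_left
  · rw [le_antisymm (hI hr.1).2 h]
    exact le_sup_right

theorem pastField_le_outerField {Ω : Type*} {S I : Set ℝ} {X : ℝ → Ω → ℝ} (hI : S ⊆ I) {s u : ℝ} :
    pastField S X s ≤ outerField I X s u :=
  iSup₂_le fun _ hr => comap_le_outerField (hI hr.1) (Or.inl hr.2)

section ConditionalLaw

variable {Ω : Type*} [MeasurableSpace Ω] {μ : Measure Ω} {T S : Set ℝ} {Z : ℝ → Ω → ℝ} {R V : ℝ}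
  {π : ℝ → Kernel (ℝ × ℝ) ℝ} {p : ℝ → ℝ → Kernel (ℝ × ℝ) ℝ}

theorem closeTimes_subset_Icc (hS : S ⊆ Ioo R V) (hRV : R < V) :
    closeTimes R V S ⊆ Icc R V := by
  rintro r (rfl | rfl | hr)
  · exact left_mem_Icc.2 hRV.le
  · exact right_mem_Icc.2 hRV.le
  · exact Ioo_subset_Icc_self (hS hr)

theorem map_endpoints_map_path {I : Set ℝ} (hR : R ∈ I) (hV : V ∈ I)
    (hZ : ∀ t ∈ I, Measurable (Z t)) :
    (μ.map (path I Z)).map (endpoints I R V) = μ.map fun ω => (Z R ω, Z V ω) := by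
  rw [Measure.map_map measurable_endpoints (measurable_path hZ)]
  congr 1
  ext ω : 1
  simp only [Function.comp_apply, endpoints, coord_path hR, coord_path hV]

/-- The conditional law of the path given its endpoints has the prescribed marginals. -/
theorem IsCondLaws.ae_marginal [IsFiniteMeasure μ] (h : IsCondLaws μ Z R V π p)
    {I : Set ℝ} [Countable I] (hR : R ∈ I) (hV : V ∈ I) (hZ : ∀ t ∈ I, Measurable (Z t)) {t : ℝ}
    (ht : t ∈ I) (htRV : t ∈ Ioo R V) :
    ∀ᵐ z ∂(μ.map (path I Z)).map (endpoints I R V),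
      (condDistrib id (endpoints I R V) (μ.map (path I Z)) z).map (coord I t) = π t z := by
  have := h.markov_marginal t htRV
  refine ae_condDistrib_map_coord _ ?_
  rw [map_endpoints_map_path hR hV hZ, ← (h.marginal t htRV).map_eq,
    Measure.map_map (measurable_endpoints.prodMk (measurable_coord t)) (measurable_path hZ)]
  congr 1
  ext ω : 1
  simp only [Function.comp_apply, endpoints, coord_path hR, coord_path hV, coord_path ht]

/-- The conditional law of the path given its endpoints has the prescribed transitions. -/
theorem IsCondLaws.ae_transition [IsProbabilityMeasure μ] (h : IsCondLaws μ Z R V π p)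
    (hM : IsMarkovOn μ T Z) (hZ : ∀ t ∈ T, Measurable (Z t))
    {I : Set ℝ} [Countable I] (hI : I ⊆ Icc R V) (hIT : I ⊆ T) (hR : R ∈ I) (hV : V ∈ I)
    {s t : ℝ} (hs : s ∈ I) (ht : t ∈ I) (hsRV : s ∈ Ioo R V) (htRV : t ∈ Ioo R V) (hst : s < t) :
    ∀ᵐ z ∂(μ.map (path I Z)).map (endpoints I R V), ∀ U, MeasurableSet U →
      ∀ A, MeasurableSet[outerField I (coord I) s V] A →
      ∫ x in A, ((coord I t ⁻¹' U).indicator (fun _ => (1 : ℝ)) x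
        - (p s t (coord I s x, coord I V x)).real U)
          ∂(condDistrib id (endpoints I R V) (μ.map (path I Z)) z) = 0 := by
  have := h.markov_transition s hsRV t htRV hst
  have hp : Measurable (path I Z) := measurable_path fun t ht => hZ t (hIT ht)
  refine ae_condDistrib_transition _ hR hV hsRV.1.le fun U hU A hA => ?_
  have hκ : Measurable fun y => (p s t y).real U :=
    ((p s t).measurable_coe hU).ennreal_toReal
  have hm : Measurable fun x : I → ℝ => (coord I t ⁻¹' U).indicator (fun _ => (1 : ℝ)) x
      - (p s t (coord I s x, coord I V x)).real U :=
    (measurable_const.indicator (measurable_coord t hU)).sub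
      (hκ.comp ((measurable_coord s).prodMk (measurable_coord V)))
  have hA' : MeasurableSet[outerField I Z s V] (path I Z ⁻¹' A) := by
    rw [outerField_eq_comap_path]
    exact ⟨A, hA, rfl⟩
  rw [setIntegral_map (outerField_le (fun t _ => measurable_coord t) A hA)
    hm.aestronglyMeasurable hp.aemeasurable]
  -- The zero on the right is replaced by the corresponding integral for `Z`, which vanishes since
  -- the event lies in the field of the past up to `s` and `Z V`.
  rw [← hM.setIntegral_transition hZ (hIT hs) (hIT ht) (hIT hV) hst htRV.2
    (h.transition s hsRV t htRV hst) hU _ (outerField_le_pastField_sup hI hIT _ hA')]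
  have hi : ∀ ω, (coord I t ⁻¹' U).indicator (fun _ => (1 : ℝ)) (path I Z ω)
      = (Z t ⁻¹' U).indicator (fun _ => 1) ω := fun ω => by
    rw [← coord_comp_path (X := Z) ht]
    rfl
  simp only [hi, coord_path hs, coord_path hV]

/-- The conditional law of a Markov quadratic harness given its values at `R` and `V` is almost
surely the law of a bridge. -/
theorem IsQuadraticHarness.ae_isBridgeLaw [IsProbabilityMeasure μ]
    {F : ℝ → ℝ → MeasurableSpace Ω} {η θ σ τ γ : ℝ}
    (hZ : IsQuadraticHarness μ T F Z η θ σ τ γ) (hM : IsMarkovOn μ T Z) (hR : R ∈ T) (hV : V ∈ T)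
    (hRV : R < V) (hcond : IsCondLaws μ Z R V π p) (hS : S ⊆ Ioo R V) (hSc : S.Countable) :
    ∀ᵐ z ∂(μ.map fun ω => (Z R ω, Z V ω)), ∃ Q : Measure (closeTimes R V S → ℝ),
      IsProbabilityMeasure Q ∧ IsBridgeLaw R V S Q π p η θ σ τ γ z.1 z.2 := by
  have hc : Countable (closeTimes R V S) := ((hSc.insert V).insert R).to_subtype
  have hI := closeTimes_subset_Icc hS hRV
  have hIT : closeTimes R V S ⊆ T := hI.trans (hZ.ordConnected.out hR hV)
  have hZm := hZ.measurable_process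
  have hZI : ∀ t ∈ closeTimes R V S, Measurable (Z t) := fun t ht => hZm t (hIT ht)
  have hRI : R ∈ closeTimes R V S := left_mem_closeTimes
  have hVI : V ∈ closeTimes R V S := right_mem_closeTimes
  have hρ : IsProbabilityMeasure (μ.map (path (closeTimes R V S) Z)) :=
    Measure.isProbabilityMeasure_map (measurable_path hZI).aemeasurable
  rw [← map_endpoints_map_path hRI hVI hZI]
  have h1 := IsHarnessOn.ae_condDistrib (μ.map (path (closeTimes R V S) Z))
    ((isHarnessOn_coord_iff hZI).2 (hZ.isHarnessOn hIT)) hRI hVI hI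
  have h2 := ae_condDistrib_endpoints (R := R) (V := V) (μ.map (path (closeTimes R V S) Z))
  have h3 := (ae_ball_iff hSc).2 fun t ht =>
    hcond.ae_marginal hRI hVI hZI (subset_closeTimes ht) (hS ht)
  have h4 := (ae_ball_iff hSc).2 fun s hs => (ae_ball_iff hSc).2 fun t ht => ae_all_iff.2
    fun hst : s < t => hcond.ae_transition hM hZm hI hIT hRI hVI (subset_closeTimes hs)
      (subset_closeTimes ht) (hS hs) (hS ht) hst
  filter_upwards [h1, h2, h3, h4] with z hz1 hz2 hz3 hz4
  refine ⟨_, inferInstance, hz1, ?_, ?_, hz3, ?_⟩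
  · filter_upwards [hz2] with x hx
    exact congrArg Prod.fst hx
  · filter_upwards [hz2] with x hx
    exact congrArg Prod.snd hx
  · intro s hs t ht hst U hU A hA
    rw [← hz4 s hs t ht hst U hU A (pastField_le_outerField subset_closeTimes A hA)]
    -- Under the conditional law the value at `V` is almost surely `z.2`, so the terminal argument
    -- of the kernel may be frozen.
    refine integral_congr_ae (ae_restrict_of_ae ?_)
    filter_upwards [hz2] with x hx
    have hx2 : coord (closeTimes R V S) V x = z.2 := congrArg Prod.snd hx
    simp only [fixEnd_apply, hx2]

end ConditionalLaw

theorem IsQuadraticHarness.ae_map_denom_pos {Ω : Type*} [MeasurableSpace Ω] {μ : Measure Ω}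
    [IsProbabilityMeasure μ] {T : Set ℝ} {F : ℝ → ℝ → MeasurableSpace Ω} {X : ℝ → Ω → ℝ}
    {η θ σ τ γ : ℝ} (h : IsQuadraticHarness μ T F X η θ σ τ γ) {s u : ℝ} (hs : s ∈ T) (hu : u ∈ T)
    (hsu : s < u) :
    ∀ᵐ z ∂(μ.map fun ω => (X s ω, X u ω)),
      0 < KB η θ σ τ γ s u z.1 z.2 → 0 < denom σ τ γ s u := by
  have hm : Measurable fun z : ℝ × ℝ => KB η θ σ τ γ s u z.1 z.2 := by
    unfold KB K slope intercept
    fun_prop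
  refine (ae_map_iff ((h.measurable_process s hs).prodMk
    (h.measurable_process u hu)).aemeasurable ?_).2 (h.ae_denom_pos hs hu hsu)
  exact (measurableSet_lt measurable_const hm).imp (MeasurableSet.const _)

end QHBridge

/-! ### The main theorem -/

theorem mainTheorem3 {Ω : Type*} [MeasurableSpace Ω] (μ : Measure Ω)
    [IsProbabilityMeasure μ] (T : Set ℝ) (F : ℝ → ℝ → MeasurableSpace Ω) (Z : ℝ → Ω → ℝ)
    (η θ σ τ γ : ℝ)
    (hZ : QHBridge.IsQuadraticHarness μ T F Z η θ σ τ γ)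
    (hMarkov : QHBridge.IsMarkovOn μ T Z)
    (R V : ℝ) (hR : R ∈ T) (hV : V ∈ T) (hRV : R < V)
    (π : ℝ → Kernel (ℝ × ℝ) ℝ) (p : ℝ → ℝ → Kernel (ℝ × ℝ) ℝ)
    (hcond : QHBridge.IsCondLaws μ Z R V π p)
    (S : Set ℝ) (hS : S ⊆ Ioo R V) (hS_countable : S.Countable) (hS_dense : Ioo R V ⊆ closure S) :
    ∀ᵐ z ∂(μ.map fun ω => (Z R ω, Z V ω)),
      0 < QHBridge.KB η θ σ τ γ R V z.1 z.2 →
        0 < QHBridge.denom σ τ γ R V ∧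
        QHBridge.MB η θ σ τ γ R V z.1 z.2 ^ 2 =
          QHBridge.KB η θ σ τ γ R V z.1 z.2 / QHBridge.denom σ τ γ R V ∧
        0 < QHBridge.MB η θ σ τ γ R V z.1 z.2 ^ 2 ∧
        (∃ (Ω' : Type) (_ : MeasurableSpace Ω') (P : Measure Ω') (X : ℝ → Ω' → ℝ),
          IsProbabilityMeasure P ∧ QHBridge.IsBridge P X R V z.1 z.2 π p S) ∧
        ∀ (Ω' : Type*) (_ : MeasurableSpace Ω') (P : Measure Ω') (X Y : ℝ → Ω' → ℝ),
          IsProbabilityMeasure P → QHBridge.IsBridge P X R V z.1 z.2 π p S →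
          Y = QHBridge.transform R V z.1 z.2 (QHBridge.MB η θ σ τ γ R V z.1 z.2) X →
          QHBridge.IsQuadraticHarness P (Ioi 0) (QHBridge.outerField (Ioi 0) Y) Y
            (QHBridge.etaB η θ σ τ γ R V z.1 z.2) (QHBridge.thetaB η θ σ τ γ R V z.1 z.2)
            (QHBridge.sigmaB σ τ γ R V) (QHBridge.tauB σ τ γ R V)
            (QHBridge.gammaB σ τ γ R V) := by

  have hTI : Icc R V ⊆ T := hZ.ordConnected.out hR hV
  have hp : ∀ s ∈ S, ∀ t ∈ S, s < t → IsMarkovKernel (p s t) := fun s hs t ht hst =>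
    hcond.markov_transition s (hS hs) t (hS ht) hst
  -- The null set discarded here is chosen before any bridge is considered, so the conclusion holds
  -- for all bridges simultaneously.
  filter_upwards [hZ.ae_isBridgeLaw hMarkov hR hV hRV hcond hS hS_countable,
    hZ.ae_map_denom_pos hR hV hRV] with z hz hpos hK
  obtain ⟨Q, hQ, hlaw⟩ := hz
  have hD := hpos hK
  have hq := div_pos hK hD
  have hM : QHBridge.MB η θ σ τ γ R V z.1 z.2 ^ 2 =
      QHBridge.KB η θ σ τ γ R V z.1 z.2 / QHBridge.denom σ τ γ R V := Real.sq_sqrt hq.le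
  refine ⟨hD, hM, hM ▸ hq, ?_, ?_⟩
  · obtain ⟨X, hX⟩ := hlaw.exists_bridge hS hS_dense hp hq.le
    exact ⟨_, _, Q, X, hQ, hX⟩
  · rintro Ω' _ P X Y hP hX rfl
    exact hlaw.isQuadraticHarness_transform hX hS hS_dense hp (hZ.pos hR) hRV hZ.gamma_ge hD hK
      fun s hs u hu hsu => hZ.denom_ne_zero (hTI (Ioo_subset_Icc_self hs))
        (hTI (Ioo_subset_Icc_self hu)) hsu
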